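/- **Notation.** For $a\in\mathbb C$, $(a)_n=a(a+1)\cdots(a+n-1)$. Write $n=2n_e+n_p$ with $n_p\in\{0,1\}$ and put $g=\rho_1+\rho_2-r_1-r_2$. The monic Bannai–Ito polynomials $B_n(x)=B_n(x;\rho_1,\rho_2,r_1,r_2)$, $n\ge 0$, are $$\begin{aligned}\tfrac1{\eta_n}B_n(x)={}&{}_4F_3\!\left({-n_e,\;n_e+g+1,\;x-r_1+\frac12,\;-x-r_1+\frac12\atop 1-r_1-r_2,\;\rho_1-r_1+\frac12,\;\rho_2-r_1+\frac12};1\right)\\&+\frac{(-1)^n(n_e+n_p+g\,n_p)(x-r_1+\frac12)}{(\rho_1-r_1+\frac12)(\rho_2-r_1+\frac12)}\,{}_4F_3\!\left({-n_e-n_p+1,\;n_e+n_p+g+1,\;x-r_1+\frac32,\;-x-r_1+\frac12\atop 1-r_1-r_2,\;\rho_1-r_1+\frac32,\;\rho_2-r_1+\frac32};1\right),\end{aligned}$$ $$\eta_n=(-1)^n\frac{(\rho_1-r_1+\frac12)_{n_e+n_p}(\rho_2-r_1+\frac12)_{n_e+n_p}(1-r_1-r_2)_{n_e}}{(n_e+g+1)_{n_e+n_p}},$$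 where the Pochhammer symbols in the denominators of the series are cancelled against the factors of $\eta_n$ (so only $(n_e+g+1)_{n_e+n_p}\neq0$ is needed). Put $$A_n=\begin{cases}\frac{(n+2\rho_1-2r_1+1)(n+2\rho_1-2r_2+1)}{4(n+g+1)}&n\text{ even},\\ \frac{(n+2g+1)(n+2\rho_1+2\rho_2+1)}{4(n+g+1)}&n\text{ odd},\end{cases}\qquad C_n=\begin{cases}-\frac{n(n-2r_1-2r_2)}{4(n+g)}&n\text{ even},\\-\frac{(n+2\rho_2-2r_2)(n+2\rho_2-2r_1)}{4(n+g)}&n\text{ odd}.\end{cases}$$ With $\pi_n=1$ for $n$ even and $\pi_n=0$ for $n$ odd, the untruncated bivariate Bannai–Ito polynomials with parameters $\alpha,\beta,\gamma,\delta,\epsilon\in\mathbb C$ are, for $n_1,n_2\ge0$, $$\begin{aligned}B_{n_1,n_2}(z_1,z_2)={}&B_{n_1}\!\left(z_1-\tfrac14;\,\beta,\;z_2+\epsilon-\tfrac14,\;\alpha,\;z_2-\epsilon+\tfrac14\right)\\&\times B_{n_2}\!\left((-1)^{n_1}z_2-\tfrac14;\,\beta+\epsilon+\tfrac{n_1}2,\;(1-\pi_{n_1})\gamma+\pi_{n_1}\delta,\;\alpha-\epsilon-\tfrac{n_1}2,\;(\pi_{n_1}-1)\delta-\pi_{n_1}\gamma\right),\end{aligned}$$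 and $B_{n_1,n_2}=0$ if $n_1<0$ or $n_2<0$. **Proposition.** Let $\alpha,\beta,\gamma,\delta,\epsilon\in\mathbb C$ be such that $-\alpha+\beta+2\epsilon+\frac12+k\ne0$ and $-\alpha+\beta+\gamma+\delta+2\epsilon+1+k\neq0$ for all integers $k\ge0$. For all $n_1,n_2\ge0$ and all $z_1,z_2\in\mathbb C$ the following hold. (1) With $A_n,C_n$ taken at the four parameters $\rho_1,\rho_2,r_1,r_2$ of the second factor of $B_{n_1,n_2}$, $$\left((-1)^{n_1}z_2-\tfrac14\right)B_{n_1,n_2}=B_{n_1,n_2+1}+\left(\beta+\epsilon+\tfrac{n_1}2-A_{n_2}-C_{n_2}\right)B_{n_1,n_2}+A_{n_2-1}C_{n_2}B_{n_1,n_2-1}.$$ (2) $$\begin{aligned}(z_1-\alpha^2+\beta^2)B_{n_1,n_2}={}&\theta^{(1)}B_{n_1+1,n_2}+\theta^{(2)}B_{n_1+1,n_2-1}+\theta^{(3)}B_{n_1+1,n_2-2}\\&+\theta^{(4)}B_{n_1,n_2+1}+\theta^{(5)}B_{n_1,n_2}+\theta^{(6)}B_{n_1,n_2-1}\\&+\theta^{(7)}B_{n_1-1,n_2+2}+\theta^{(8)}B_{n_1-1,n_2+1}+\theta^{(9)}B_{n_1-1,n_2},\end{aligned}$$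 where $\theta^{(i)}=\theta^{(i)}_{n_1,n_2}$ is given as follows. Put $M=n_1+n_2$, $S=-\alpha+\beta+\gamma+\delta+2\epsilon+M$, $T=-2\alpha+2\beta+4\epsilon+2n_1$, $a_\gamma=-2\alpha+2\gamma+2\epsilon+M$, $a_\delta=-2\alpha+2\delta+2\epsilon+M$, $b_\gamma=2\beta+2\gamma+2\epsilon+M$, $b_\delta=2\beta+2\delta+2\epsilon+M$, $G=-\alpha+\beta+\gamma+\delta+2\epsilon+n_1+\frac{n_2}2$, $G'=-\alpha+\beta+2\epsilon+n_1+\frac{n_2}2$, and $X=n_1(-2\alpha+2\beta+4\epsilon+n_1-1)$ for $n_1$ even, $X=(4\epsilon+n_1-1)(-2\alpha+2\beta+n_1)$ for $n_1$ odd. The four cases are listed in the order ($n_1$ even, $n_2$ even), (even, odd), (odd, even), (odd, odd), and the two cases for $\theta^{(4)}$ in the order $n_1$ even, $n_1$ odd; a product of fractions with a factor $n_1=0$ or $n_2=0$ in a numerator is $0$ (even if some denominator vanishes; the same convention gives $C_0=0$). All other denominators are nonzero under the hypotheses below. $$\theta^{(1)}=(-1)^{n_2},\qquad \theta^{(7)}=(-1)^{n_2}\frac{X}{(T-1)^2},$$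 $$\theta^{(2)}=\begin{cases}\frac{n_2}4\left(\frac{b_\gamma+1}{S+1}-\frac{a_\gamma}{S}\right)\\ \frac14(2\gamma+2\delta+n_2)\left(\frac{a_\gamma+1}{S+1}-\frac{b_\gamma}{S}\right)\\ \frac{n_2}4\left(\frac{b_\gamma}{S}-\frac{a_\gamma+1}{S+1}\right)\\ \frac14(2\gamma+2\delta+n_2)\left(\frac{a_\gamma}{S}-\frac{b_\gamma+1}{S+1}\right)\end{cases}\qquad \theta^{(3)}=\begin{cases}-\frac{n_2(2\gamma+2\delta+n_2-1)a_\gamma b_\delta}{16S^2}\\ \frac{(n_2-1)(2\gamma+2\delta+n_2)a_\delta b_\gamma}{16S^2}\\ -\frac{n_2(2\gamma+2\delta+n_2-1)a_\delta b_\gamma}{16S^2}\\ \frac{(n_2-1)(2\gamma+2\delta+n_2)a_\gamma b_\delta}{16S^2}\end{cases}$$ $$\theta^{(4)}=\begin{cases}1-\frac{4\epsilon+n_1}{T+1}-\frac{n_1}{T-1}\\ 1-\frac{4\epsilon+n_1-1}{T-1}-\frac{n_1+1}{T+1}\end{cases}\qquad \theta^{(5)}=\frac14\theta^{(4)}\cdot\begin{cases}\left(2\alpha+2\beta-\frac{b_\gamma+1}{S+1}+1\right)\left(T-\frac{n_2}{S}+1\right)\\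 \left(2\alpha+2\beta+\frac{b_\gamma}{S}-1\right)\left(T+\frac{n_2+1}{S+1}-1\right)\\ \left(2\alpha+2\beta+\frac{a_\gamma+1}{S+1}-1\right)\left(T-\frac{n_2}{S}+1\right)\\ \left(2\alpha+2\beta-\frac{a_\gamma}{S}+1\right)\left(T+\frac{n_2+1}{S+1}-1\right)\end{cases}$$ $$\theta^{(6)}=\frac{1}{8(T+1)S^2}\cdot\begin{cases}n_2\left(2\alpha-2\beta+\frac{2n_1}{T-1}-1\right)a_\gamma b_\delta G\\ (2\gamma+2\delta+n_2)\left(2\alpha-2\beta+\frac{2n_1}{T-1}-1\right)a_\delta b_\gamma G'\\ n_2\left(2\alpha-2\beta+\frac{8\epsilon+2n_1-2}{T-1}-1\right)a_\delta b_\gamma G\\ (2\gamma+2\delta+n_2)\left(2\alpha-2\beta+\frac{8\epsilon+2n_1-2}{T-1}-1\right)a_\gamma b_\delta G'\end{cases}$$ $$\theta^{(8)}=\frac{X}{2(T-1)^2}\cdot\begin{cases}-\frac{G}{S+1}\left(2\alpha+2\beta-\frac{a_\gamma}{S}+1\right)\\ \frac{G'}{S}\left(2\alpha+2\beta+\frac{a_\gamma+1}{S+1}-1\right)\\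 -\frac{G}{S}\left(2\alpha+2\beta+\frac{a_\gamma+1}{S+1}-1\right)\\ \frac{G'}{S+1}\left(2\alpha+2\beta-\frac{a_\gamma}{S}+1\right)\end{cases}\qquad \theta^{(9)}=\frac{(-1)^{n_2+1}X}{8(T-1)^2S^2}\cdot\begin{cases}(T+n_2-1)a_\gamma b_\delta G\\ (T+n_2)a_\delta b_\gamma(G-\frac12)\\ (T+n_2-1)a_\delta b_\gamma G\\ (T+n_2)a_\gamma b_\delta(G-\frac12)\end{cases}$$ (3) Each $B_{n_1,n_2}(z_1,z_2)$ is a polynomial in $z_1$ and $z_2$. -/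

import Mathlib

namespace BannaiIto

noncomputable section

/-- The Pochhammer symbol `(a)_n = a (a + 1) ⋯ (a + n - 1)`. -/
def poch (a : ℂ) (n : ℕ) : ℂ := ∏ i ∈ Finset.range n, (a + i)

/-- The generalized hypergeometric series `₄F₃(a₁, a₂, a₃, a₄; b₁, b₂, b₃; z)`. -/
def hyp4F3 (a₁ a₂ a₃ a₄ b₁ b₂ b₃ z : ℂ) : ℂ :=
  ∑' k : ℕ, (poch a₁ k * poch a₂ k * poch a₃ k * poch a₄ k) /
    (poch b₁ k * poch b₂ k * poch b₃ k * (k.factorial : ℂ)) * z ^ k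

/-- The normalization coefficient `η_n`, where `n = 2 n_e + n_p`, `n_e = n / 2`, `n_p = n % 2`. -/
def eta (n : ℕ) (ρ₁ ρ₂ r₁ r₂ : ℂ) : ℂ :=
  (-1) ^ n *
    (poch (ρ₁ - r₁ + 1 / 2) (n / 2 + n % 2) * poch (ρ₂ - r₁ + 1 / 2) (n / 2 + n % 2) *
      poch (1 - r₁ - r₂) (n / 2)) /
    poch (((n / 2 : ℕ) : ℂ) + (ρ₁ + ρ₂ - r₁ - r₂) + 1) (n / 2 + n % 2)

/-- The combination of two `₄F₃` series that equals `B_n(x; ρ₁, ρ₂, r₁, r₂) / η_n`. -/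
def biSeries (n : ℕ) (x ρ₁ ρ₂ r₁ r₂ : ℂ) : ℂ :=
  hyp4F3 (-((n / 2 : ℕ) : ℂ)) (((n / 2 : ℕ) : ℂ) + (ρ₁ + ρ₂ - r₁ - r₂) + 1)
      (x - r₁ + 1 / 2) (-x - r₁ + 1 / 2)
      (1 - r₁ - r₂) (ρ₁ - r₁ + 1 / 2) (ρ₂ - r₁ + 1 / 2) 1 +
    (-1) ^ n *
      (((n / 2 : ℕ) : ℂ) + ((n % 2 : ℕ) : ℂ) + (ρ₁ + ρ₂ - r₁ - r₂) * ((n % 2 : ℕ) : ℂ)) *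
      (x - r₁ + 1 / 2) / ((ρ₁ - r₁ + 1 / 2) * (ρ₂ - r₁ + 1 / 2)) *
    hyp4F3 (-((n / 2 : ℕ) : ℂ) - ((n % 2 : ℕ) : ℂ) + 1)
      (((n / 2 : ℕ) : ℂ) + ((n % 2 : ℕ) : ℂ) + (ρ₁ + ρ₂ - r₁ - r₂) + 1)
      (x - r₁ + 3 / 2) (-x - r₁ + 1 / 2)
      (1 - r₁ - r₂) (ρ₁ - r₁ + 3 / 2) (ρ₂ - r₁ + 3 / 2) 1

/-- The monic Bannai-Ito polynomial `B_n(x; ρ₁, ρ₂, r₁, r₂)`: the product of `eta` and `biSeries`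
in which the denominator Pochhammer symbols of the two terminating series have been cancelled
against the factors of `eta`, e.g. `(b)_m / (b)_k = (b + k)_{m - k}`, so that no spurious
division by zero occurs (see `biPoly_eq` for the agreement). With `m = n_e` and `p = n_p`. -/
def biPoly (n : ℕ) (x ρ₁ ρ₂ r₁ r₂ : ℂ) : ℂ :=
  let m : ℕ := n / 2
  let p : ℕ := n % 2
  let g : ℂ := ρ₁ + ρ₂ - r₁ - r₂
  ((-1) ^ n *
      ∑ k ∈ Finset.range (m + 1),
        poch (-(m : ℂ)) k * poch ((m : ℂ) + g + 1) k *
          poch (x - r₁ + 1 / 2) k * poch (-x - r₁ + 1 / 2) k / (k.factorial : ℂ) *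
          (poch (1 - r₁ - r₂ + k) (m - k) * poch (ρ₁ - r₁ + 1 / 2 + k) (m + p - k) *
            poch (ρ₂ - r₁ + 1 / 2 + k) (m + p - k)) +
    ((m : ℂ) + (p : ℂ) + g * (p : ℂ)) * (x - r₁ + 1 / 2) *
      ∑ k ∈ Finset.range (m + p),
        poch (-(m : ℂ) - (p : ℂ) + 1) k * poch ((m : ℂ) + (p : ℂ) + g + 1) k *
          poch (x - r₁ + 3 / 2) k * poch (-x - r₁ + 1 / 2) k / (k.factorial : ℂ) *
          (poch (1 - r₁ - r₂ + k) (m - k) * poch (ρ₁ - r₁ + 3 / 2 + k) (m + p - 1 - k) *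
            poch (ρ₂ - r₁ + 3 / 2 + k) (m + p - 1 - k))) /
  poch ((m : ℂ) + g + 1) (m + p)

theorem poch_split (a : ℂ) {k n : ℕ} (h : k ≤ n) :
    poch a n = poch a k * poch (a + k) (n - k) := by
  obtain ⟨j, rfl⟩ := Nat.exists_eq_add_of_le h
  simp only [poch, Finset.prod_range_add, Nat.add_sub_cancel_left]
  congr 1
  refine Finset.prod_congr rfl fun i _ => ?_
  push_cast
  ring

theorem poch_succ_left (a : ℂ) (n : ℕ) : poch a (n + 1) = a * poch (a + 1) n := by
  simp only [poch, Finset.prod_range_succ']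
  rw [mul_comm]
  congr 1
  · simp
  · refine Finset.prod_congr rfl fun i _ => ?_
    push_cast
    ring

theorem poch_ne_zero {a : ℂ} {n : ℕ} (h : ∀ i < n, a + i ≠ 0) : poch a n ≠ 0 :=
  Finset.prod_ne_zero_iff.2 fun i hi => h i (Finset.mem_range.1 hi)

theorem poch_neg_eq_zero {m k : ℕ} (h : m < k) : poch (-(m : ℂ)) k = 0 :=
  Finset.prod_eq_zero (Finset.mem_range.2 h) (by simp)

/-- A `₄F₃` series at `1` with a numerator parameter `-m` terminates. -/
theorem hyp4F3_terminating (m : ℕ) (a₂ a₃ a₄ b₁ b₂ b₃ : ℂ) :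
    hyp4F3 (-(m : ℂ)) a₂ a₃ a₄ b₁ b₂ b₃ 1 =
      ∑ k ∈ Finset.range (m + 1), (poch (-(m : ℂ)) k * poch a₂ k * poch a₃ k * poch a₄ k) /
        (poch b₁ k * poch b₂ k * poch b₃ k * (k.factorial : ℂ)) := by
  unfold hyp4F3
  rw [tsum_eq_sum (s := Finset.range (m + 1))]
  · simp
  · intro k hk
    have : m < k := by simpa [Nat.lt_succ_iff] using hk
    simp [poch_neg_eq_zero this]

/-- Wherever the denominators of the two hypergeometric series do not vanish,
`B_n = η_n · (₄F₃ + ⋯ ₄F₃)`. -/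
theorem biPoly_eq (n : ℕ) (x ρ₁ ρ₂ r₁ r₂ : ℂ)
    (h₁ : ∀ k < n / 2, 1 - r₁ - r₂ + (k : ℂ) ≠ 0)
    (h₂ : ∀ k < n / 2 + n % 2, ρ₁ - r₁ + 1 / 2 + (k : ℂ) ≠ 0)
    (h₃ : ∀ k < n / 2 + n % 2, ρ₂ - r₁ + 1 / 2 + (k : ℂ) ≠ 0) :
    biPoly n x ρ₁ ρ₂ r₁ r₂ = eta n ρ₁ ρ₂ r₁ r₂ * biSeries n x ρ₁ ρ₂ r₁ r₂ := by
  have hp2 : n % 2 < 2 := Nat.mod_lt _ (by norm_num)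
  unfold biPoly eta biSeries
  generalize n / 2 = m at *
  generalize n % 2 = p at *
  generalize ρ₁ + ρ₂ - r₁ - r₂ = g
  dsimp only
  rw [hyp4F3_terminating]
  have hs : ((-1 : ℂ) ^ n) * (-1) ^ n = 1 := by
    rw [← mul_pow]; norm_num
  have F1 : ∀ k ∈ Finset.range (m + 1),
      poch (-(m : ℂ)) k * poch ((m : ℂ) + g + 1) k *
          poch (x - r₁ + 1 / 2) k * poch (-x - r₁ + 1 / 2) k / (k.factorial : ℂ) *
          (poch (1 - r₁ - r₂ + k) (m - k) * poch (ρ₁ - r₁ + 1 / 2 + k) (m + p - k) *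
            poch (ρ₂ - r₁ + 1 / 2 + k) (m + p - k)) =
      (poch (ρ₁ - r₁ + 1 / 2) (m + p) * poch (ρ₂ - r₁ + 1 / 2) (m + p) *
        poch (1 - r₁ - r₂) m) *
      ((poch (-(m : ℂ)) k * poch ((m : ℂ) + g + 1) k *
          poch (x - r₁ + 1 / 2) k * poch (-x - r₁ + 1 / 2) k) /
        (poch (1 - r₁ - r₂) k * poch (ρ₁ - r₁ + 1 / 2) k * poch (ρ₂ - r₁ + 1 / 2) k *
          (k.factorial : ℂ))) := by
    intro k hk
    have hk' : k ≤ m := Nat.lt_succ_iff.1 (Finset.mem_range.1 hk)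
    have e1 : poch (1 - r₁ - r₂) k ≠ 0 := poch_ne_zero fun i hi => h₁ i (by omega)
    have e2 : poch (ρ₁ - r₁ + 1 / 2) k ≠ 0 := poch_ne_zero fun i hi => h₂ i (by omega)
    have e3 : poch (ρ₂ - r₁ + 1 / 2) k ≠ 0 := poch_ne_zero fun i hi => h₃ i (by omega)
    have e4 : (k.factorial : ℂ) ≠ 0 := Nat.cast_ne_zero.2 k.factorial_ne_zero
    rw [poch_split (1 - r₁ - r₂) hk',
      poch_split (ρ₁ - r₁ + 1 / 2) (show k ≤ m + p by omega),
      poch_split (ρ₂ - r₁ + 1 / 2) (show k ≤ m + p by omega)]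
    generalize ρ₁ - r₁ + 1 / 2 = A at *
    generalize ρ₂ - r₁ + 1 / 2 = B at *
    field_simp
  rw [Finset.sum_congr rfl F1, ← Finset.mul_sum]
  rcases Nat.eq_zero_or_pos (m + p) with h0 | hpos
  · obtain ⟨rfl, rfl⟩ : m = 0 ∧ p = 0 := by omega
    simp
    ring
  · obtain ⟨N, hN⟩ : ∃ N, m + p = N + 1 := ⟨m + p - 1, by omega⟩
    have hc : -(m : ℂ) - (p : ℂ) + 1 = -(N : ℂ) := by
      have : ((m : ℂ) + p) = N + 1 := by exact_mod_cast hN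
      linear_combination -this
    rw [hc, hyp4F3_terminating]
    have d2 : ρ₁ - r₁ + 1 / 2 ≠ 0 := by simpa using h₂ 0 hpos
    have d3 : ρ₂ - r₁ + 1 / 2 ≠ 0 := by simpa using h₃ 0 hpos
    rw [hN] at h₂ h₃ ⊢
    have s2 : ρ₁ - r₁ + 1 / 2 + 1 = ρ₁ - r₁ + 3 / 2 := by ring
    have s3 : ρ₂ - r₁ + 1 / 2 + 1 = ρ₂ - r₁ + 3 / 2 := by ring
    have F2 : ∀ k ∈ Finset.range (N + 1),
        poch (-(N : ℂ)) k * poch ((m : ℂ) + (p : ℂ) + g + 1) k *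
            poch (x - r₁ + 3 / 2) k * poch (-x - r₁ + 1 / 2) k / (k.factorial : ℂ) *
            (poch (1 - r₁ - r₂ + k) (m - k) * poch (ρ₁ - r₁ + 3 / 2 + k) (N + 1 - 1 - k) *
              poch (ρ₂ - r₁ + 3 / 2 + k) (N + 1 - 1 - k)) =
        (poch (ρ₁ - r₁ + 1 / 2) (N + 1) * poch (ρ₂ - r₁ + 1 / 2) (N + 1) *
          poch (1 - r₁ - r₂) m / ((ρ₁ - r₁ + 1 / 2) * (ρ₂ - r₁ + 1 / 2))) *
        ((poch (-(N : ℂ)) k * poch ((m : ℂ) + (p : ℂ) + g + 1) k *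
            poch (x - r₁ + 3 / 2) k * poch (-x - r₁ + 1 / 2) k) /
          (poch (1 - r₁ - r₂) k * poch (ρ₁ - r₁ + 3 / 2) k * poch (ρ₂ - r₁ + 3 / 2) k *
            (k.factorial : ℂ))) := by
      intro k hk
      have hk' : k ≤ N := Nat.lt_succ_iff.1 (Finset.mem_range.1 hk)
      have e1 : poch (1 - r₁ - r₂) k ≠ 0 := poch_ne_zero fun i hi => h₁ i (by omega)
      have e2 : poch (ρ₁ - r₁ + 3 / 2) k ≠ 0 := poch_ne_zero fun i hi => by
        have := h₂ (i + 1) (by omega)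
        push_cast at this
        intro h
        exact this (by linear_combination h)
      have e3 : poch (ρ₂ - r₁ + 3 / 2) k ≠ 0 := poch_ne_zero fun i hi => by
        have := h₃ (i + 1) (by omega)
        push_cast at this
        intro h
        exact this (by linear_combination h)
      have e4 : (k.factorial : ℂ) ≠ 0 := Nat.cast_ne_zero.2 k.factorial_ne_zero
      rw [poch_succ_left, poch_succ_left, s2, s3,
        poch_split (1 - r₁ - r₂) (show k ≤ m by omega),
        poch_split (ρ₁ - r₁ + 3 / 2) hk', poch_split (ρ₂ - r₁ + 3 / 2) hk',
        Nat.add_sub_cancel]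
      generalize ρ₁ - r₁ + 1 / 2 = A at *
      generalize ρ₂ - r₁ + 1 / 2 = B at *
      generalize ρ₁ - r₁ + 3 / 2 = A' at *
      generalize ρ₂ - r₁ + 3 / 2 = B' at *
      field_simp
    rw [Finset.sum_congr rfl F2, ← Finset.mul_sum]
    have key : ∀ e K X u v w D S₁ S₂ : ℂ, e * e = 1 →
        (e * (u * S₁) + K * X * (u / (v * w) * S₂)) / D =
          e * u / D * (S₁ + e * K * X / (v * w) * S₂) := by
      intro e K X u v w D S₁ S₂ he
      linear_combination (-(K * X * (u / (v * w)) * S₂ / D)) * he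
    exact key _ _ _ _ _ _ _ _ _ hs

/-- The coefficient `A_n` of the univariate three-term recurrence relation. -/
def coeffA (n : ℤ) (ρ₁ ρ₂ r₁ r₂ : ℂ) : ℂ :=
  let g : ℂ := ρ₁ + ρ₂ - r₁ - r₂
  if Even n then
    ((n : ℂ) + 2 * ρ₁ - 2 * r₁ + 1) * ((n : ℂ) + 2 * ρ₁ - 2 * r₂ + 1) / (4 * ((n : ℂ) + g + 1))
  else
    ((n : ℂ) + 2 * g + 1) * ((n : ℂ) + 2 * ρ₁ + 2 * ρ₂ + 1) / (4 * ((n : ℂ) + g + 1))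

/-- The coefficient `C_n` of the univariate three-term recurrence relation. -/
def coeffC (n : ℤ) (ρ₁ ρ₂ r₁ r₂ : ℂ) : ℂ :=
  let g : ℂ := ρ₁ + ρ₂ - r₁ - r₂
  if Even n then
    -((n : ℂ) * ((n : ℂ) - 2 * r₁ - 2 * r₂) / (4 * ((n : ℂ) + g)))
  else
    -(((n : ℂ) + 2 * ρ₂ - 2 * r₂) * ((n : ℂ) + 2 * ρ₂ - 2 * r₁) / (4 * ((n : ℂ) + g)))

/-- The indicator `π_n` of the even numbers. -/
def parityInd (n : ℕ) : ℂ := if Even n then 1 else 0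

/-! The parameters `ρ₁, ρ₂, r₁, r₂` of the second factor of the bivariate polynomial. -/

def secondρ₁ (β ε : ℂ) (n₁ : ℕ) : ℂ := β + ε + (n₁ : ℂ) / 2

def secondρ₂ (γ δ : ℂ) (n₁ : ℕ) : ℂ := (1 - parityInd n₁) * γ + parityInd n₁ * δ

def secondr₁ (α ε : ℂ) (n₁ : ℕ) : ℂ := α - ε - (n₁ : ℂ) / 2

def secondr₂ (γ δ : ℂ) (n₁ : ℕ) : ℂ := (parityInd n₁ - 1) * δ - parityInd n₁ * γ

/-- The untruncated bivariate Bannai-Ito polynomials `B_{n₁,n₂}(z₁, z₂)`, for `n₁, n₂ ≥ 0`. -/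
def bivBINat (α β γ δ ε : ℂ) (n₁ n₂ : ℕ) (z₁ z₂ : ℂ) : ℂ :=
  biPoly n₁ (z₁ - 1 / 4) β (z₂ + ε - 1 / 4) α (z₂ - ε + 1 / 4) *
    biPoly n₂ ((-1) ^ n₁ * z₂ - 1 / 4)
      (secondρ₁ β ε n₁) (secondρ₂ γ δ n₁) (secondr₁ α ε n₁) (secondr₂ γ δ n₁)

/-- The untruncated bivariate Bannai-Ito polynomials, with the usual convention that they are
zero when one of the degrees is negative. -/
def bivBI (α β γ δ ε : ℂ) (n₁ n₂ : ℤ) (z₁ z₂ : ℂ) : ℂ :=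
  if 0 ≤ n₁ ∧ 0 ≤ n₂ then bivBINat α β γ δ ε n₁.toNat n₂.toNat z₁ z₂ else 0

/-! The coefficients of the nine-term recurrence relation. -/

section Theta

variable (α β γ δ ε : ℂ) (n₁ n₂ : ℕ)

def theta1 : ℂ := (-1) ^ n₂

def theta2 : ℂ :=
  if Even n₁ then
    if Even n₂ then
      (n₂ : ℂ) / 4 * ((2 * β + 2 * γ + 2 * ε + n₁ + n₂ + 1) / (-α + β + γ + δ + 2 * ε + n₁ + n₂ + 1)
        - (-2 * α + 2 * γ + 2 * ε + n₁ + n₂) / (-α + β + γ + δ + 2 * ε + n₁ + n₂))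
    else
      1 / 4 * (2 * γ + 2 * δ + n₂) *
        ((-2 * α + 2 * γ + 2 * ε + n₁ + n₂ + 1) / (-α + β + γ + δ + 2 * ε + n₁ + n₂ + 1)
        - (2 * β + 2 * γ + 2 * ε + n₁ + n₂) / (-α + β + γ + δ + 2 * ε + n₁ + n₂))
  else
    if Even n₂ then
      (n₂ : ℂ) / 4 * ((2 * β + 2 * γ + 2 * ε + n₁ + n₂) / (-α + β + γ + δ + 2 * ε + n₁ + n₂)
        - (-2 * α + 2 * γ + 2 * ε + n₁ + n₂ + 1) / (-α + β + γ + δ + 2 * ε + n₁ + n₂ + 1))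
    else
      1 / 4 * (2 * γ + 2 * δ + n₂) *
        ((-2 * α + 2 * γ + 2 * ε + n₁ + n₂) / (-α + β + γ + δ + 2 * ε + n₁ + n₂)
        - (2 * β + 2 * γ + 2 * ε + n₁ + n₂ + 1) / (-α + β + γ + δ + 2 * ε + n₁ + n₂ + 1))

def theta3 : ℂ :=
  if Even n₁ then
    if Even n₂ then
      -((n₂ : ℂ) * (2 * γ + 2 * δ + n₂ - 1) * (-2 * α + 2 * γ + 2 * ε + n₁ + n₂) *
        (2 * β + 2 * δ + 2 * ε + n₁ + n₂)) / (16 * (-α + β + γ + δ + 2 * ε + n₁ + n₂) ^ 2)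
    else
      ((n₂ : ℂ) - 1) * (2 * γ + 2 * δ + n₂) * (-2 * α + 2 * δ + 2 * ε + n₁ + n₂) *
        (2 * β + 2 * γ + 2 * ε + n₁ + n₂) / (16 * (-α + β + γ + δ + 2 * ε + n₁ + n₂) ^ 2)
  else
    if Even n₂ then
      -((n₂ : ℂ) * (2 * γ + 2 * δ + n₂ - 1) * (-2 * α + 2 * δ + 2 * ε + n₁ + n₂) *
        (2 * β + 2 * γ + 2 * ε + n₁ + n₂)) / (16 * (-α + β + γ + δ + 2 * ε + n₁ + n₂) ^ 2)
    else
      ((n₂ : ℂ) - 1) * (2 * γ + 2 * δ + n₂) * (-2 * α + 2 * γ + 2 * ε + n₁ + n₂) *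
        (2 * β + 2 * δ + 2 * ε + n₁ + n₂) / (16 * (-α + β + γ + δ + 2 * ε + n₁ + n₂) ^ 2)

def theta4 : ℂ :=
  if Even n₁ then
    1 - (2 * ε + (n₁ : ℂ) / 2) / (-α + β + 2 * ε + n₁ + 1 / 2)
      - ((n₁ : ℂ) / 2) / (-α + β + 2 * ε + n₁ - 1 / 2)
  else
    1 - (2 * ε + ((n₁ : ℂ) - 1) / 2) / (-α + β + 2 * ε + n₁ - 1 / 2)
      - (((n₁ : ℂ) + 1) / 2) / (-α + β + 2 * ε + n₁ + 1 / 2)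

def theta5 : ℂ :=
  if Even n₁ then
    if Even n₂ then
      -(1 / 4) * ((n₁ : ℂ) / (-2 * α + 2 * β + 4 * ε + 2 * n₁ - 1)
          + (4 * ε + n₁) / (-2 * α + 2 * β + 4 * ε + 2 * n₁ + 1) - 1) *
        (2 * α + 2 * β - (2 * β + 2 * γ + 2 * ε + n₁ + n₂ + 1) /
          (-α + β + γ + δ + 2 * ε + n₁ + n₂ + 1) + 1) *
        (-2 * α + 2 * β - (n₂ : ℂ) / (-α + β + γ + δ + 2 * ε + n₁ + n₂) + 4 * ε + 2 * n₁ + 1)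
    else
      -(1 / 4) * ((n₁ : ℂ) / (-2 * α + 2 * β + 4 * ε + 2 * n₁ - 1)
          + (4 * ε + n₁) / (-2 * α + 2 * β + 4 * ε + 2 * n₁ + 1) - 1) *
        (2 * α + 2 * β + (2 * (β + γ) + 2 * ε + n₁ + n₂) /
          (-α + β + γ + δ + 2 * ε + n₁ + n₂) - 1) *
        (-2 * α + 2 * β + ((n₂ : ℂ) + 1) / (-α + β + γ + δ + 2 * ε + n₁ + n₂ + 1)
          + 4 * ε + 2 * n₁ - 1)
  else
    if Even n₂ then
      -(1 / 4) * (((n₁ : ℂ) + 1) / (-2 * α + 2 * β + 4 * ε + 2 * n₁ + 1)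
          + (4 * ε + n₁ - 1) / (-2 * α + 2 * β + 4 * ε + 2 * n₁ - 1) - 1) *
        (2 * α + 2 * β + (-2 * α + 2 * γ + 2 * ε + n₁ + n₂ + 1) /
          (-α + β + γ + δ + 2 * ε + n₁ + n₂ + 1) - 1) *
        (-2 * α + 2 * β - (n₂ : ℂ) / (-α + β + γ + δ + 2 * ε + n₁ + n₂) + 4 * ε + 2 * n₁ + 1)
    else
      -(1 / 4) * (((n₁ : ℂ) + 1) / (-2 * α + 2 * β + 4 * ε + 2 * n₁ + 1)
          + (4 * ε + n₁ - 1) / (-2 * α + 2 * β + 4 * ε + 2 * n₁ - 1) - 1) *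
        (2 * α + 2 * β - (-2 * α + 2 * γ + 2 * ε + n₁ + n₂) /
          (-α + β + γ + δ + 2 * ε + n₁ + n₂) + 1) *
        (-2 * α + 2 * β + ((n₂ : ℂ) + 1) / (-α + β + γ + δ + 2 * ε + n₁ + n₂ + 1)
          + 4 * ε + 2 * n₁ - 1)

def theta6 : ℂ :=
  if Even n₁ then
    if Even n₂ then
      (n₂ : ℂ) * (2 * α - 2 * β + 2 * n₁ / (-2 * α + 2 * β + 4 * ε + 2 * n₁ - 1) - 1) *
        (-α + γ + ε + ((n₁ : ℂ) + n₂) / 2) * (β + δ + ε + ((n₁ : ℂ) + n₂) / 2) *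
        (-α + β + γ + δ + 2 * ε + n₁ + (n₂ : ℂ) / 2) /
      (2 * (-2 * α + 2 * β + 4 * ε + 2 * n₁ + 1) * (-α + β + γ + δ + 2 * ε + n₁ + n₂) ^ 2)
    else
      (γ + δ + (n₂ : ℂ) / 2) *
        (2 * α - 2 * β + 2 * n₁ / (-2 * α + 2 * β + 4 * ε + 2 * n₁ - 1) - 1) *
        (-α + β + 2 * ε + n₁ + (n₂ : ℂ) / 2) *
        (-α + δ + ε + ((n₁ : ℂ) + n₂) / 2) * (β + γ + ε + ((n₁ : ℂ) + n₂) / 2) /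
      ((-2 * α + 2 * β + 4 * ε + 2 * n₁ + 1) * (-α + β + γ + δ + 2 * ε + n₁ + n₂) ^ 2)
  else
    if Even n₂ then
      (n₂ : ℂ) *
        (2 * α - 2 * β + (8 * ε + 2 * n₁ - 2) / (-2 * α + 2 * β + 4 * ε + 2 * n₁ - 1) - 1) *
        (-α + δ + ε + ((n₁ : ℂ) + n₂) / 2) * (β + γ + ε + ((n₁ : ℂ) + n₂) / 2) *
        (-α + β + γ + δ + 2 * ε + n₁ + (n₂ : ℂ) / 2) /
      (2 * (-2 * α + 2 * β + 4 * ε + 2 * n₁ + 1) * (-α + β + γ + δ + 2 * ε + n₁ + n₂) ^ 2)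
    else
      (γ + δ + (n₂ : ℂ) / 2) *
        (2 * α - 2 * β + (8 * ε + 2 * n₁ - 2) / (-2 * α + 2 * β + 4 * ε + 2 * n₁ - 1) - 1) *
        (-α + β + 2 * ε + n₁ + (n₂ : ℂ) / 2) *
        (-α + γ + ε + ((n₁ : ℂ) + n₂) / 2) * (β + δ + ε + ((n₁ : ℂ) + n₂) / 2) /
      ((-2 * α + 2 * β + 4 * ε + 2 * n₁ + 1) * (-α + β + γ + δ + 2 * ε + n₁ + n₂) ^ 2)

def theta7 : ℂ :=
  if Even n₁ then
    (-1) ^ n₂ * ((n₁ : ℂ) * (-2 * α + 2 * β + 4 * ε + n₁ - 1) /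
      (-2 * α + 2 * β + 4 * ε + 2 * n₁ - 1) ^ 2)
  else
    (-1) ^ n₂ * ((4 * ε + n₁ - 1) * (-2 * α + 2 * β + n₁) /
      (-2 * α + 2 * β + 4 * ε + 2 * n₁ - 1) ^ 2)

def theta8 : ℂ :=
  if Even n₁ then
    if Even n₂ then
      -((n₁ : ℂ) / 2 * (-2 * α + 2 * β + 4 * ε + n₁ - 1) *
        (-α + β + γ + δ + 2 * ε + n₁ + (n₂ : ℂ) / 2) *
        (2 * α + 2 * β - (-2 * α + 2 * γ + 2 * ε + n₁ + n₂) /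
          (-α + β + γ + δ + 2 * ε + n₁ + n₂) + 1)) /
      ((-2 * α + 2 * β + 4 * ε + 2 * n₁ - 1) ^ 2 * (-α + β + γ + δ + 2 * ε + n₁ + n₂ + 1))
    else
      (n₁ : ℂ) / 2 * (-2 * α + 2 * β + 4 * ε + n₁ - 1) *
        (-α + β + 2 * ε + n₁ + (n₂ : ℂ) / 2) *
        (2 * α + 2 * β + (-2 * α + 2 * γ + 2 * ε + n₁ + n₂ + 1) /
          (-α + β + γ + δ + 2 * ε + n₁ + n₂ + 1) - 1) /
      ((-2 * α + 2 * β + 4 * ε + 2 * n₁ - 1) ^ 2 * (-α + β + γ + δ + 2 * ε + n₁ + n₂))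
  else
    if Even n₂ then
      (2 * ε + ((n₁ : ℂ) - 1) / 2) * (2 * α - 2 * β - n₁) *
        (-α + β + γ + δ + 2 * ε + n₁ + (n₂ : ℂ) / 2) *
        (2 * α + 2 * β + (-2 * α + 2 * γ + 2 * ε + n₁ + n₂ + 1) /
          (-α + β + γ + δ + 2 * ε + n₁ + n₂ + 1) - 1) /
      ((-2 * α + 2 * β + 4 * ε + 2 * n₁ - 1) ^ 2 * (-α + β + γ + δ + 2 * ε + n₁ + n₂))
    else
      -((2 * ε + ((n₁ : ℂ) - 1) / 2) * (2 * α - 2 * β - n₁) *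
        (-α + β + 2 * ε + n₁ + (n₂ : ℂ) / 2) *
        (2 * α + 2 * β - (-2 * α + 2 * γ + 2 * ε + n₁ + n₂) /
          (-α + β + γ + δ + 2 * ε + n₁ + n₂) + 1)) /
      ((-2 * α + 2 * β + 4 * ε + 2 * n₁ - 1) ^ 2 * (-α + β + γ + δ + 2 * ε + n₁ + n₂ + 1))

def theta9 : ℂ :=
  if Even n₁ then
    if Even n₂ then
      (n₁ : ℂ) / 2 * (-2 * α + 2 * β + 4 * ε + n₁ - 1) *
        (-2 * α + 2 * β + 4 * ε + 2 * n₁ + n₂ - 1) *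
        (-α + γ + ε + ((n₁ : ℂ) + n₂) / 2) * (β + δ + ε + ((n₁ : ℂ) + n₂) / 2) *
        (-α + β + γ + δ + 2 * ε + n₁ + (n₂ : ℂ) / 2) /
      ((-1) ^ (n₂ + 1) * (-2 * α + 2 * β + 4 * ε + 2 * n₁ - 1) ^ 2 *
        (-α + β + γ + δ + 2 * ε + n₁ + n₂) ^ 2)
    else
      (n₁ : ℂ) / 2 * (-2 * α + 2 * β + 4 * ε + n₁ - 1) *
        (-2 * α + 2 * β + 4 * ε + 2 * n₁ + n₂) *
        (-α + δ + ε + ((n₁ : ℂ) + n₂) / 2) * (β + γ + ε + ((n₁ : ℂ) + n₂) / 2) *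
        (-α + β + γ + δ + 2 * ε + n₁ + ((n₂ : ℂ) - 1) / 2) /
      ((-1) ^ (n₂ + 1) * (-2 * α + 2 * β + 4 * ε + 2 * n₁ - 1) ^ 2 *
        (-α + β + γ + δ + 2 * ε + n₁ + n₂) ^ 2)
  else
    if Even n₂ then
      (2 * ε + ((n₁ : ℂ) - 1) / 2) * (-2 * α + 2 * β + n₁) *
        (-2 * α + 2 * β + 4 * ε + 2 * n₁ + n₂ - 1) *
        (-α + δ + ε + ((n₁ : ℂ) + n₂) / 2) * (β + γ + ε + ((n₁ : ℂ) + n₂) / 2) *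
        (-α + β + γ + δ + 2 * ε + n₁ + (n₂ : ℂ) / 2) /
      ((-1) ^ (n₂ + 1) * (-2 * α + 2 * β + 4 * ε + 2 * n₁ - 1) ^ 2 *
        (-α + β + γ + δ + 2 * ε + n₁ + n₂) ^ 2)
    else
      (2 * ε + ((n₁ : ℂ) - 1) / 2) * (-2 * α + 2 * β + n₁) *
        (-2 * α + 2 * β + 4 * ε + 2 * n₁ + n₂) *
        (-α + γ + ε + ((n₁ : ℂ) + n₂) / 2) * (β + δ + ε + ((n₁ : ℂ) + n₂) / 2) *
        (-α + β + γ + δ + 2 * ε + n₁ + ((n₂ : ℂ) - 1) / 2) /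
      ((-1) ^ (n₂ + 1) * (-2 * α + 2 * β + 4 * ε + 2 * n₁ - 1) ^ 2 *
        (-α + β + γ + δ + 2 * ε + n₁ + n₂) ^ 2)

end Theta

end

end BannaiIto

namespace BannaiIto

noncomputable section

/-! Everything rests on the univariate recurrence x B_n = B_{n+1} + b_n B_n + u_n B_{n-1} with b_n =
ρ₁ - A_n - C_n and u_n = A_{n-1} C_n (`biPoly_recurrence`). Relation (1) is this recurrence for the
second factor, multiplied by the first factor, which does not depend on n₂.

For (2), write B_{n₁,n₂} = F_{n₁} S_{n₁,n₂} and apply the recurrence in z₁ to F. The value of g for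
F does not involve z₂, so b_{n₁} is affine and u_{n₁} quadratic in x = (-1)^{n₁} z₂ - 1/4, which is
the variable of S. Three groups of three terms arise. In F_{n₁+1} S_{n₁,n₂}, the second factor is
expanded in the S_{n₁+1,·}. In b_{n₁} F_{n₁} S_{n₁,n₂}, the variable x is absorbed by the recurrence
of S. In u_{n₁} F_{n₁-1} S_{n₁,n₂}, the quadratic u_{n₁} is a constant times (x + ρ₁)(x + r₁ + 1/2),
with ρ₁, r₁ the parameters of S, and this is exactly the multiplier that makes S_{n₁,n₂} a
combination of three S_{n₁-1,·}.

Replacing n₁ by n₁ ± 1 sends the parameters of S to (ρ₁ ± 1/2, -r₂, r₁ ∓ 1/2, -ρ₂) and x to -x -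
1/2. The two connection formulas `biPoly_eq_up` and `mul_biPoly_eq_down` for this change are proved
by induction on the degree (`connection_step`): substituting the expansion into the recurrence
produces the next connection coefficients and two remainders that vanish, all of it by identities of
rational functions.

The recurrence itself is obtained by expanding B_n along (a)_k (b)_k and (a)_{k+1} (b)_k, where a =
x - r₁ + 1/2 and b = -x - r₁ + 1/2; multiplication by x is sparse in this family. Comparing
coefficients means dividing by the lower Pochhammer symbols of the series, so it is done for generic
parameters and then extended by continuity along a line of parameters on which g is constant.

For (3), g is independent of z₁ and z₂ in both factors, so the only division in `biPoly` that could
involve the variables is by a constant. -/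

theorem poch_zero (a : ℂ) : poch a 0 = 1 := by simp [poch]

/-! ### Expansion of the polynomials in a Pochhammer basis. -/

theorem poch_succ (a : ℂ) (n : ℕ) : poch a (n + 1) = poch a n * (a + n) := by
  simp [poch, Finset.prod_range_succ]

/-- `η_n` up to sign, as a function of `n_e` and `n_p`. -/
def etaAbs (g u v w : ℂ) (m p : ℕ) : ℂ :=
  poch u m * poch v (m + p) * poch w (m + p) / poch ((m : ℂ) + g + 1) (m + p)

/-- The reciprocal of `k! (u)_k (v)_k (w)_k`. -/
def hypWeight (u v w : ℂ) (k : ℕ) : ℂ :=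
  1 / ((k.factorial : ℂ) * poch u k * poch v k * poch w k)

/-! The coefficients of `B_{2m}` and `B_{2m+1}` along `(a)_k (b)_k` and `(a)_{k+1} (b)_k`. -/

def evenCoeffEven (g u v w : ℂ) (m k : ℕ) : ℂ :=
  etaAbs g u v w m 0 * (poch (-(m : ℂ)) k * poch ((m : ℂ) + g + 1) k * hypWeight u v w k)

def evenCoeffOdd (g u v w : ℂ) (m k : ℕ) : ℂ :=
  -(etaAbs g u v w m 0 * (poch (-(m : ℂ)) (k + 1) * poch ((m : ℂ) + g + 1) k *
    (hypWeight u v w k / ((v + k) * (w + k)))))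

def oddCoeffEven (g u v w : ℂ) (m k : ℕ) : ℂ :=
  -(etaAbs g u v w m 1 * (poch (-(m : ℂ)) k * poch ((m : ℂ) + g + 1) k * hypWeight u v w k))

def oddCoeffOdd (g u v w : ℂ) (m k : ℕ) : ℂ :=
  etaAbs g u v w m 1 * (poch (-(m : ℂ)) k * poch ((m : ℂ) + g + 1) (k + 1) *
    (hypWeight u v w k / ((v + k) * (w + k))))

/-- The expansion with coefficients `e`, `o` in the basis `(a)_k (b)_k`, `(a)_{k+1} (b)_k`. -/
def basisSum (N : ℕ) (a b : ℂ) (e o : ℕ → ℂ) : ℂ :=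
  ∑ k ∈ Finset.range N, (e k * (poch a k * poch b k) + o k * (poch a (k + 1) * poch b k))

/-- Allows polynomials of different degrees to be written as basis sums of one common length. -/
theorem sum_range_extend {N M : ℕ} (h : M ≤ N) (f : ℕ → ℂ) (hf : ∀ k, M ≤ k → f k = 0) :
    ∑ k ∈ Finset.range N, f k = ∑ k ∈ Finset.range M, f k := by
  refine (Finset.sum_subset (Finset.range_subset_range.2 h) fun k _ hk => hf k ?_).symm
  simpa using hk

theorem poch_tail {a : ℂ} (ha : ∀ k : ℕ, a + k ≠ 0) {k n : ℕ} (h : k ≤ n) :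
    poch (a + k) (n - k) = poch a n / poch a k := by
  rw [poch_split a h, mul_div_cancel_left₀ _ (poch_ne_zero fun i _ => ha i)]

theorem poch_tail_succ {a : ℂ} (ha : ∀ k : ℕ, a + k ≠ 0) {k n : ℕ} (h : k ≤ n) :
    poch (a + 1 + k) (n - k) = poch a (n + 1) / (poch a k * (a + k)) := by
  have := poch_tail ha (Nat.succ_le_succ h)
  rw [Nat.succ_eq_add_one, Nat.succ_eq_add_one, Nat.succ_sub_succ, poch_succ a k] at this
  rw [← this]
  congr 1
  push_cast
  ring

/-- The genericity of u, v, w undoes the cancellation built into `biPoly`: (c + k)_{n-k} becomes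
(c)_n / (c)_k, so all coefficients share the factor `etaAbs`. -/
theorem biPoly_even_expansion {x ρ₁ ρ₂ r₁ r₂ u v w g : ℂ} (hu : u = 1 - r₁ - r₂)
    (hv : v = ρ₁ - r₁ + 1 / 2) (hw : w = ρ₂ - r₁ + 1 / 2) (hg : g = ρ₁ + ρ₂ - r₁ - r₂)
    (nu : ∀ k : ℕ, u + k ≠ 0) (nv : ∀ k : ℕ, v + k ≠ 0) (nw : ∀ k : ℕ, w + k ≠ 0)
    {m N : ℕ} (hN : m < N) :
    biPoly (2 * m) x ρ₁ ρ₂ r₁ r₂ = basisSum N (x - r₁ + 1 / 2) (-x - r₁ + 1 / 2)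
      (evenCoeffEven g u v w m) (evenCoeffOdd g u v w m) := by
  have hv' : ρ₁ - r₁ + 3 / 2 = v + 1 := by rw [hv]; ring
  have hw' : ρ₂ - r₁ + 3 / 2 = w + 1 := by rw [hw]; ring
  have ha' : x - r₁ + 3 / 2 = x - r₁ + 1 / 2 + 1 := by ring
  unfold biPoly
  simp only [show 2 * m / 2 = m by omega, show 2 * m % 2 = 0 by omega, hv', hw', ha', ← hu, ← hv,
    ← hw, ← hg, Nat.cast_zero, mul_zero, add_zero, sub_zero, pow_mul]
  generalize x - r₁ + 1 / 2 = a
  generalize -x - r₁ + 1 / 2 = b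
  rw [basisSum, Finset.sum_add_distrib,
    sum_range_extend (M := m + 1) hN, sum_range_extend (M := m) hN.le, add_div,
    Finset.mul_sum, Finset.mul_sum, Finset.sum_div, Finset.sum_div]
  · congr 1
    · refine Finset.sum_congr rfl fun k hk => ?_
      have hk' : k ≤ m := Nat.lt_succ_iff.1 (Finset.mem_range.1 hk)
      rw [poch_tail nu hk', poch_tail nv hk', poch_tail nw hk']
      unfold evenCoeffEven etaAbs hypWeight
      simp only [add_zero]
      have e1 : poch u k ≠ 0 := poch_ne_zero fun i _ => nu i
      have e2 : poch v k ≠ 0 := poch_ne_zero fun i _ => nv i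
      have e3 : poch w k ≠ 0 := poch_ne_zero fun i _ => nw i
      have e4 : (k.factorial : ℂ) ≠ 0 := Nat.cast_ne_zero.2 k.factorial_ne_zero
      norm_num
      field_simp
    · refine Finset.sum_congr rfl fun k hk => ?_
      obtain ⟨j, rfl⟩ : ∃ j, m = j + 1 := ⟨m - 1, by have := Finset.mem_range.1 hk; omega⟩
      have hk' : k ≤ j := Nat.lt_succ_iff.1 (Finset.mem_range.1 hk)
      rw [poch_tail nu (hk'.trans j.le_succ), Nat.add_sub_cancel, poch_tail_succ nv hk',
        poch_tail_succ nw hk']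
      unfold evenCoeffOdd etaAbs hypWeight
      simp only [add_zero]
      -- The prefactors of the second series are absorbed here: m (1 - m)_k = -(-m)_{k+1} and a (a +
      -- 1)_k = (a)_{k+1}.
      rw [poch_succ_left (-((j + 1 : ℕ) : ℂ)) k, poch_succ_left a]
      generalize v + (k : ℂ) = V
      generalize w + (k : ℂ) = W
      ring
  · intro k hk
    simp [evenCoeffOdd, poch_neg_eq_zero (show m < k + 1 by omega)]
  · intro k hk
    simp [evenCoeffEven, poch_neg_eq_zero (show m < k by omega)]

theorem biPoly_odd_expansion {x ρ₁ ρ₂ r₁ r₂ u v w g : ℂ} (hu : u = 1 - r₁ - r₂)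
    (hv : v = ρ₁ - r₁ + 1 / 2) (hw : w = ρ₂ - r₁ + 1 / 2) (hg : g = ρ₁ + ρ₂ - r₁ - r₂)
    (nu : ∀ k : ℕ, u + k ≠ 0) (nv : ∀ k : ℕ, v + k ≠ 0) (nw : ∀ k : ℕ, w + k ≠ 0)
    {m N : ℕ} (hN : m < N) :
    biPoly (2 * m + 1) x ρ₁ ρ₂ r₁ r₂ = basisSum N (x - r₁ + 1 / 2) (-x - r₁ + 1 / 2)
      (oddCoeffEven g u v w m) (oddCoeffOdd g u v w m) := by
  have hv' : ρ₁ - r₁ + 3 / 2 = v + 1 := by rw [hv]; ring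
  have hw' : ρ₂ - r₁ + 3 / 2 = w + 1 := by rw [hw]; ring
  have ha' : x - r₁ + 3 / 2 = x - r₁ + 1 / 2 + 1 := by ring
  unfold biPoly
  simp only [show (2 * m + 1) / 2 = m by omega, show (2 * m + 1) % 2 = 1 by omega, hv', hw', ha',
    ← hu, ← hv, ← hw, ← hg, Nat.cast_one, mul_one, pow_succ, pow_mul, Nat.add_sub_cancel,
    sub_add_cancel]
  generalize x - r₁ + 1 / 2 = a
  generalize -x - r₁ + 1 / 2 = b
  rw [basisSum, Finset.sum_add_distrib,
    sum_range_extend (M := m + 1) hN, sum_range_extend (M := m + 1) hN, add_div,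
    Finset.mul_sum, Finset.mul_sum, Finset.sum_div, Finset.sum_div]
  · congr 1
    · refine Finset.sum_congr rfl fun k hk => ?_
      have hk' : k ≤ m := Nat.lt_succ_iff.1 (Finset.mem_range.1 hk)
      have hk1 : k ≤ m + 1 := by omega
      rw [poch_tail nu hk', poch_tail nv hk1, poch_tail nw hk1]
      unfold oddCoeffEven etaAbs hypWeight
      have e1 : poch u k ≠ 0 := poch_ne_zero fun i _ => nu i
      have e2 : poch v k ≠ 0 := poch_ne_zero fun i _ => nv i
      have e3 : poch w k ≠ 0 := poch_ne_zero fun i _ => nw i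
      have e4 : (k.factorial : ℂ) ≠ 0 := Nat.cast_ne_zero.2 k.factorial_ne_zero
      norm_num
      field_simp
    · refine Finset.sum_congr rfl fun k hk => ?_
      have hk' : k ≤ m := Nat.lt_succ_iff.1 (Finset.mem_range.1 hk)
      rw [poch_tail nu hk', poch_tail_succ nv hk', poch_tail_succ nw hk']
      unfold oddCoeffOdd etaAbs hypWeight
      have e8 : (m : ℂ) + 1 + g + 1 = m + g + 1 + 1 := by ring
      -- In odd degree the prefactor is m + 1 + g, and it completes (m + g + 2)_k to (m + g +
      -- 1)_{k+1}.
      rw [poch_succ_left ((m : ℂ) + g + 1) k, poch_succ_left a, e8]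
      generalize v + (k : ℂ) = V
      generalize w + (k : ℂ) = W
      ring
  · intro k hk
    simp [oddCoeffOdd, poch_neg_eq_zero (show m < k by omega)]
  · intro k hk
    simp [oddCoeffEven, poch_neg_eq_zero (show m < k by omega)]

/-- Since a + k and b + k are affine in x with slopes 1 and -1, x (a)_k (b)_k is a combination of
itself and (a)_{k+1} (b)_k, and x (a)_{k+1} (b)_k one of itself and (a)_{k+1} (b)_{k+1}. The last
product belongs to index k + 1; the condition on `o N` keeps it inside the range of summation. -/
theorem mul_basisSum (N : ℕ) (x r : ℂ) (e o : ℕ → ℂ) (ho : o N = 0) :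
    x * basisSum (N + 1) (x - r + 1 / 2) (-x - r + 1 / 2) e o =
      basisSum (N + 1) (x - r + 1 / 2) (-x - r + 1 / 2)
        (fun k => (r - 1 / 2 - k) * e k - (if k = 0 then 0 else o (k - 1)))
        (fun k => e k + (k - r + 1 / 2) * o k) := by
  set a := x - r + 1 / 2 with ha
  set b := -x - r + 1 / 2 with hb
  have key : ∀ k, x * (e k * (poch a k * poch b k) + o k * (poch a (k + 1) * poch b k)) =
      ((r - 1 / 2 - k) * e k * (poch a k * poch b k) +
        (e k + (k - r + 1 / 2) * o k) * (poch a (k + 1) * poch b k)) -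
        o k * (poch a (k + 1) * poch b (k + 1)) := by
    intro k
    rw [poch_succ, poch_succ, ha, hb]
    ring
  have shift : ∑ k ∈ Finset.range (N + 1),
      (if k = 0 then 0 else o (k - 1)) * (poch a k * poch b k) =
      ∑ k ∈ Finset.range (N + 1), o k * (poch a (k + 1) * poch b (k + 1)) := by
    rw [Finset.sum_range_succ', Finset.sum_range_succ _ N, ho]
    simp
  unfold basisSum
  rw [Finset.mul_sum, Finset.sum_congr rfl fun k _ => key k, Finset.sum_sub_distrib, ← shift,
    ← Finset.sum_sub_distrib]
  refine Finset.sum_congr rfl fun k _ => ?_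
  ring

theorem basisSum_congr {N : ℕ} {a b : ℂ} {e e' o o' : ℕ → ℂ} (he : ∀ k, e k = e' k)
    (ho : ∀ k, o k = o' k) : basisSum N a b e o = basisSum N a b e' o' := by
  unfold basisSum
  simp only [he, ho]

theorem basisSum_combination (N : ℕ) (a b s t : ℂ) (e₁ o₁ e₂ o₂ e₃ o₃ : ℕ → ℂ) :
    basisSum N a b e₁ o₁ + s * basisSum N a b e₂ o₂ + t * basisSum N a b e₃ o₃ =
      basisSum N a b (fun k => e₁ k + s * e₂ k + t * e₃ k)
        (fun k => o₁ k + s * o₂ k + t * o₃ k) := by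
  unfold basisSum
  rw [Finset.mul_sum, Finset.mul_sum, ← Finset.sum_add_distrib, ← Finset.sum_add_distrib]
  refine Finset.sum_congr rfl fun k _ => ?_
  ring

/-! ### The three-term recurrence, coefficient by coefficient. -/

theorem hypWeight_succ (u v w : ℂ) (k : ℕ) :
    hypWeight u v w (k + 1) = hypWeight u v w k / ((k + 1) * (u + k) * (v + k) * (w + k)) := by
  simp only [hypWeight, poch_succ, Nat.factorial_succ, div_div]
  push_cast
  congr 1
  ring

theorem poch_add_one {a : ℂ} (ha : a ≠ 0) (n : ℕ) : poch (a + 1) n = poch a n * (a + n) / a := by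
  rw [← poch_succ, poch_succ_left, mul_div_cancel_left₀ _ ha]

section Coefficients

variable {g u v w : ℂ}

/-- This and the next ratio express the normalizations of three consecutive degrees through one of
them, which then factors out of the coefficient identities. -/
theorem etaAbs_one (hg : ∀ k : ℕ, g + 1 + k ≠ 0) (m : ℕ) :
    etaAbs g u v w m 1 = etaAbs g u v w m 0 * ((v + m) * (w + m) / (2 * m + g + 1)) := by
  have h := hg (m + m)
  have h' : poch ((m : ℂ) + g + 1) m ≠ 0 := poch_ne_zero fun i _ => by
    have := hg (m + i)
    push_cast at this
    intro h
    exact this (by linear_combination h)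
  have h'' : (m : ℂ) + g + 1 + m ≠ 0 := by
    push_cast at h
    intro h'
    exact h (by linear_combination h')
  have e : 2 * (m : ℂ) + g + 1 = m + g + 1 + m := by ring
  rw [etaAbs, etaAbs, add_zero, poch_succ v, poch_succ w, poch_succ _ m, e]
  field_simp

theorem etaAbs_succ_zero (hg : ∀ k : ℕ, g + 1 + k ≠ 0) (m : ℕ) :
    etaAbs g u v w (m + 1) 0 =
      etaAbs g u v w m 1 * ((u + m) * (m + g + 1) / (2 * m + g + 2)) := by
  have h1 : (m : ℂ) + g + 1 ≠ 0 := by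
    intro h
    exact hg m (by linear_combination h)
  have h2 : (m : ℂ) + g + 1 + (m + 1 : ℕ) ≠ 0 := by
    have := hg (m + m + 1)
    push_cast at this ⊢
    intro h
    exact this (by linear_combination h)
  have h3 : poch ((m : ℂ) + g + 1) (m + 1) ≠ 0 := poch_ne_zero fun i _ => by
    have := hg (m + i)
    push_cast at this
    intro h
    exact this (by linear_combination h)
  have e : ((m + 1 : ℕ) : ℂ) + g + 1 = m + g + 1 + 1 := by push_cast; ring
  have e' : 2 * (m : ℂ) + g + 2 = m + g + 1 + (m + 1 : ℕ) := by push_cast; ring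
  rw [etaAbs, etaAbs, add_zero, poch_succ u, e, poch_add_one h1, e']
  field_simp

/-- Comparison of the coefficients of (a)_{k+1} (b)_{k+1} in the recurrence of degree 2m + 2. The
multiplication diagonal and the middle coefficient b_n both contain r₁ as a summand; it has been
cancelled, which leaves an identity in g, u, v, w alone. -/
theorem evenCoeff_recurrence_even (hg : ∀ k : ℕ, g + 1 + k ≠ 0) (nu : ∀ k : ℕ, u + k ≠ 0)
    (nv : ∀ k : ℕ, v + k ≠ 0)
    (nw : ∀ k : ℕ, w + k ≠ 0) (m k : ℕ) :
    (-(1 / 2) - (k + 1 : ℂ)) * evenCoeffEven g u v w (m + 1) (k + 1) -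
        evenCoeffOdd g u v w (m + 1) k =
      oddCoeffEven g u v w (m + 1) (k + 1) +
      (v - 1 / 2 - (m + 1 + v) * (m + g + 2 - w) / (2 * m + g + 3) +
        (m + 1) * (m + u) / (2 * m + g + 2)) * evenCoeffEven g u v w (m + 1) (k + 1) +
      (-((m + g + 1) * (m + g + 2 - u) * (m + 1) * (m + u) / (2 * m + g + 2) ^ 2)) *
        oddCoeffEven g u v w m (k + 1) := by
  have h1 : (m : ℂ) + g + 1 ≠ 0 := fun h => hg m (by linear_combination h)
  have h2 : 2 * (m : ℂ) + g + 2 ≠ 0 := fun h => hg (2 * m + 1) (by push_cast; linear_combination h)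
  have h3 : 2 * (m : ℂ) + g + 3 ≠ 0 := fun h => hg (2 * m + 2) (by push_cast; linear_combination h)
  have hk : (k : ℂ) + 1 ≠ 0 := by exact_mod_cast k.succ_ne_zero
  have huk := nu k
  have hvk := nv k
  have hwk := nw k
  have e1 : 2 * ((m : ℂ) + 1) + g + 1 = 2 * m + g + 3 := by ring
  have e2 : (m : ℂ) + 1 + g + 1 = m + g + 1 + 1 := by ring
  have e3 : -((m : ℂ) + 1) + 1 = -m := by ring
  unfold evenCoeffEven evenCoeffOdd oddCoeffEven
  rw [etaAbs_one hg (m + 1), etaAbs_succ_zero hg m, hypWeight_succ,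
    poch_succ_left (-((m + 1 : ℕ) : ℂ)) k, poch_succ_left ((m : ℂ) + g + 1) k]
  push_cast
  rw [e1, e2, e3, poch_succ _ k, poch_succ _ k]
  generalize etaAbs g u v w m 1 = H
  generalize poch (-(m : ℂ)) k = a
  generalize poch ((m : ℂ) + g + 1 + 1) k = b
  generalize hypWeight u v w k = Q
  generalize (m : ℂ) = m at *
  generalize (k : ℂ) = k at *
  field_simp
  ring

theorem evenCoeff_recurrence_even_zero (hg : ∀ k : ℕ, g + 1 + k ≠ 0) (m : ℕ) :
    -(1 / 2) * evenCoeffEven g u v w (m + 1) 0 =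
      oddCoeffEven g u v w (m + 1) 0 +
      (v - 1 / 2 - (m + 1 + v) * (m + g + 2 - w) / (2 * m + g + 3) +
        (m + 1) * (m + u) / (2 * m + g + 2)) * evenCoeffEven g u v w (m + 1) 0 +
      (-((m + g + 1) * (m + g + 2 - u) * (m + 1) * (m + u) / (2 * m + g + 2) ^ 2)) *
        oddCoeffEven g u v w m 0 := by
  have h1 : (m : ℂ) + g + 1 ≠ 0 := fun h => hg m (by linear_combination h)
  have h2 : 2 * (m : ℂ) + g + 2 ≠ 0 := fun h => hg (2 * m + 1) (by push_cast; linear_combination h)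
  have h3 : 2 * (m : ℂ) + g + 3 ≠ 0 := fun h => hg (2 * m + 2) (by push_cast; linear_combination h)
  have e1 : 2 * ((m : ℂ) + 1) + g + 1 = 2 * m + g + 3 := by ring
  unfold evenCoeffEven oddCoeffEven
  rw [etaAbs_one hg (m + 1), etaAbs_succ_zero hg m]
  simp only [poch_zero]
  push_cast
  rw [e1]
  generalize etaAbs g u v w m 1 = H
  generalize hypWeight u v w 0 = Q
  generalize (m : ℂ) = m at *
  field_simp
  ring

/-- Comparison of the coefficients of (a)_{k+1} (b)_k. Here r₁ enters the two sides with opposite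
signs, so 2 r₁ = g + 2 - u - v - w survives. -/
theorem oddCoeff_recurrence_even (hg : ∀ k : ℕ, g + 1 + k ≠ 0)
    (nv : ∀ k : ℕ, v + k ≠ 0) (nw : ∀ k : ℕ, w + k ≠ 0) (m k : ℕ) :
    evenCoeffEven g u v w (m + 1) k +
        (k + 1 / 2 - (g + 2 - u - v - w)) * evenCoeffOdd g u v w (m + 1) k =
      oddCoeffOdd g u v w (m + 1) k +
      (v - 1 / 2 - (m + 1 + v) * (m + g + 2 - w) / (2 * m + g + 3) +
        (m + 1) * (m + u) / (2 * m + g + 2)) * evenCoeffOdd g u v w (m + 1) k +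
      (-((m + g + 1) * (m + g + 2 - u) * (m + 1) * (m + u) / (2 * m + g + 2) ^ 2)) *
        oddCoeffOdd g u v w m k := by
  have h1 : (m : ℂ) + g + 1 ≠ 0 := fun h => hg m (by linear_combination h)
  have h2 : 2 * (m : ℂ) + g + 2 ≠ 0 := fun h => hg (2 * m + 1) (by push_cast; linear_combination h)
  have h3 : 2 * (m : ℂ) + g + 3 ≠ 0 := fun h => hg (2 * m + 2) (by push_cast; linear_combination h)
  have hvk := nv k
  have hwk := nw k
  have e1 : 2 * ((m : ℂ) + 1) + g + 1 = 2 * m + g + 3 := by ring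
  have e2 : (m : ℂ) + 1 + g + 1 = m + g + 1 + 1 := by ring
  have e3 : -((m : ℂ) + 1) + 1 = -m := by ring
  have hm : -((m : ℂ) + 1) ≠ 0 := neg_ne_zero.2 (by exact_mod_cast m.succ_ne_zero)
  have hm' : (m : ℂ) + 1 ≠ 0 := neg_ne_zero.1 hm
  -- The degrees 2m + 2 and 2m + 1 involve (-(m+1))_k and (-m)_k; expressing one by the other leaves
  -- a single Pochhammer symbol to factor out.
  have e4 : poch (-(m : ℂ)) k = poch (-((m : ℂ) + 1)) k * (m + 1 - k) / (m + 1) := by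
    rw [← e3, poch_add_one hm, div_eq_div_iff hm hm']
    ring
  unfold evenCoeffEven evenCoeffOdd oddCoeffOdd
  rw [etaAbs_one hg (m + 1), etaAbs_succ_zero hg m, poch_succ_left ((m : ℂ) + g + 1) k]
  push_cast
  rw [e1, e2, poch_succ _ k, poch_succ _ k, e4]
  generalize etaAbs g u v w m 1 = H
  generalize poch (-((m : ℂ) + 1)) k = a
  generalize poch ((m : ℂ) + g + 1 + 1) k = b
  generalize hypWeight u v w k = Q
  generalize (m : ℂ) = m at *
  generalize (k : ℂ) = k at *
  clear e4 hm e3 e2 e1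
  rw [mul_comm 2 m] at *
  field_simp
  ring

theorem evenCoeff_recurrence_odd (hg : ∀ k : ℕ, g + 1 + k ≠ 0) (nu : ∀ k : ℕ, u + k ≠ 0)
    (nv : ∀ k : ℕ, v + k ≠ 0) (nw : ∀ k : ℕ, w + k ≠ 0) (m k : ℕ) :
    (-(1 / 2) - (k + 1 : ℂ)) * oddCoeffEven g u v w m (k + 1) - oddCoeffOdd g u v w m k =
      evenCoeffEven g u v w (m + 1) (k + 1) +
      (v - 1 / 2 - (m + g + 1) * (m + g + 2 - u) / (2 * m + g + 2) +
        (m + g + 1 - v) * (m + w) / (2 * m + g + 1)) * oddCoeffEven g u v w m (k + 1) +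
      (-((m + v) * (m + g + 1 - w) * (m + g + 1 - v) * (m + w) / (2 * m + g + 1) ^ 2)) *
        evenCoeffEven g u v w m (k + 1) := by
  have h0 : 2 * (m : ℂ) + g + 1 ≠ 0 := fun h => hg (2 * m) (by push_cast; linear_combination h)
  have h1 : (m : ℂ) + g + 1 ≠ 0 := fun h => hg m (by linear_combination h)
  have h2 : 2 * (m : ℂ) + g + 2 ≠ 0 := fun h => hg (2 * m + 1) (by push_cast; linear_combination h)
  have hk : (k : ℂ) + 1 ≠ 0 := by exact_mod_cast k.succ_ne_zero
  have hvk := nv k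
  have hwk := nw k
  have huk := nu k
  have hmv := nv m
  have hmw := nw m
  have e2 : (m : ℂ) + 1 + g + 1 = m + g + 1 + 1 := by ring
  have e3 : -((m : ℂ) + 1) + 1 = -m := by ring
  unfold evenCoeffEven oddCoeffEven oddCoeffOdd
  rw [etaAbs_succ_zero hg m, etaAbs_one hg m, hypWeight_succ,
    poch_succ_left (-((m + 1 : ℕ) : ℂ)) k]
  push_cast
  rw [e2, e3, poch_add_one h1, poch_succ (-(m : ℂ)) k]
  push_cast
  generalize etaAbs g u v w m 0 = H
  generalize poch (-(m : ℂ)) k = a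
  generalize poch ((m : ℂ) + g + 1) (k + 1) = b
  generalize hypWeight u v w k = Q
  generalize (m : ℂ) = m at *
  generalize (k : ℂ) = k at *
  field_simp
  ring

theorem evenCoeff_recurrence_odd_zero (hg : ∀ k : ℕ, g + 1 + k ≠ 0) (m : ℕ) :
    -(1 / 2) * oddCoeffEven g u v w m 0 =
      evenCoeffEven g u v w (m + 1) 0 +
      (v - 1 / 2 - (m + g + 1) * (m + g + 2 - u) / (2 * m + g + 2) +
        (m + g + 1 - v) * (m + w) / (2 * m + g + 1)) * oddCoeffEven g u v w m 0 +
      (-((m + v) * (m + g + 1 - w) * (m + g + 1 - v) * (m + w) / (2 * m + g + 1) ^ 2)) *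
        evenCoeffEven g u v w m 0 := by
  have h0 : 2 * (m : ℂ) + g + 1 ≠ 0 := fun h => hg (2 * m) (by push_cast; linear_combination h)
  have h1 : (m : ℂ) + g + 1 ≠ 0 := fun h => hg m (by linear_combination h)
  have h2 : 2 * (m : ℂ) + g + 2 ≠ 0 := fun h => hg (2 * m + 1) (by push_cast; linear_combination h)
  unfold evenCoeffEven oddCoeffEven
  rw [etaAbs_succ_zero hg m, etaAbs_one hg m]
  simp only [poch_zero]
  generalize etaAbs g u v w m 0 = H
  generalize hypWeight u v w 0 = Q
  generalize (m : ℂ) = m at *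
  field_simp
  ring

theorem oddCoeff_recurrence_odd (hg : ∀ k : ℕ, g + 1 + k ≠ 0)
    (nv : ∀ k : ℕ, v + k ≠ 0) (nw : ∀ k : ℕ, w + k ≠ 0) (m k : ℕ) :
    oddCoeffEven g u v w m k +
        (k + 1 / 2 - (g + 2 - u - v - w)) * oddCoeffOdd g u v w m k =
      evenCoeffOdd g u v w (m + 1) k +
      (v - 1 / 2 - (m + g + 1) * (m + g + 2 - u) / (2 * m + g + 2) +
        (m + g + 1 - v) * (m + w) / (2 * m + g + 1)) * oddCoeffOdd g u v w m k +
      (-((m + v) * (m + g + 1 - w) * (m + g + 1 - v) * (m + w) / (2 * m + g + 1) ^ 2)) *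
        evenCoeffOdd g u v w m k := by
  have h0 : 2 * (m : ℂ) + g + 1 ≠ 0 := fun h => hg (2 * m) (by push_cast; linear_combination h)
  have h1 : (m : ℂ) + g + 1 ≠ 0 := fun h => hg m (by linear_combination h)
  have h2 : 2 * (m : ℂ) + g + 2 ≠ 0 := fun h => hg (2 * m + 1) (by push_cast; linear_combination h)
  have hvk := nv k
  have hwk := nw k
  have e2 : (m : ℂ) + 1 + g + 1 = m + g + 1 + 1 := by ring
  have e3 : -((m : ℂ) + 1) + 1 = -m := by ring
  unfold oddCoeffEven evenCoeffOdd oddCoeffOdd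
  rw [etaAbs_succ_zero hg m, etaAbs_one hg m, poch_succ_left (-((m + 1 : ℕ) : ℂ)) k]
  push_cast
  rw [e2, e3, poch_add_one h1, poch_succ _ k, poch_succ _ k]
  generalize etaAbs g u v w m 0 = H
  generalize poch (-(m : ℂ)) k = a
  generalize poch ((m : ℂ) + g + 1) k = b
  generalize hypWeight u v w k = Q
  generalize (m : ℂ) = m at *
  generalize (k : ℂ) = k at *
  rw [mul_comm 2 m] at *
  field_simp
  ring

end Coefficients

/-! The recurrence coefficients as rational functions of the degree. -/

def recAEven (n ρ₁ ρ₂ r₁ r₂ : ℂ) : ℂ :=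
  (n + 2 * ρ₁ - 2 * r₁ + 1) * (n + 2 * ρ₁ - 2 * r₂ + 1) / (4 * (n + (ρ₁ + ρ₂ - r₁ - r₂) + 1))

def recAOdd (n ρ₁ ρ₂ r₁ r₂ : ℂ) : ℂ :=
  (n + 2 * (ρ₁ + ρ₂ - r₁ - r₂) + 1) * (n + 2 * ρ₁ + 2 * ρ₂ + 1) /
    (4 * (n + (ρ₁ + ρ₂ - r₁ - r₂) + 1))

def recCEven (n ρ₁ ρ₂ r₁ r₂ : ℂ) : ℂ :=
  -(n * (n - 2 * r₁ - 2 * r₂) / (4 * (n + (ρ₁ + ρ₂ - r₁ - r₂))))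

def recCOdd (n ρ₁ ρ₂ r₁ r₂ : ℂ) : ℂ :=
  -((n + 2 * ρ₂ - 2 * r₂) * (n + 2 * ρ₂ - 2 * r₁) / (4 * (n + (ρ₁ + ρ₂ - r₁ - r₂))))

/-! ### The three-term recurrence for generic parameters. -/

theorem biPoly_recurrence_even_generic {x ρ₁ ρ₂ r₁ r₂ : ℂ}
    (hg : ∀ k : ℕ, ρ₁ + ρ₂ - r₁ - r₂ + 1 + k ≠ 0) (nu : ∀ k : ℕ, 1 - r₁ - r₂ + k ≠ 0)
    (nv : ∀ k : ℕ, ρ₁ - r₁ + 1 / 2 + k ≠ 0) (nw : ∀ k : ℕ, ρ₂ - r₁ + 1 / 2 + k ≠ 0) (m : ℕ) :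
    x * biPoly (2 * (m + 1)) x ρ₁ ρ₂ r₁ r₂ =
      biPoly (2 * (m + 1) + 1) x ρ₁ ρ₂ r₁ r₂ +
      (ρ₁ - recAEven (2 * m + 2) ρ₁ ρ₂ r₁ r₂ - recCEven (2 * m + 2) ρ₁ ρ₂ r₁ r₂) *
        biPoly (2 * (m + 1)) x ρ₁ ρ₂ r₁ r₂ +
      recAOdd (2 * m + 1) ρ₁ ρ₂ r₁ r₂ * recCEven (2 * m + 2) ρ₁ ρ₂ r₁ r₂ *
        biPoly (2 * m + 1) x ρ₁ ρ₂ r₁ r₂ := by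
  have h2 : 2 * (m : ℂ) + 2 + (ρ₁ + ρ₂ - r₁ - r₂) ≠ 0 :=
    fun h => hg (2 * m + 1) (by push_cast; linear_combination h)
  have h3 : 2 * (m : ℂ) + 3 + (ρ₁ + ρ₂ - r₁ - r₂) ≠ 0 :=
    fun h => hg (2 * m + 2) (by push_cast; linear_combination h)
  -- The common length m + 3 covers all three degrees, so both sides become basis sums that can be
  -- compared termwise.
  rw [biPoly_even_expansion rfl rfl rfl rfl nu nv nw (show m + 1 < m + 2 + 1 by omega),
    biPoly_odd_expansion rfl rfl rfl rfl nu nv nw (show m + 1 < m + 2 + 1 by omega),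
    biPoly_odd_expansion rfl rfl rfl rfl nu nv nw (show m < m + 2 + 1 by omega),
    mul_basisSum, basisSum_combination]
  · generalize hu : 1 - r₁ - r₂ = u at *
    generalize hv : ρ₁ - r₁ + 1 / 2 = v at *
    generalize hw : ρ₂ - r₁ + 1 / 2 = w at *
    generalize hG : ρ₁ + ρ₂ - r₁ - r₂ = g at *
    have hA : ρ₁ - recAEven (2 * m + 2) ρ₁ ρ₂ r₁ r₂ - recCEven (2 * m + 2) ρ₁ ρ₂ r₁ r₂ =
        r₁ + (v - 1 / 2 - (m + 1 + v) * (m + g + 2 - w) / (2 * m + g + 3) +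
          (m + 1) * (m + u) / (2 * m + g + 2)) := by
      have e1 : 2 * (m : ℂ) + g + 3 = 2 * m + 2 + g + 1 := by ring
      have e2 : 2 * (m : ℂ) + g + 2 = 2 * m + 2 + g := by ring
      have h3' : 2 * (m : ℂ) + 2 + g + 1 ≠ 0 := fun h => h3 (by linear_combination h)
      unfold recAEven recCEven
      rw [hG, e1, e2]
      have e3 : (2 * (m : ℂ) + 2 + 2 * ρ₁ - 2 * r₁ + 1) * (2 * m + 2 + 2 * ρ₁ - 2 * r₂ + 1) =
          4 * ((m + 1 + v) * (m + g + 2 - w)) := by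
        rw [← hv, ← hw, ← hG]; ring
      have e4 : (2 * (m : ℂ) + 2) * (2 * m + 2 - 2 * r₁ - 2 * r₂) =
          4 * ((m + 1) * (m + u)) := by
        rw [← hu]; ring
      have e5 : ρ₁ = r₁ + v - 1 / 2 := by rw [← hv]; ring
      have h4 : (4 : ℂ) ≠ 0 := by norm_num
      rw [e3, e4, mul_div_mul_left _ _ h4, mul_div_mul_left _ _ h4]
      linear_combination e5
    have hC : recAOdd (2 * m + 1) ρ₁ ρ₂ r₁ r₂ * recCEven (2 * m + 2) ρ₁ ρ₂ r₁ r₂ =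
        -((m + g + 1) * (m + g + 2 - u) * (m + 1) * (m + u) / (2 * m + g + 2) ^ 2) := by
      have e1 : 2 * (m : ℂ) + g + 2 = 2 * m + 2 + g := by ring
      have e2 : 2 * (m : ℂ) + 1 + g + 1 = 2 * m + 2 + g := by ring
      unfold recAOdd recCEven
      rw [hG, e1, e2, ← hu]
      have e4 : ρ₁ = g + r₁ + r₂ - ρ₂ := by rw [← hG]; ring
      rw [e4]
      field_simp
      ring
    rw [hA, hC]
    refine basisSum_congr (fun k => ?_) (fun k => ?_)
    · rcases k with - | k
      · have := evenCoeff_recurrence_even_zero (u := u) (v := v) (w := w) hg m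
        rw [if_pos rfl]
        push_cast
        linear_combination this
      · have := evenCoeff_recurrence_even hg nu nv nw m k
        rw [if_neg k.succ_ne_zero, Nat.add_sub_cancel]
        push_cast
        linear_combination this
    · have := oddCoeff_recurrence_even (u := u) hg nv nw m k
      have e : g + 2 - u - v - w = 2 * r₁ := by rw [← hG, ← hu, ← hv, ← hw]; ring
      rw [e] at this
      linear_combination this
  -- The boundary condition of `mul_basisSum`: the coefficient at the end of the range contains a
  -- vanishing (-(m+1))_{m+3}.
  · rw [evenCoeffOdd, poch_neg_eq_zero (by omega)]
    ring

theorem biPoly_recurrence_odd_generic {x ρ₁ ρ₂ r₁ r₂ : ℂ}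
    (hg : ∀ k : ℕ, ρ₁ + ρ₂ - r₁ - r₂ + 1 + k ≠ 0) (nu : ∀ k : ℕ, 1 - r₁ - r₂ + k ≠ 0)
    (nv : ∀ k : ℕ, ρ₁ - r₁ + 1 / 2 + k ≠ 0) (nw : ∀ k : ℕ, ρ₂ - r₁ + 1 / 2 + k ≠ 0) (m : ℕ) :
    x * biPoly (2 * m + 1) x ρ₁ ρ₂ r₁ r₂ =
      biPoly (2 * (m + 1)) x ρ₁ ρ₂ r₁ r₂ +
      (ρ₁ - recAOdd (2 * m + 1) ρ₁ ρ₂ r₁ r₂ - recCOdd (2 * m + 1) ρ₁ ρ₂ r₁ r₂) *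
        biPoly (2 * m + 1) x ρ₁ ρ₂ r₁ r₂ +
      recAEven (2 * m) ρ₁ ρ₂ r₁ r₂ * recCOdd (2 * m + 1) ρ₁ ρ₂ r₁ r₂ *
        biPoly (2 * m) x ρ₁ ρ₂ r₁ r₂ := by
  have h1 : 2 * (m : ℂ) + 1 + (ρ₁ + ρ₂ - r₁ - r₂) ≠ 0 :=
    fun h => hg (2 * m) (by push_cast; linear_combination h)
  have h2 : 2 * (m : ℂ) + 2 + (ρ₁ + ρ₂ - r₁ - r₂) ≠ 0 :=
    fun h => hg (2 * m + 1) (by push_cast; linear_combination h)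
  rw [biPoly_even_expansion rfl rfl rfl rfl nu nv nw (show m + 1 < m + 2 + 1 by omega),
    biPoly_odd_expansion rfl rfl rfl rfl nu nv nw (show m < m + 2 + 1 by omega),
    biPoly_even_expansion rfl rfl rfl rfl nu nv nw (show m < m + 2 + 1 by omega),
    mul_basisSum, basisSum_combination]
  · generalize hu : 1 - r₁ - r₂ = u at *
    generalize hv : ρ₁ - r₁ + 1 / 2 = v at *
    generalize hw : ρ₂ - r₁ + 1 / 2 = w at *
    generalize hG : ρ₁ + ρ₂ - r₁ - r₂ = g at *
    have hA : ρ₁ - recAOdd (2 * m + 1) ρ₁ ρ₂ r₁ r₂ - recCOdd (2 * m + 1) ρ₁ ρ₂ r₁ r₂ =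
        r₁ + (v - 1 / 2 - (m + g + 1) * (m + g + 2 - u) / (2 * m + g + 2) +
          (m + g + 1 - v) * (m + w) / (2 * m + g + 1)) := by
      have e1 : 2 * (m : ℂ) + g + 2 = 2 * m + 1 + g + 1 := by ring
      have e2 : 2 * (m : ℂ) + g + 1 = 2 * m + 1 + g := by ring
      unfold recAOdd recCOdd
      rw [hG, e1, e2]
      have e3 : (2 * (m : ℂ) + 1 + 2 * g + 1) * (2 * m + 1 + 2 * ρ₁ + 2 * ρ₂ + 1) =
          4 * ((m + g + 1) * (m + g + 2 - u)) := by
        rw [← hu, ← hG]; ring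
      have e4 : (2 * (m : ℂ) + 1 + 2 * ρ₂ - 2 * r₂) * (2 * m + 1 + 2 * ρ₂ - 2 * r₁) =
          4 * ((m + g + 1 - v) * (m + w)) := by
        rw [← hv, ← hw, ← hG]; ring
      have e5 : ρ₁ = r₁ + v - 1 / 2 := by rw [← hv]; ring
      have h4 : (4 : ℂ) ≠ 0 := by norm_num
      rw [e3, e4, mul_div_mul_left _ _ h4, mul_div_mul_left _ _ h4]
      linear_combination e5
    have hC : recAEven (2 * m) ρ₁ ρ₂ r₁ r₂ * recCOdd (2 * m + 1) ρ₁ ρ₂ r₁ r₂ =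
        -((m + v) * (m + g + 1 - w) * (m + g + 1 - v) * (m + w) / (2 * m + g + 1) ^ 2) := by
      have e1 : 2 * (m : ℂ) + g + 1 = 2 * m + 1 + g := by ring
      have e2 : 2 * (m : ℂ) + g + 1 = 2 * m + 1 + g := by ring
      unfold recAEven recCOdd
      rw [hG, e2, ← hv, ← hw]
      have e4 : r₂ = ρ₁ + ρ₂ - r₁ - g := by rw [← hG]; ring
      rw [e4]
      field_simp
      ring
    rw [hA, hC]
    refine basisSum_congr (fun k => ?_) (fun k => ?_)
    · rcases k with - | k
      · have := evenCoeff_recurrence_odd_zero (u := u) (v := v) (w := w) hg m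
        rw [if_pos rfl]
        push_cast
        linear_combination this
      · have := evenCoeff_recurrence_odd hg nu nv nw m k
        rw [if_neg k.succ_ne_zero, Nat.add_sub_cancel]
        push_cast
        linear_combination this
    · have := oddCoeff_recurrence_odd (u := u) hg nv nw m k
      have e : g + 2 - u - v - w = 2 * r₁ := by rw [← hG, ← hu, ← hv, ← hw]; ring
      rw [e] at this
      linear_combination this
  · rw [oddCoeffOdd, poch_neg_eq_zero (by omega)]
    ring

/-! ### Removal of the genericity assumptions by continuity. -/

/-- The direction (1, 1, 0, 2) leaves g unchanged, hence also every denominator that depends on the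
parameters, while it moves each of u, v, w off the nonpositive integers. -/
theorem continuous_biPoly_shift (n : ℕ) (x ρ₁ ρ₂ r₁ r₂ : ℂ) :
    Continuous fun t => biPoly n x (ρ₁ + t) (ρ₂ + t) r₁ (r₂ + 2 * t) := by
  have hg : ∀ t, ρ₁ + t + (ρ₂ + t) - r₁ - (r₂ + 2 * t) = ρ₁ + ρ₂ - r₁ - r₂ := fun t => by ring
  unfold biPoly poch
  simp only [hg]
  fun_prop

/-- Two continuous functions of `t` agree at `0` if they agree whenever `a + t`, `b + t` and
`c - 2 * t` avoid the nonpositive integers. -/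
theorem eq_at_zero_of_generic {f h : ℂ → ℂ} (hf : Continuous f) (hh : Continuous h) (a b c : ℂ)
    (H : ∀ t, (∀ k : ℕ, a + t + k ≠ 0) → (∀ k : ℕ, b + t + k ≠ 0) → (∀ k : ℕ, c - 2 * t + k ≠ 0) →
      f t = h t) : f 0 = h 0 := by
  let s : Set ℂ := Set.range (fun k : ℕ => -a - k) ∪ Set.range (fun k : ℕ => -b - k) ∪
    Set.range (fun k : ℕ => (c + k) / 2)
  have hs : s.Countable :=
    ((Set.countable_range _).union (Set.countable_range _)).union (Set.countable_range _)
  -- The excluded t form a countable set, so its complement in the plane is dense.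
  have hd : Dense sᶜ := hs.dense_compl ℝ
  refine congrFun (hf.ext_on hd hh fun t ht => H t ?_ ?_ ?_) 0
  · intro k hk
    exact ht (Or.inl (Or.inl ⟨k, by dsimp only; linear_combination -hk⟩))
  · intro k hk
    exact ht (Or.inl (Or.inr ⟨k, by dsimp only; linear_combination -hk⟩))
  · intro k hk
    exact ht (Or.inr ⟨k, by dsimp only; linear_combination hk / 2⟩)

theorem biPoly_recurrence_even {ρ₁ ρ₂ r₁ r₂ : ℂ}
    (hg : ∀ k : ℕ, ρ₁ + ρ₂ - r₁ - r₂ + 1 + k ≠ 0) (x : ℂ) (m : ℕ) :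
    x * biPoly (2 * (m + 1)) x ρ₁ ρ₂ r₁ r₂ =
      biPoly (2 * (m + 1) + 1) x ρ₁ ρ₂ r₁ r₂ +
      (ρ₁ - recAEven (2 * m + 2) ρ₁ ρ₂ r₁ r₂ - recCEven (2 * m + 2) ρ₁ ρ₂ r₁ r₂) *
        biPoly (2 * (m + 1)) x ρ₁ ρ₂ r₁ r₂ +
      recAOdd (2 * m + 1) ρ₁ ρ₂ r₁ r₂ * recCEven (2 * m + 2) ρ₁ ρ₂ r₁ r₂ *
        biPoly (2 * m + 1) x ρ₁ ρ₂ r₁ r₂ := by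
  have e : ∀ t, ρ₁ + t + (ρ₂ + t) - r₁ - (r₂ + 2 * t) = ρ₁ + ρ₂ - r₁ - r₂ := fun t => by ring
  have c0 := continuous_biPoly_shift (2 * (m + 1) + 1) x ρ₁ ρ₂ r₁ r₂
  have c1 := continuous_biPoly_shift (2 * (m + 1)) x ρ₁ ρ₂ r₁ r₂
  have c2 := continuous_biPoly_shift (2 * m + 1) x ρ₁ ρ₂ r₁ r₂
  have key := eq_at_zero_of_generic (f := fun t =>
      x * biPoly (2 * (m + 1)) x (ρ₁ + t) (ρ₂ + t) r₁ (r₂ + 2 * t))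
    (h := fun t => biPoly (2 * (m + 1) + 1) x (ρ₁ + t) (ρ₂ + t) r₁ (r₂ + 2 * t) +
      (ρ₁ + t - recAEven (2 * m + 2) (ρ₁ + t) (ρ₂ + t) r₁ (r₂ + 2 * t) -
        recCEven (2 * m + 2) (ρ₁ + t) (ρ₂ + t) r₁ (r₂ + 2 * t)) *
        biPoly (2 * (m + 1)) x (ρ₁ + t) (ρ₂ + t) r₁ (r₂ + 2 * t) +
      recAOdd (2 * m + 1) (ρ₁ + t) (ρ₂ + t) r₁ (r₂ + 2 * t) *
        recCEven (2 * m + 2) (ρ₁ + t) (ρ₂ + t) r₁ (r₂ + 2 * t) *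
        biPoly (2 * m + 1) x (ρ₁ + t) (ρ₂ + t) r₁ (r₂ + 2 * t))
    (by fun_prop) (by unfold recAEven recCEven recAOdd; simp only [e]; fun_prop)
    (ρ₁ - r₁ + 1 / 2) (ρ₂ - r₁ + 1 / 2) (1 - r₁ - r₂)
    (fun t h1 h2 h3 => biPoly_recurrence_even_generic (by simpa only [e] using hg)
      (fun k h => h3 k (by linear_combination h)) (fun k h => h1 k (by linear_combination h))
      (fun k h => h2 k (by linear_combination h)) m)
  simpa using key

theorem biPoly_recurrence_odd {ρ₁ ρ₂ r₁ r₂ : ℂ}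
    (hg : ∀ k : ℕ, ρ₁ + ρ₂ - r₁ - r₂ + 1 + k ≠ 0) (x : ℂ) (m : ℕ) :
    x * biPoly (2 * m + 1) x ρ₁ ρ₂ r₁ r₂ =
      biPoly (2 * (m + 1)) x ρ₁ ρ₂ r₁ r₂ +
      (ρ₁ - recAOdd (2 * m + 1) ρ₁ ρ₂ r₁ r₂ - recCOdd (2 * m + 1) ρ₁ ρ₂ r₁ r₂) *
        biPoly (2 * m + 1) x ρ₁ ρ₂ r₁ r₂ +
      recAEven (2 * m) ρ₁ ρ₂ r₁ r₂ * recCOdd (2 * m + 1) ρ₁ ρ₂ r₁ r₂ *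
        biPoly (2 * m) x ρ₁ ρ₂ r₁ r₂ := by
  have e : ∀ t, ρ₁ + t + (ρ₂ + t) - r₁ - (r₂ + 2 * t) = ρ₁ + ρ₂ - r₁ - r₂ := fun t => by ring
  have c0 := continuous_biPoly_shift (2 * (m + 1)) x ρ₁ ρ₂ r₁ r₂
  have c1 := continuous_biPoly_shift (2 * m + 1) x ρ₁ ρ₂ r₁ r₂
  have c2 := continuous_biPoly_shift (2 * m) x ρ₁ ρ₂ r₁ r₂
  have key := eq_at_zero_of_generic (f := fun t =>
      x * biPoly (2 * m + 1) x (ρ₁ + t) (ρ₂ + t) r₁ (r₂ + 2 * t))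
    (h := fun t => biPoly (2 * (m + 1)) x (ρ₁ + t) (ρ₂ + t) r₁ (r₂ + 2 * t) +
      (ρ₁ + t - recAOdd (2 * m + 1) (ρ₁ + t) (ρ₂ + t) r₁ (r₂ + 2 * t) -
        recCOdd (2 * m + 1) (ρ₁ + t) (ρ₂ + t) r₁ (r₂ + 2 * t)) *
        biPoly (2 * m + 1) x (ρ₁ + t) (ρ₂ + t) r₁ (r₂ + 2 * t) +
      recAEven (2 * m) (ρ₁ + t) (ρ₂ + t) r₁ (r₂ + 2 * t) *
        recCOdd (2 * m + 1) (ρ₁ + t) (ρ₂ + t) r₁ (r₂ + 2 * t) *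
        biPoly (2 * m) x (ρ₁ + t) (ρ₂ + t) r₁ (r₂ + 2 * t))
    (by fun_prop) (by unfold recAEven recCOdd recAOdd; simp only [e]; fun_prop)
    (ρ₁ - r₁ + 1 / 2) (ρ₂ - r₁ + 1 / 2) (1 - r₁ - r₂)
    (fun t h1 h2 h3 => biPoly_recurrence_odd_generic (by simpa only [e] using hg)
      (fun k h => h3 k (by linear_combination h)) (fun k h => h1 k (by linear_combination h))
      (fun k h => h2 k (by linear_combination h)) m)
  simpa using key

theorem biPoly_zero (x ρ₁ ρ₂ r₁ r₂ : ℂ) : biPoly 0 x ρ₁ ρ₂ r₁ r₂ = 1 := by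
  simp [biPoly, poch]

theorem biPoly_one {ρ₁ ρ₂ r₁ r₂ : ℂ} (hg : ρ₁ + ρ₂ - r₁ - r₂ + 1 ≠ 0) (x : ℂ) :
    biPoly 1 x ρ₁ ρ₂ r₁ r₂ = x - ρ₁ + recAEven 0 ρ₁ ρ₂ r₁ r₂ := by
  simp [biPoly, poch, recAEven]
  field_simp
  ring

/-! Connection coefficients for the parameter change
`(ρ₁, ρ₂, r₁, r₂) ↦ (ρ₁ + 1/2, -r₂, r₁ - 1/2, -ρ₂)`. -/

def upAEven (n ρ₁ ρ₂ r₁ r₂ : ℂ) : ℂ :=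
  n / 4 * ((2 * ρ₁ - 2 * r₂ + n + 1) / (n + (ρ₁ + ρ₂ - r₁ - r₂) + 1) -
    (n - 2 * r₁ - 2 * r₂) / (n + (ρ₁ + ρ₂ - r₁ - r₂)))

def upAOdd (n ρ₁ ρ₂ r₁ r₂ : ℂ) : ℂ :=
  (2 * ρ₂ - 2 * r₂ + n) / 4 * ((n - 2 * r₁ - 2 * r₂ + 1) / (n + (ρ₁ + ρ₂ - r₁ - r₂) + 1) -
    (2 * ρ₁ - 2 * r₂ + n) / (n + (ρ₁ + ρ₂ - r₁ - r₂)))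

def upBEven (n ρ₁ ρ₂ r₁ r₂ : ℂ) : ℂ :=
  -(n * (2 * ρ₂ - 2 * r₂ + n - 1) * (n - 2 * r₁ - 2 * r₂) * (2 * ρ₁ + 2 * ρ₂ + n) /
    (16 * (n + (ρ₁ + ρ₂ - r₁ - r₂)) ^ 2))

def upBOdd (n ρ₁ ρ₂ r₁ r₂ : ℂ) : ℂ :=
  (n - 1) * (2 * ρ₂ - 2 * r₂ + n) * (n - 2 * r₁ + 2 * ρ₂) * (2 * ρ₁ - 2 * r₂ + n) /
    (16 * (n + (ρ₁ + ρ₂ - r₁ - r₂)) ^ 2)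

/-! The middle coefficients of the three-term recurrence. -/

def recBEven (n ρ₁ ρ₂ r₁ r₂ : ℂ) : ℂ :=
  ρ₁ - recAEven n ρ₁ ρ₂ r₁ r₂ - recCEven n ρ₁ ρ₂ r₁ r₂

def recBOdd (n ρ₁ ρ₂ r₁ r₂ : ℂ) : ℂ :=
  ρ₁ - recAOdd n ρ₁ ρ₂ r₁ r₂ - recCOdd n ρ₁ ρ₂ r₁ r₂

def recUEven (n ρ₁ ρ₂ r₁ r₂ : ℂ) : ℂ :=
  recAOdd (n - 1) ρ₁ ρ₂ r₁ r₂ * recCEven n ρ₁ ρ₂ r₁ r₂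

def recUOdd (n ρ₁ ρ₂ r₁ r₂ : ℂ) : ℂ :=
  recAEven (n - 1) ρ₁ ρ₂ r₁ r₂ * recCOdd n ρ₁ ρ₂ r₁ r₂


/-! Connection coefficients for the parameter change
`(ρ₁, ρ₂, r₁, r₂) ↦ (ρ₁ - 1/2, -r₂, r₁ + 1/2, -ρ₂)`, after multiplication by
`(x + ρ₁) (x + r₁ + 1/2)`. -/

def downAEven (n ρ₁ ρ₂ r₁ r₂ : ℂ) : ℂ :=
  -((ρ₁ + ρ₂ - r₁ - r₂ + n / 2) / (2 * (n + (ρ₁ + ρ₂ - r₁ - r₂) + 1)) *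
    (2 * ρ₁ + 2 * r₁ - (n - 2 * r₁ - 2 * r₂) / (n + (ρ₁ + ρ₂ - r₁ - r₂)) + 1))

def downAOdd (n ρ₁ ρ₂ r₁ r₂ : ℂ) : ℂ :=
  (ρ₁ - r₁ + n / 2) / (2 * (n + (ρ₁ + ρ₂ - r₁ - r₂))) *
    (2 * ρ₁ + 2 * r₁ + (n - 2 * r₁ - 2 * r₂ + 1) / (n + (ρ₁ + ρ₂ - r₁ - r₂) + 1) - 1)

def downBEven (n ρ₁ ρ₂ r₁ r₂ : ℂ) : ℂ :=
  -((2 * ρ₁ - 2 * r₁ + n - 1) * (n - 2 * r₁ - 2 * r₂) * (n + 2 * ρ₁ + 2 * ρ₂) *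
    (ρ₁ + ρ₂ - r₁ - r₂ + n / 2) / (8 * (n + (ρ₁ + ρ₂ - r₁ - r₂)) ^ 2))

def downBOdd (n ρ₁ ρ₂ r₁ r₂ : ℂ) : ℂ :=
  (2 * ρ₁ - 2 * r₁ + n) * (n + 2 * ρ₂ - 2 * r₁) * (n + 2 * ρ₁ - 2 * r₂) *
    (ρ₁ + ρ₂ - r₁ - r₂ + n / 2 - 1 / 2) / (8 * (n + (ρ₁ + ρ₂ - r₁ - r₂)) ^ 2)

/-! ### Rational identities behind the two connection formulas. -/

section Identities

variable {n ρ₁ ρ₂ r₁ r₂ S : ℂ}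

/-- With n a complex variable, each parity needs four identities, one for each hypothesis `i₁` to
`i₄` of `connection_step`: two recursions for the connection coefficients and two vanishing
remainders. -/
theorem up_coeffA_succ_even (hS : S = n + (ρ₁ + ρ₂ - r₁ - r₂))
    (h0 : S ≠ 0) (h1 : S + 1 ≠ 0) (h2 : S + 2 ≠ 0) :
    upAOdd (n + 1) ρ₁ ρ₂ r₁ r₂ =
      -(recBEven n (ρ₁ + 1 / 2) (-r₂) (r₁ - 1 / 2) (-ρ₂) + 1 / 2) - upAEven n ρ₁ ρ₂ r₁ r₂ -
      recBEven n ρ₁ ρ₂ r₁ r₂ := by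
  have e1 : n + 1 + (ρ₁ + ρ₂ - r₁ - r₂) + 1 = S + 2 := by linear_combination -hS
  have e2 : n + (ρ₁ + 1 / 2 + -r₂ - (r₁ - 1 / 2) - -ρ₂) + 1 = S + 2 := by linear_combination -hS
  have e3 : n + (ρ₁ + ρ₂ - r₁ - r₂) + 1 = S + 1 := by linear_combination -hS
  have e4 : n + 1 + (ρ₁ + ρ₂ - r₁ - r₂) = S + 1 := by linear_combination -hS
  have e5 : n + (ρ₁ + 1 / 2 + -r₂ - (r₁ - 1 / 2) - -ρ₂) = S + 1 := by linear_combination -hS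
  have e6 : n + (ρ₁ + ρ₂ - r₁ - r₂) = S := by linear_combination -hS
  unfold recBEven recAEven recCEven upAEven upAOdd
  rw [e1, e2, e3, e4, e5, e6]
  -- Every denominator is now built from integer translates of S. Eliminating ρ₂ makes S an
  -- independent variable, and what remains is a polynomial identity after clearing denominators.
  obtain rfl : ρ₂ = S - n - ρ₁ + r₁ + r₂ := by rw [hS]; ring
  clear hS e1 e2 e3 e4 e5 e6
  field_simp
  ring

theorem up_coeffB_succ_even (hS : S = n + (ρ₁ + ρ₂ - r₁ - r₂))
    (h0 : S ≠ 0) (h1 : S + 1 ≠ 0) :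
    upBOdd (n + 1) ρ₁ ρ₂ r₁ r₂ =
      -recUEven n (ρ₁ + 1 / 2) (-r₂) (r₁ - 1 / 2) (-ρ₂) -
        upAEven n ρ₁ ρ₂ r₁ r₂ * (recBOdd (n - 1) (ρ₁ + 1 / 2) (-r₂) (r₁ - 1 / 2) (-ρ₂) + 1 / 2) -
        upBEven n ρ₁ ρ₂ r₁ r₂ - recBEven n ρ₁ ρ₂ r₁ r₂ * upAEven n ρ₁ ρ₂ r₁ r₂ +
        recUEven n ρ₁ ρ₂ r₁ r₂ := by
  have e1 : n - 1 + (ρ₁ + 1 / 2 + -r₂ - (r₁ - 1 / 2) - -ρ₂) + 1 = S + 1 := by linear_combination -hS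
  have e2 : n + (ρ₁ + ρ₂ - r₁ - r₂) + 1 = S + 1 := by linear_combination -hS
  have e3 : n - 1 + (ρ₁ + ρ₂ - r₁ - r₂) + 1 = S := by linear_combination -hS
  have e4 : n + 1 + (ρ₁ + ρ₂ - r₁ - r₂) = S + 1 := by linear_combination -hS
  have e5 : n + (ρ₁ + 1 / 2 + -r₂ - (r₁ - 1 / 2) - -ρ₂) = S + 1 := by linear_combination -hS
  have e6 : n + (ρ₁ + ρ₂ - r₁ - r₂) = S := by linear_combination -hS
  have e7 : n - 1 + (ρ₁ + 1 / 2 + -r₂ - (r₁ - 1 / 2) - -ρ₂) = S := by linear_combination -hS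
  unfold recUEven recBEven recBOdd recAEven recAOdd recCEven recCOdd upAEven upBEven upBOdd
  rw [e1, e2, e3, e4, e5, e6, e7]
  obtain rfl : ρ₂ = S - n - ρ₁ + r₁ + r₂ := by rw [hS]; ring
  clear hS e1 e2 e3 e4 e5 e6 e7
  field_simp
  ring

theorem up_upper_remainder_even (hS : S = n + (ρ₁ + ρ₂ - r₁ - r₂))
    (h0 : S - 1 ≠ 0) (h1 : S ≠ 0) (h2 : S + 1 ≠ 0) :
    upAEven n ρ₁ ρ₂ r₁ r₂ * recUOdd (n - 1) (ρ₁ + 1 / 2) (-r₂) (r₁ - 1 / 2) (-ρ₂) +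
      upBEven n ρ₁ ρ₂ r₁ r₂ * (recBEven (n - 2) (ρ₁ + 1 / 2) (-r₂) (r₁ - 1 / 2) (-ρ₂) + 1 / 2) +
      recBEven n ρ₁ ρ₂ r₁ r₂ * upBEven n ρ₁ ρ₂ r₁ r₂ +
      recUEven n ρ₁ ρ₂ r₁ r₂ * upAOdd (n - 1) ρ₁ ρ₂ r₁ r₂ = 0 := by
  have e1 : n + (ρ₁ + ρ₂ - r₁ - r₂) + 1 = S + 1 := by linear_combination -hS
  have e2 : n - 1 - 1 + (ρ₁ + 1 / 2 + -r₂ - (r₁ - 1 / 2) - -ρ₂) + 1 = S := by linear_combination -hS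
  have e3 : n - 2 + (ρ₁ + 1 / 2 + -r₂ - (r₁ - 1 / 2) - -ρ₂) + 1 = S := by linear_combination -hS
  have e4 : n - 1 + (ρ₁ + ρ₂ - r₁ - r₂) + 1 = S := by linear_combination -hS
  have e5 : n + (ρ₁ + ρ₂ - r₁ - r₂) = S := by linear_combination -hS
  have e6 : n - 1 + (ρ₁ + 1 / 2 + -r₂ - (r₁ - 1 / 2) - -ρ₂) = S := by linear_combination -hS
  have e7 : n - 2 + (ρ₁ + 1 / 2 + -r₂ - (r₁ - 1 / 2) - -ρ₂) = S - 1 := by linear_combination -hS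
  have e8 : n - 1 + (ρ₁ + ρ₂ - r₁ - r₂) = S - 1 := by linear_combination -hS
  unfold recUEven recUOdd recBEven recAEven recAOdd recCEven recCOdd upAEven upAOdd upBEven
  rw [e1, e2, e3, e4, e5, e6, e7, e8]
  obtain rfl : ρ₂ = S - n - ρ₁ + r₁ + r₂ := by rw [hS]; ring
  clear hS e1 e2 e3 e4 e5 e6 e7 e8
  field_simp
  ring

theorem up_lower_remainder_even (hS : S = n + (ρ₁ + ρ₂ - r₁ - r₂))
    (h0 : S - 1 ≠ 0) (h1 : S ≠ 0) :
    upBEven n ρ₁ ρ₂ r₁ r₂ * recUEven (n - 2) (ρ₁ + 1 / 2) (-r₂) (r₁ - 1 / 2) (-ρ₂) +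
      recUEven n ρ₁ ρ₂ r₁ r₂ * upBOdd (n - 1) ρ₁ ρ₂ r₁ r₂ = 0 := by
  have e1 : n - 2 - 1 + (ρ₁ + 1 / 2 + -r₂ - (r₁ - 1 / 2) - -ρ₂) + 1 = S - 1 :=
      by linear_combination -hS
  have e2 : n - 1 + (ρ₁ + ρ₂ - r₁ - r₂) + 1 = S := by linear_combination -hS
  have e3 : n + (ρ₁ + ρ₂ - r₁ - r₂) = S := by linear_combination -hS
  have e4 : n - 2 + (ρ₁ + 1 / 2 + -r₂ - (r₁ - 1 / 2) - -ρ₂) = S - 1 := by linear_combination -hS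
  have e5 : n - 1 + (ρ₁ + ρ₂ - r₁ - r₂) = S - 1 := by linear_combination -hS
  unfold recUEven recAOdd recCEven upBEven upBOdd
  rw [e1, e2, e3, e4, e5]
  obtain rfl : ρ₂ = S - n - ρ₁ + r₁ + r₂ := by rw [hS]; ring
  clear hS e1 e2 e3 e4 e5
  field_simp
  ring

theorem up_coeffA_succ_odd (hS : S = n + (ρ₁ + ρ₂ - r₁ - r₂))
    (h0 : S ≠ 0) (h1 : S + 1 ≠ 0) (h2 : S + 2 ≠ 0) :
    upAEven (n + 1) ρ₁ ρ₂ r₁ r₂ =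
      (recBOdd n (ρ₁ + 1 / 2) (-r₂) (r₁ - 1 / 2) (-ρ₂) + 1 / 2) - upAOdd n ρ₁ ρ₂ r₁ r₂ +
      recBOdd n ρ₁ ρ₂ r₁ r₂ := by
  have e1 : n + 1 + (ρ₁ + ρ₂ - r₁ - r₂) + 1 = S + 2 := by linear_combination -hS
  have e2 : n + (ρ₁ + 1 / 2 + -r₂ - (r₁ - 1 / 2) - -ρ₂) + 1 = S + 2 := by linear_combination -hS
  have e3 : n + (ρ₁ + ρ₂ - r₁ - r₂) + 1 = S + 1 := by linear_combination -hS
  have e4 : n + 1 + (ρ₁ + ρ₂ - r₁ - r₂) = S + 1 := by linear_combination -hS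
  have e5 : n + (ρ₁ + 1 / 2 + -r₂ - (r₁ - 1 / 2) - -ρ₂) = S + 1 := by linear_combination -hS
  have e6 : n + (ρ₁ + ρ₂ - r₁ - r₂) = S := by linear_combination -hS
  unfold recBOdd recAOdd recCOdd upAEven upAOdd
  rw [e1, e2, e3, e4, e5, e6]
  obtain rfl : ρ₂ = S - n - ρ₁ + r₁ + r₂ := by rw [hS]; ring
  clear hS e1 e2 e3 e4 e5 e6
  field_simp
  ring

theorem up_coeffB_succ_odd (hS : S = n + (ρ₁ + ρ₂ - r₁ - r₂))
    (h0 : S ≠ 0) (h1 : S + 1 ≠ 0) :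
    upBEven (n + 1) ρ₁ ρ₂ r₁ r₂ =
      recUOdd n (ρ₁ + 1 / 2) (-r₂) (r₁ - 1 / 2) (-ρ₂) -
        upAOdd n ρ₁ ρ₂ r₁ r₂ * (recBEven (n - 1) (ρ₁ + 1 / 2) (-r₂) (r₁ - 1 / 2) (-ρ₂) + 1 / 2) -
        upBOdd n ρ₁ ρ₂ r₁ r₂ - recBOdd n ρ₁ ρ₂ r₁ r₂ * upAOdd n ρ₁ ρ₂ r₁ r₂ -
        recUOdd n ρ₁ ρ₂ r₁ r₂ := by
  have e1 : n - 1 + (ρ₁ + 1 / 2 + -r₂ - (r₁ - 1 / 2) - -ρ₂) + 1 = S + 1 := by linear_combination -hS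
  have e2 : n + (ρ₁ + ρ₂ - r₁ - r₂) + 1 = S + 1 := by linear_combination -hS
  have e3 : n - 1 + (ρ₁ + ρ₂ - r₁ - r₂) + 1 = S := by linear_combination -hS
  have e4 : n + 1 + (ρ₁ + ρ₂ - r₁ - r₂) = S + 1 := by linear_combination -hS
  have e5 : n + (ρ₁ + 1 / 2 + -r₂ - (r₁ - 1 / 2) - -ρ₂) = S + 1 := by linear_combination -hS
  have e6 : n + (ρ₁ + ρ₂ - r₁ - r₂) = S := by linear_combination -hS
  have e7 : n - 1 + (ρ₁ + 1 / 2 + -r₂ - (r₁ - 1 / 2) - -ρ₂) = S := by linear_combination -hS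
  unfold recUOdd recBEven recBOdd recAEven recAOdd recCEven recCOdd upAOdd upBEven upBOdd
  rw [e1, e2, e3, e4, e5, e6, e7]
  obtain rfl : ρ₂ = S - n - ρ₁ + r₁ + r₂ := by rw [hS]; ring
  clear hS e1 e2 e3 e4 e5 e6 e7
  field_simp
  ring

theorem up_upper_remainder_odd (hS : S = n + (ρ₁ + ρ₂ - r₁ - r₂))
    (h0 : S - 1 ≠ 0) (h1 : S ≠ 0) (h2 : S + 1 ≠ 0) :
    upAOdd n ρ₁ ρ₂ r₁ r₂ * recUEven (n - 1) (ρ₁ + 1 / 2) (-r₂) (r₁ - 1 / 2) (-ρ₂) +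
      upBOdd n ρ₁ ρ₂ r₁ r₂ * (recBOdd (n - 2) (ρ₁ + 1 / 2) (-r₂) (r₁ - 1 / 2) (-ρ₂) + 1 / 2) +
      recBOdd n ρ₁ ρ₂ r₁ r₂ * upBOdd n ρ₁ ρ₂ r₁ r₂ +
      recUOdd n ρ₁ ρ₂ r₁ r₂ * upAEven (n - 1) ρ₁ ρ₂ r₁ r₂ = 0 := by
  have e1 : n + (ρ₁ + ρ₂ - r₁ - r₂) + 1 = S + 1 := by linear_combination -hS
  have e2 : n - 1 - 1 + (ρ₁ + 1 / 2 + -r₂ - (r₁ - 1 / 2) - -ρ₂) + 1 = S := by linear_combination -hS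
  have e3 : n - 2 + (ρ₁ + 1 / 2 + -r₂ - (r₁ - 1 / 2) - -ρ₂) + 1 = S := by linear_combination -hS
  have e4 : n - 1 + (ρ₁ + ρ₂ - r₁ - r₂) + 1 = S := by linear_combination -hS
  have e5 : n + (ρ₁ + ρ₂ - r₁ - r₂) = S := by linear_combination -hS
  have e6 : n - 1 + (ρ₁ + 1 / 2 + -r₂ - (r₁ - 1 / 2) - -ρ₂) = S := by linear_combination -hS
  have e7 : n - 2 + (ρ₁ + 1 / 2 + -r₂ - (r₁ - 1 / 2) - -ρ₂) = S - 1 := by linear_combination -hS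
  have e8 : n - 1 + (ρ₁ + ρ₂ - r₁ - r₂) = S - 1 := by linear_combination -hS
  unfold recUEven recUOdd recBOdd recAEven recAOdd recCEven recCOdd upAEven upAOdd upBOdd
  rw [e1, e2, e3, e4, e5, e6, e7, e8]
  obtain rfl : ρ₂ = S - n - ρ₁ + r₁ + r₂ := by rw [hS]; ring
  clear hS e1 e2 e3 e4 e5 e6 e7 e8
  field_simp
  ring

theorem up_lower_remainder_odd (hS : S = n + (ρ₁ + ρ₂ - r₁ - r₂))
    (h0 : S - 1 ≠ 0) (h1 : S ≠ 0) :
    upBOdd n ρ₁ ρ₂ r₁ r₂ * recUOdd (n - 2) (ρ₁ + 1 / 2) (-r₂) (r₁ - 1 / 2) (-ρ₂) +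
      recUOdd n ρ₁ ρ₂ r₁ r₂ * upBEven (n - 1) ρ₁ ρ₂ r₁ r₂ = 0 := by
  have e1 : n - 2 - 1 + (ρ₁ + 1 / 2 + -r₂ - (r₁ - 1 / 2) - -ρ₂) + 1 = S - 1 :=
      by linear_combination -hS
  have e2 : n - 1 + (ρ₁ + ρ₂ - r₁ - r₂) + 1 = S := by linear_combination -hS
  have e3 : n + (ρ₁ + ρ₂ - r₁ - r₂) = S := by linear_combination -hS
  have e4 : n - 2 + (ρ₁ + 1 / 2 + -r₂ - (r₁ - 1 / 2) - -ρ₂) = S - 1 := by linear_combination -hS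
  have e5 : n - 1 + (ρ₁ + ρ₂ - r₁ - r₂) = S - 1 := by linear_combination -hS
  unfold recUOdd recAEven recCOdd upBEven upBOdd
  rw [e1, e2, e3, e4, e5]
  obtain rfl : ρ₂ = S - n - ρ₁ + r₁ + r₂ := by rw [hS]; ring
  clear hS e1 e2 e3 e4 e5
  field_simp
  ring

/-- The same scheme, except that the shifted polynomials start at degree n + 2, because of the
quadratic multiplier, and g falls by one; thus their denominators are again translates of the same
S. -/
theorem down_coeffA_succ_even (hS : S = n + (ρ₁ + ρ₂ - r₁ - r₂))
    (h0 : S ≠ 0) (h1 : S + 1 ≠ 0) (h2 : S + 2 ≠ 0) :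
    downAOdd (n + 1) ρ₁ ρ₂ r₁ r₂ =
      -(recBEven (n + 2) (ρ₁ - 1 / 2) (-r₂) (r₁ + 1 / 2) (-ρ₂) + 1 / 2) - downAEven n ρ₁ ρ₂ r₁ r₂ -
      recBEven n ρ₁ ρ₂ r₁ r₂ := by
  have e1 : n + 1 + (ρ₁ + ρ₂ - r₁ - r₂) + 1 = S + 2 := by linear_combination -hS
  have e2 : n + 2 + (ρ₁ - 1 / 2 + -r₂ - (r₁ + 1 / 2) - -ρ₂) + 1 = S + 2 := by linear_combination -hS
  have e3 : n + (ρ₁ + ρ₂ - r₁ - r₂) + 1 = S + 1 := by linear_combination -hS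
  have e4 : n + 1 + (ρ₁ + ρ₂ - r₁ - r₂) = S + 1 := by linear_combination -hS
  have e5 : n + 2 + (ρ₁ - 1 / 2 + -r₂ - (r₁ + 1 / 2) - -ρ₂) = S + 1 := by linear_combination -hS
  have e6 : n + (ρ₁ + ρ₂ - r₁ - r₂) = S := by linear_combination -hS
  unfold recBEven downAEven downAOdd recAEven recCEven
  rw [e1, e2, e3, e4, e5, e6]
  obtain rfl : ρ₂ = S - n - ρ₁ + r₁ + r₂ := by rw [hS]; ring
  clear hS e1 e2 e3 e4 e5 e6
  field_simp
  ring

theorem down_coeffB_succ_even (hS : S = n + (ρ₁ + ρ₂ - r₁ - r₂))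
    (h0 : S ≠ 0) (h1 : S + 1 ≠ 0) :
    downBOdd (n + 1) ρ₁ ρ₂ r₁ r₂ =
      -recUEven (n + 2) (ρ₁ - 1 / 2) (-r₂) (r₁ + 1 / 2) (-ρ₂) -
        downAEven n ρ₁ ρ₂ r₁ r₂ * (recBOdd (n + 1) (ρ₁ - 1 / 2) (-r₂) (r₁ + 1 / 2) (-ρ₂) + 1 / 2) -
        downBEven n ρ₁ ρ₂ r₁ r₂ - recBEven n ρ₁ ρ₂ r₁ r₂ * downAEven n ρ₁ ρ₂ r₁ r₂ +
        recUEven n ρ₁ ρ₂ r₁ r₂ := by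
  have e1 : n + 2 - 1 + (ρ₁ - 1 / 2 + -r₂ - (r₁ + 1 / 2) - -ρ₂) + 1 = S + 1 :=
      by linear_combination -hS
  have e2 : n + (ρ₁ + ρ₂ - r₁ - r₂) + 1 = S + 1 := by linear_combination -hS
  have e3 : n + 1 + (ρ₁ - 1 / 2 + -r₂ - (r₁ + 1 / 2) - -ρ₂) + 1 = S + 1 := by linear_combination -hS
  have e4 : n - 1 + (ρ₁ + ρ₂ - r₁ - r₂) + 1 = S := by linear_combination -hS
  have e5 : n + 1 + (ρ₁ + ρ₂ - r₁ - r₂) = S + 1 := by linear_combination -hS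
  have e6 : n + 2 + (ρ₁ - 1 / 2 + -r₂ - (r₁ + 1 / 2) - -ρ₂) = S + 1 := by linear_combination -hS
  have e7 : n + (ρ₁ + ρ₂ - r₁ - r₂) = S := by linear_combination -hS
  have e8 : n + 1 + (ρ₁ - 1 / 2 + -r₂ - (r₁ + 1 / 2) - -ρ₂) = S := by linear_combination -hS
  unfold recUEven recBEven recBOdd downAEven downBEven downBOdd recAEven recAOdd recCEven recCOdd
  rw [e1, e2, e3, e4, e5, e6, e7, e8]
  obtain rfl : ρ₂ = S - n - ρ₁ + r₁ + r₂ := by rw [hS]; ring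
  clear hS e1 e2 e3 e4 e5 e6 e7 e8
  field_simp
  ring

theorem down_upper_remainder_even (hS : S = n + (ρ₁ + ρ₂ - r₁ - r₂))
    (h0 : S - 1 ≠ 0) (h1 : S ≠ 0) (h2 : S + 1 ≠ 0) :
    downAEven n ρ₁ ρ₂ r₁ r₂ * recUOdd (n + 1) (ρ₁ - 1 / 2) (-r₂) (r₁ + 1 / 2) (-ρ₂) +
      downBEven n ρ₁ ρ₂ r₁ r₂ * (recBEven n (ρ₁ - 1 / 2) (-r₂) (r₁ + 1 / 2) (-ρ₂) + 1 / 2) +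
      recBEven n ρ₁ ρ₂ r₁ r₂ * downBEven n ρ₁ ρ₂ r₁ r₂ +
      recUEven n ρ₁ ρ₂ r₁ r₂ * downAOdd (n - 1) ρ₁ ρ₂ r₁ r₂ = 0 := by
  have e1 : n + (ρ₁ + ρ₂ - r₁ - r₂) + 1 = S + 1 := by linear_combination -hS
  have e2 : n + 1 - 1 + (ρ₁ - 1 / 2 + -r₂ - (r₁ + 1 / 2) - -ρ₂) + 1 = S := by linear_combination -hS
  have e3 : n + (ρ₁ - 1 / 2 + -r₂ - (r₁ + 1 / 2) - -ρ₂) + 1 = S := by linear_combination -hS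
  have e4 : n - 1 + (ρ₁ + ρ₂ - r₁ - r₂) + 1 = S := by linear_combination -hS
  have e5 : n + (ρ₁ + ρ₂ - r₁ - r₂) = S := by linear_combination -hS
  have e6 : n + 1 + (ρ₁ - 1 / 2 + -r₂ - (r₁ + 1 / 2) - -ρ₂) = S := by linear_combination -hS
  have e7 : n + (ρ₁ - 1 / 2 + -r₂ - (r₁ + 1 / 2) - -ρ₂) = S - 1 := by linear_combination -hS
  have e8 : n - 1 + (ρ₁ + ρ₂ - r₁ - r₂) = S - 1 := by linear_combination -hS
  unfold recUEven recUOdd recBEven downAEven downAOdd downBEven recAEven recAOdd recCEven recCOdd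
  rw [e1, e2, e3, e4, e5, e6, e7, e8]
  obtain rfl : ρ₂ = S - n - ρ₁ + r₁ + r₂ := by rw [hS]; ring
  clear hS e1 e2 e3 e4 e5 e6 e7 e8
  field_simp
  ring

theorem down_lower_remainder_even (hS : S = n + (ρ₁ + ρ₂ - r₁ - r₂))
    (h0 : S - 1 ≠ 0) (h1 : S ≠ 0) :
    downBEven n ρ₁ ρ₂ r₁ r₂ * recUEven n (ρ₁ - 1 / 2) (-r₂) (r₁ + 1 / 2) (-ρ₂) +
      recUEven n ρ₁ ρ₂ r₁ r₂ * downBOdd (n - 1) ρ₁ ρ₂ r₁ r₂ = 0 := by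
  have e1 : n - 1 + (ρ₁ - 1 / 2 + -r₂ - (r₁ + 1 / 2) - -ρ₂) + 1 = S - 1 := by linear_combination -hS
  have e2 : n - 1 + (ρ₁ + ρ₂ - r₁ - r₂) + 1 = S := by linear_combination -hS
  have e3 : n + (ρ₁ + ρ₂ - r₁ - r₂) = S := by linear_combination -hS
  have e4 : n + (ρ₁ - 1 / 2 + -r₂ - (r₁ + 1 / 2) - -ρ₂) = S - 1 := by linear_combination -hS
  have e5 : n - 1 + (ρ₁ + ρ₂ - r₁ - r₂) = S - 1 := by linear_combination -hS
  unfold recUEven downBEven downBOdd recAOdd recCEven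
  rw [e1, e2, e3, e4, e5]
  obtain rfl : ρ₂ = S - n - ρ₁ + r₁ + r₂ := by rw [hS]; ring
  clear hS e1 e2 e3 e4 e5
  field_simp
  ring

theorem down_coeffA_succ_odd (hS : S = n + (ρ₁ + ρ₂ - r₁ - r₂))
    (h0 : S ≠ 0) (h1 : S + 1 ≠ 0) (h2 : S + 2 ≠ 0) :
    downAEven (n + 1) ρ₁ ρ₂ r₁ r₂ =
      (recBOdd (n + 2) (ρ₁ - 1 / 2) (-r₂) (r₁ + 1 / 2) (-ρ₂) + 1 / 2) - downAOdd n ρ₁ ρ₂ r₁ r₂ +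
      recBOdd n ρ₁ ρ₂ r₁ r₂ := by
  have e1 : n + 1 + (ρ₁ + ρ₂ - r₁ - r₂) + 1 = S + 2 := by linear_combination -hS
  have e2 : n + 2 + (ρ₁ - 1 / 2 + -r₂ - (r₁ + 1 / 2) - -ρ₂) + 1 = S + 2 := by linear_combination -hS
  have e3 : n + (ρ₁ + ρ₂ - r₁ - r₂) + 1 = S + 1 := by linear_combination -hS
  have e4 : n + 1 + (ρ₁ + ρ₂ - r₁ - r₂) = S + 1 := by linear_combination -hS
  have e5 : n + 2 + (ρ₁ - 1 / 2 + -r₂ - (r₁ + 1 / 2) - -ρ₂) = S + 1 := by linear_combination -hS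
  have e6 : n + (ρ₁ + ρ₂ - r₁ - r₂) = S := by linear_combination -hS
  unfold recBOdd downAEven downAOdd recAOdd recCOdd
  rw [e1, e2, e3, e4, e5, e6]
  obtain rfl : ρ₂ = S - n - ρ₁ + r₁ + r₂ := by rw [hS]; ring
  clear hS e1 e2 e3 e4 e5 e6
  field_simp
  ring

theorem down_coeffB_succ_odd (hS : S = n + (ρ₁ + ρ₂ - r₁ - r₂))
    (h0 : S ≠ 0) (h1 : S + 1 ≠ 0) :
    downBEven (n + 1) ρ₁ ρ₂ r₁ r₂ =
      recUOdd (n + 2) (ρ₁ - 1 / 2) (-r₂) (r₁ + 1 / 2) (-ρ₂) -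
        downAOdd n ρ₁ ρ₂ r₁ r₂ * (recBEven (n + 1) (ρ₁ - 1 / 2) (-r₂) (r₁ + 1 / 2) (-ρ₂) + 1 / 2) -
        downBOdd n ρ₁ ρ₂ r₁ r₂ - recBOdd n ρ₁ ρ₂ r₁ r₂ * downAOdd n ρ₁ ρ₂ r₁ r₂ -
        recUOdd n ρ₁ ρ₂ r₁ r₂ := by
  have e1 : n + 2 - 1 + (ρ₁ - 1 / 2 + -r₂ - (r₁ + 1 / 2) - -ρ₂) + 1 = S + 1 :=
      by linear_combination -hS
  have e2 : n + (ρ₁ + ρ₂ - r₁ - r₂) + 1 = S + 1 := by linear_combination -hS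
  have e3 : n + 1 + (ρ₁ - 1 / 2 + -r₂ - (r₁ + 1 / 2) - -ρ₂) + 1 = S + 1 := by linear_combination -hS
  have e4 : n - 1 + (ρ₁ + ρ₂ - r₁ - r₂) + 1 = S := by linear_combination -hS
  have e5 : n + 1 + (ρ₁ + ρ₂ - r₁ - r₂) = S + 1 := by linear_combination -hS
  have e6 : n + 2 + (ρ₁ - 1 / 2 + -r₂ - (r₁ + 1 / 2) - -ρ₂) = S + 1 := by linear_combination -hS
  have e7 : n + (ρ₁ + ρ₂ - r₁ - r₂) = S := by linear_combination -hS
  have e8 : n + 1 + (ρ₁ - 1 / 2 + -r₂ - (r₁ + 1 / 2) - -ρ₂) = S := by linear_combination -hS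
  unfold recUOdd recBEven recBOdd downAOdd downBEven downBOdd recAEven recAOdd recCEven recCOdd
  rw [e1, e2, e3, e4, e5, e6, e7, e8]
  obtain rfl : ρ₂ = S - n - ρ₁ + r₁ + r₂ := by rw [hS]; ring
  clear hS e1 e2 e3 e4 e5 e6 e7 e8
  field_simp
  ring

theorem down_upper_remainder_odd (hS : S = n + (ρ₁ + ρ₂ - r₁ - r₂))
    (h0 : S - 1 ≠ 0) (h1 : S ≠ 0) (h2 : S + 1 ≠ 0) :
    downAOdd n ρ₁ ρ₂ r₁ r₂ * recUEven (n + 1) (ρ₁ - 1 / 2) (-r₂) (r₁ + 1 / 2) (-ρ₂) +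
      downBOdd n ρ₁ ρ₂ r₁ r₂ * (recBOdd n (ρ₁ - 1 / 2) (-r₂) (r₁ + 1 / 2) (-ρ₂) + 1 / 2) +
      recBOdd n ρ₁ ρ₂ r₁ r₂ * downBOdd n ρ₁ ρ₂ r₁ r₂ +
      recUOdd n ρ₁ ρ₂ r₁ r₂ * downAEven (n - 1) ρ₁ ρ₂ r₁ r₂ = 0 := by
  have e1 : n + (ρ₁ + ρ₂ - r₁ - r₂) + 1 = S + 1 := by linear_combination -hS
  have e2 : n + 1 - 1 + (ρ₁ - 1 / 2 + -r₂ - (r₁ + 1 / 2) - -ρ₂) + 1 = S := by linear_combination -hS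
  have e3 : n + (ρ₁ - 1 / 2 + -r₂ - (r₁ + 1 / 2) - -ρ₂) + 1 = S := by linear_combination -hS
  have e4 : n - 1 + (ρ₁ + ρ₂ - r₁ - r₂) + 1 = S := by linear_combination -hS
  have e5 : n + (ρ₁ + ρ₂ - r₁ - r₂) = S := by linear_combination -hS
  have e6 : n + 1 + (ρ₁ - 1 / 2 + -r₂ - (r₁ + 1 / 2) - -ρ₂) = S := by linear_combination -hS
  have e7 : n + (ρ₁ - 1 / 2 + -r₂ - (r₁ + 1 / 2) - -ρ₂) = S - 1 := by linear_combination -hS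
  have e8 : n - 1 + (ρ₁ + ρ₂ - r₁ - r₂) = S - 1 := by linear_combination -hS
  unfold recUEven recUOdd recBOdd downAEven downAOdd downBOdd recAEven recAOdd recCEven recCOdd
  rw [e1, e2, e3, e4, e5, e6, e7, e8]
  obtain rfl : ρ₂ = S - n - ρ₁ + r₁ + r₂ := by rw [hS]; ring
  clear hS e1 e2 e3 e4 e5 e6 e7 e8
  field_simp
  ring

theorem down_lower_remainder_odd (hS : S = n + (ρ₁ + ρ₂ - r₁ - r₂))
    (h0 : S - 1 ≠ 0) (h1 : S ≠ 0) :
    downBOdd n ρ₁ ρ₂ r₁ r₂ * recUOdd n (ρ₁ - 1 / 2) (-r₂) (r₁ + 1 / 2) (-ρ₂) +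
      recUOdd n ρ₁ ρ₂ r₁ r₂ * downBEven (n - 1) ρ₁ ρ₂ r₁ r₂ = 0 := by
  have e1 : n - 1 + (ρ₁ - 1 / 2 + -r₂ - (r₁ + 1 / 2) - -ρ₂) + 1 = S - 1 := by linear_combination -hS
  have e2 : n - 1 + (ρ₁ + ρ₂ - r₁ - r₂) + 1 = S := by linear_combination -hS
  have e3 : n + (ρ₁ + ρ₂ - r₁ - r₂) = S := by linear_combination -hS
  have e4 : n + (ρ₁ - 1 / 2 + -r₂ - (r₁ + 1 / 2) - -ρ₂) = S - 1 := by linear_combination -hS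
  have e5 : n - 1 + (ρ₁ + ρ₂ - r₁ - r₂) = S - 1 := by linear_combination -hS
  unfold recUOdd downBEven downBOdd recAEven recCOdd
  rw [e1, e2, e3, e4, e5]
  obtain rfl : ρ₂ = S - n - ρ₁ + r₁ + r₂ := by rw [hS]; ring
  clear hS e1 e2 e3 e4 e5
  field_simp
  ring

end Identities

/-! The coefficients above, for natural degrees of either parity. -/

def recB (n : ℕ) (ρ₁ ρ₂ r₁ r₂ : ℂ) : ℂ :=
  if Even n then recBEven n ρ₁ ρ₂ r₁ r₂ else recBOdd n ρ₁ ρ₂ r₁ r₂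

def recU (n : ℕ) (ρ₁ ρ₂ r₁ r₂ : ℂ) : ℂ :=
  if Even n then recUEven n ρ₁ ρ₂ r₁ r₂ else recUOdd n ρ₁ ρ₂ r₁ r₂

def upA (n : ℕ) (ρ₁ ρ₂ r₁ r₂ : ℂ) : ℂ :=
  if Even n then upAEven n ρ₁ ρ₂ r₁ r₂ else upAOdd n ρ₁ ρ₂ r₁ r₂

def upB (n : ℕ) (ρ₁ ρ₂ r₁ r₂ : ℂ) : ℂ :=
  if Even n then upBEven n ρ₁ ρ₂ r₁ r₂ else upBOdd n ρ₁ ρ₂ r₁ r₂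

def downA (n : ℕ) (ρ₁ ρ₂ r₁ r₂ : ℂ) : ℂ :=
  if Even n then downAEven n ρ₁ ρ₂ r₁ r₂ else downAOdd n ρ₁ ρ₂ r₁ r₂

def downB (n : ℕ) (ρ₁ ρ₂ r₁ r₂ : ℂ) : ℂ :=
  if Even n then downBEven n ρ₁ ρ₂ r₁ r₂ else downBOdd n ρ₁ ρ₂ r₁ r₂

/-! ### The recurrence for all degrees and the inductive step of the connection formulas. -/

section Recurrence

variable {ρ₁ ρ₂ r₁ r₂ : ℂ}

theorem recU_zero : recU 0 ρ₁ ρ₂ r₁ r₂ = 0 := by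
  simp [recU, recUEven, recCEven]

/-- The three-term recurrence relation of the Bannai-Ito polynomials. -/
theorem biPoly_recurrence (hg : ∀ k : ℕ, ρ₁ + ρ₂ - r₁ - r₂ + 1 + k ≠ 0) (x : ℂ) (n : ℕ) :
    x * biPoly n x ρ₁ ρ₂ r₁ r₂ =
      biPoly (n + 1) x ρ₁ ρ₂ r₁ r₂ + recB n ρ₁ ρ₂ r₁ r₂ * biPoly n x ρ₁ ρ₂ r₁ r₂ +
        recU n ρ₁ ρ₂ r₁ r₂ * biPoly (n - 1) x ρ₁ ρ₂ r₁ r₂ := by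
  rcases Nat.even_or_odd' n with ⟨m, rfl | rfl⟩
  · rcases m with - | m
    · rw [mul_zero, biPoly_zero, biPoly_one (by simpa using hg 0), recU_zero]
      simp only [recB, recBEven, recCEven, Even.zero, if_true]
      push_cast
      ring
    · have h := biPoly_recurrence_even hg x m
      have e : 2 * (m : ℂ) + 2 - 1 = 2 * m + 1 := by ring
      have e' : ((2 * (m + 1) : ℕ) : ℂ) = 2 * m + 2 := by push_cast; ring
      simp only [recB, recU, even_two_mul, if_true, recBEven, recUEven, e', e]
      exact h
  · have h := biPoly_recurrence_odd hg x m
    have ho : ¬ Even (2 * m + 1) := by simp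
    simp only [recB, recU, ho, if_false, recBOdd, recUOdd]
    push_cast
    rw [add_sub_cancel_right]
    exact h

/-- With x = -y - 1/2, where y is the variable of the Y's, insert the expansions of X₀ and X₁ into X
= (x - b) X₀ - u X₁ and reduce each y Yᵢ by its own recurrence. The coefficients of Y, Y₀, Y₁ give
-s, P, Q; `i₃` and `i₄` say that those of Y₂ and Y₃ vanish. Some hypotheses carry the factor u, p or
q, so that nothing has to be known about a term whose coefficient is zero. -/
theorem connection_step {x s b u p q p' q' P Q b₀ b₁ b₂ u₀ u₁ u₂ X X₀ X₁ Y Y₀ Y₁ Y₂ Y₃ : ℂ}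
    (hX : x * X₀ = X + b * X₀ + u * X₁)
    (h₀ : X₀ = s * Y₀ + p * Y₁ + q * Y₂) (h₁ : u * X₁ = u * (-s * Y₁ + p' * Y₂ + q' * Y₃))
    (y₀ : (-x - 1 / 2) * Y₀ = Y + b₀ * Y₀ + u₀ * Y₁)
    (y₁ : p * ((-x - 1 / 2) * Y₁) = p * (Y₀ + b₁ * Y₁ + u₁ * Y₂))
    (y₂ : q * ((-x - 1 / 2) * Y₂) = q * (Y₁ + b₂ * Y₂ + u₂ * Y₃))
    (i₁ : P = -s * (b₀ + 1 / 2) - p - s * b)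
    (i₂ : Q = -s * u₀ - p * (b₁ + 1 / 2) - q - b * p + s * u)
    (i₃ : p * u₁ + q * (b₂ + 1 / 2) + b * q + u * p' = 0) (i₄ : q * u₂ + u * q' = 0) :
    X = -s * Y + P * Y₀ + Q * Y₁ := by
  linear_combination -hX + (x - b) * h₀ - h₁ - s * y₀ - y₁ - y₂ - Y₀ * i₁ - Y₁ * i₂ -
    Y₂ * i₃ - Y₃ * i₄

end Recurrence

/-! ### The connection formula that raises g by one. -/

section Identities

variable {ρ₁ ρ₂ r₁ r₂ : ℂ}

theorem even_add_two_iff {n : ℕ} : Even (n + 2) ↔ Even n := by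
  simp [Nat.even_add]

theorem up_coeffA_succ (hg : ∀ k : ℕ, ρ₁ + ρ₂ - r₁ - r₂ + 1 + k ≠ 0) (n : ℕ) :
    upA (n + 2) ρ₁ ρ₂ r₁ r₂ =
      -(-1) ^ (n + 1) * (recB (n + 1) (ρ₁ + 1 / 2) (-r₂) (r₁ - 1 / 2) (-ρ₂) + 1 / 2) -
        upA (n + 1) ρ₁ ρ₂ r₁ r₂ - (-1) ^ (n + 1) * recB (n + 1) ρ₁ ρ₂ r₁ r₂ := by
  have h0 : (n : ℂ) + 1 + (ρ₁ + ρ₂ - r₁ - r₂) ≠ 0 := fun h => hg n (by linear_combination h)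
  have h1 : (n : ℂ) + 1 + (ρ₁ + ρ₂ - r₁ - r₂) + 1 ≠ 0 := fun h => hg (n + 1) (by
    push_cast
    linear_combination h)
  have h2 : (n : ℂ) + 1 + (ρ₁ + ρ₂ - r₁ - r₂) + 2 ≠ 0 := fun h => hg (n + 2) (by
    push_cast
    linear_combination h)
  have e : ((n + 2 : ℕ) : ℂ) = n + 1 + 1 := by push_cast; ring
  rcases Nat.even_or_odd n with hn | hn
  · have ho : ¬ Even (n + 1) := by simpa [Nat.even_add_one] using hn
    simp only [upA, recB, even_add_two_iff, hn, ho, if_true, if_false, e,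
      (Nat.not_even_iff_odd.1 ho).neg_one_pow]
    push_cast
    rw [up_coeffA_succ_odd rfl h0 h1 h2]
    ring
  · have ho : Even (n + 1) := hn.add_one
    have hn' : ¬ Even n := Nat.not_even_iff_odd.2 hn
    simp only [upA, recB, even_add_two_iff, hn', ho, if_true, if_false, e, ho.neg_one_pow]
    push_cast
    rw [up_coeffA_succ_even rfl h0 h1 h2]
    ring

theorem up_coeffB_succ (hg : ∀ k : ℕ, ρ₁ + ρ₂ - r₁ - r₂ + 1 + k ≠ 0) (n : ℕ) :
    upB (n + 2) ρ₁ ρ₂ r₁ r₂ =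
      -(-1) ^ (n + 1) * recU (n + 1) (ρ₁ + 1 / 2) (-r₂) (r₁ - 1 / 2) (-ρ₂) -
        upA (n + 1) ρ₁ ρ₂ r₁ r₂ *
          (recB n (ρ₁ + 1 / 2) (-r₂) (r₁ - 1 / 2) (-ρ₂) + 1 / 2) -
        upB (n + 1) ρ₁ ρ₂ r₁ r₂ - recB (n + 1) ρ₁ ρ₂ r₁ r₂ * upA (n + 1) ρ₁ ρ₂ r₁ r₂ +
        (-1) ^ (n + 1) * recU (n + 1) ρ₁ ρ₂ r₁ r₂ := by
  have h0 : (n : ℂ) + 1 + (ρ₁ + ρ₂ - r₁ - r₂) ≠ 0 := fun h => hg n (by linear_combination h)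
  have h1 : (n : ℂ) + 1 + (ρ₁ + ρ₂ - r₁ - r₂) + 1 ≠ 0 := fun h => hg (n + 1) (by
    push_cast
    linear_combination h)
  have e : ((n + 2 : ℕ) : ℂ) = n + 1 + 1 := by push_cast; ring
  rcases Nat.even_or_odd n with hn | hn
  · have ho : ¬ Even (n + 1) := by simpa [Nat.even_add_one] using hn
    simp only [upA, upB, recB, recU, even_add_two_iff, hn, ho, if_true, if_false, e,
      (Nat.not_even_iff_odd.1 ho).neg_one_pow]
    push_cast
    rw [up_coeffB_succ_odd rfl h0 h1, add_sub_cancel_right]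
    ring
  · have ho : Even (n + 1) := hn.add_one
    have hn' : ¬ Even n := Nat.not_even_iff_odd.2 hn
    simp only [upA, upB, recB, recU, even_add_two_iff, hn', ho, if_true, if_false, e,
      ho.neg_one_pow]
    push_cast
    rw [up_coeffB_succ_even rfl h0 h1, add_sub_cancel_right]
    ring

/-- Stated from degree 2 on: the underlying identity divides by n + g - 1, which the hypothesis
controls only there. -/
theorem up_upper_remainder (hg : ∀ k : ℕ, ρ₁ + ρ₂ - r₁ - r₂ + 1 + k ≠ 0) (n : ℕ) :
    upA (n + 2) ρ₁ ρ₂ r₁ r₂ * recU (n + 1) (ρ₁ + 1 / 2) (-r₂) (r₁ - 1 / 2) (-ρ₂) +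
      upB (n + 2) ρ₁ ρ₂ r₁ r₂ * (recB n (ρ₁ + 1 / 2) (-r₂) (r₁ - 1 / 2) (-ρ₂) + 1 / 2) +
      recB (n + 2) ρ₁ ρ₂ r₁ r₂ * upB (n + 2) ρ₁ ρ₂ r₁ r₂ +
      recU (n + 2) ρ₁ ρ₂ r₁ r₂ * upA (n + 1) ρ₁ ρ₂ r₁ r₂ = 0 := by
  have h0 : (n : ℂ) + 2 + (ρ₁ + ρ₂ - r₁ - r₂) - 1 ≠ 0 := fun h => hg n (by linear_combination h)
  have h1 : (n : ℂ) + 2 + (ρ₁ + ρ₂ - r₁ - r₂) ≠ 0 := fun h => hg (n + 1) (by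
    push_cast
    linear_combination h)
  have h2 : (n : ℂ) + 2 + (ρ₁ + ρ₂ - r₁ - r₂) + 1 ≠ 0 := fun h => hg (n + 2) (by
    push_cast
    linear_combination h)
  have e1 : (n : ℂ) + 2 - 1 = n + 1 := by ring
  have e2 : (n : ℂ) + 2 - 2 = n := by ring
  rcases Nat.even_or_odd n with hn | hn
  · have ho : ¬ Even (n + 1) := by simpa [Nat.even_add_one] using hn
    have := up_upper_remainder_even rfl h0 h1 h2
    rw [e1, e2] at this
    simp only [upA, upB, recB, recU, even_add_two_iff, hn, ho, if_true, if_false]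
    push_cast
    exact this
  · have ho : Even (n + 1) := hn.add_one
    have hn' : ¬ Even n := Nat.not_even_iff_odd.2 hn
    have := up_upper_remainder_odd rfl h0 h1 h2
    rw [e1, e2] at this
    simp only [upA, upB, recB, recU, even_add_two_iff, hn', ho, if_true, if_false]
    push_cast
    exact this

theorem up_lower_remainder (hg : ∀ k : ℕ, ρ₁ + ρ₂ - r₁ - r₂ + 1 + k ≠ 0) (n : ℕ) :
    upB (n + 2) ρ₁ ρ₂ r₁ r₂ * recU n (ρ₁ + 1 / 2) (-r₂) (r₁ - 1 / 2) (-ρ₂) +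
      recU (n + 2) ρ₁ ρ₂ r₁ r₂ * upB (n + 1) ρ₁ ρ₂ r₁ r₂ = 0 := by
  have h0 : (n : ℂ) + 2 + (ρ₁ + ρ₂ - r₁ - r₂) - 1 ≠ 0 := fun h => hg n (by linear_combination h)
  have h1 : (n : ℂ) + 2 + (ρ₁ + ρ₂ - r₁ - r₂) ≠ 0 := fun h => hg (n + 1) (by
    push_cast
    linear_combination h)
  have e1 : (n : ℂ) + 2 - 1 = n + 1 := by ring
  have e2 : (n : ℂ) + 2 - 2 = n := by ring
  rcases Nat.even_or_odd n with hn | hn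
  · have ho : ¬ Even (n + 1) := by simpa [Nat.even_add_one] using hn
    have := up_lower_remainder_even rfl h0 h1
    rw [e1, e2] at this
    simp only [upB, recU, even_add_two_iff, hn, ho, if_true, if_false]
    push_cast
    exact this
  · have ho : Even (n + 1) := hn.add_one
    have hn' : ¬ Even n := Nat.not_even_iff_odd.2 hn
    have := up_lower_remainder_odd rfl h0 h1
    rw [e1, e2] at this
    simp only [upB, recU, even_add_two_iff, hn', ho, if_true, if_false]
    push_cast
    exact this

theorem upA_zero : upA 0 ρ₁ ρ₂ r₁ r₂ = 0 := by simp [upA, upAEven]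

theorem upB_zero : upB 0 ρ₁ ρ₂ r₁ r₂ = 0 := by simp [upB, upBEven]

theorem upB_one : upB 1 ρ₁ ρ₂ r₁ r₂ = 0 := by simp [upB, upBOdd]

theorem upA_one (hg : ∀ k : ℕ, ρ₁ + ρ₂ - r₁ - r₂ + 1 + k ≠ 0) :
    upA 1 ρ₁ ρ₂ r₁ r₂ = -(1 / 2) - recB 0 (ρ₁ + 1 / 2) (-r₂) (r₁ - 1 / 2) (-ρ₂) -
      recB 0 ρ₁ ρ₂ r₁ r₂ := by
  have e : ρ₁ + 1 / 2 + -r₂ - (r₁ - 1 / 2) - -ρ₂ + 1 = ρ₁ + ρ₂ - r₁ - r₂ + 2 := by ring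
  have e' : ρ₁ + ρ₂ - r₁ - r₂ + 1 + 1 = ρ₁ + ρ₂ - r₁ - r₂ + 2 := by ring
  have e'' : 1 + (ρ₁ + ρ₂ - r₁ - r₂) = ρ₁ + ρ₂ - r₁ - r₂ + 1 := by ring
  have h1 : ρ₁ + ρ₂ - r₁ - r₂ + 1 ≠ 0 := by simpa using hg 0
  have h2 : ρ₁ + ρ₂ - r₁ - r₂ + 2 ≠ 0 := fun h => hg 1 (by push_cast; linear_combination h)
  simp only [upA, upAOdd, recB, recBEven, recAEven, recCEven, Nat.not_even_one, Even.zero, if_true,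
    if_false, Nat.cast_one, Nat.cast_zero, zero_add, zero_mul, zero_div, neg_zero, sub_zero, e, e'',
    e']
  clear e e' e''
  obtain ⟨g, hG⟩ : ∃ g, ρ₁ + ρ₂ - r₁ - r₂ = g := ⟨_, rfl⟩
  rw [hG] at h1 h2 ⊢
  obtain rfl : ρ₂ = g - ρ₁ + r₁ + r₂ := by rw [← hG]; ring
  field_simp
  ring

/-- The Bannai-Ito polynomials in terms of those with shifted parameters. -/
theorem biPoly_eq_up (hg : ∀ k : ℕ, ρ₁ + ρ₂ - r₁ - r₂ + 1 + k ≠ 0) (x : ℂ) (n : ℕ) :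
    biPoly n x ρ₁ ρ₂ r₁ r₂ =
      (-1) ^ n * biPoly n (-x - 1 / 2) (ρ₁ + 1 / 2) (-r₂) (r₁ - 1 / 2) (-ρ₂) +
      upA n ρ₁ ρ₂ r₁ r₂ * biPoly (n - 1) (-x - 1 / 2) (ρ₁ + 1 / 2) (-r₂) (r₁ - 1 / 2) (-ρ₂) +
      upB n ρ₁ ρ₂ r₁ r₂ *
        biPoly (n - 2) (-x - 1 / 2) (ρ₁ + 1 / 2) (-r₂) (r₁ - 1 / 2) (-ρ₂) := by
  have hg' : ∀ k : ℕ, ρ₁ + 1 / 2 + -r₂ - (r₁ - 1 / 2) - -ρ₂ + 1 + k ≠ 0 := fun k h =>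
    hg (k + 1) (by push_cast; linear_combination h)
  have hX := biPoly_recurrence hg x
  have hY := biPoly_recurrence hg' (-x - 1 / 2)
  induction n using Nat.twoStepInduction with
  | zero => simp [biPoly_zero, upA_zero, upB_zero]
  | one =>
    have h := hX 0
    have h' := hY 0
    rw [biPoly_zero, recU_zero, zero_add] at h h'
    rw [upB_one, upA_one hg, pow_one, Nat.sub_self, biPoly_zero]
    linear_combination -h - h'
  | more n ih₀ ih₁ =>
    rw [show (-1 : ℂ) ^ (n + 2) = -(-1) ^ (n + 1) by ring]
    set Y : ℕ → ℂ := fun k => biPoly k (-x - 1 / 2) (ρ₁ + 1 / 2) (-r₂) (r₁ - 1 / 2) (-ρ₂)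
    rcases n with - | n
    -- At the passage from degree 1 to degree 2, `upB_one` and `recU_zero` kill everything below Y
    -- 0, so the lower slots are filled with 0.
    · refine connection_step (Y₀ := Y 1) (Y₁ := Y 0) (Y₂ := 0) (Y₃ := 0) (b₂ := 0) (u₂ := 0)
        (p' := 0) (q' := 0) (u₁ := 0) (hX 1) ?_ ?_ (hY 1) ?_ ?_ (up_coeffA_succ hg 0)
        (up_coeffB_succ hg 0)
        ?_ ?_
      · simp only [zero_add, upB_one, zero_mul] at ih₁ ⊢
        exact ih₁
      · simp [Y, biPoly_zero]
      · have := hY 0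
        rw [recU_zero] at this
        rw [zero_add, mul_zero, add_zero]
        linear_combination upA 1 ρ₁ ρ₂ r₁ r₂ * this
      · simp [upB_one]
      · simp [upB_one]
      · simp [upB_one]
    · refine connection_step (Y₀ := Y (n + 2)) (Y₁ := Y (n + 1)) (Y₂ := Y n) (Y₃ := Y (n - 1))
        (hX (n + 2)) ih₁ ?_ (hY (n + 2)) (congrArg _ (hY (n + 1))) (congrArg _ (hY n))
        (up_coeffA_succ hg (n + 1)) (up_coeffB_succ hg (n + 1)) (up_upper_remainder hg n)
        (up_lower_remainder hg n)
      rw [show n + 2 - 1 = n + 1 from rfl, ih₀, pow_succ _ (n + 1), mul_neg_one, neg_neg]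
      rfl

end Identities

/-! ### The connection formula that lowers g by one. -/

section Identities

variable {ρ₁ ρ₂ r₁ r₂ : ℂ}

/-- The shifted family has g - 1 in place of g, which is why nonvanishing is now required from g
itself and not from g + 1. -/
theorem down_coeffA_succ (hg : ∀ k : ℕ, ρ₁ + ρ₂ - r₁ - r₂ + k ≠ 0) (n : ℕ) :
    downA (n + 1) ρ₁ ρ₂ r₁ r₂ =
      -(-1) ^ n * (recB (n + 2) (ρ₁ - 1 / 2) (-r₂) (r₁ + 1 / 2) (-ρ₂) + 1 / 2) -
        downA n ρ₁ ρ₂ r₁ r₂ - (-1) ^ n * recB n ρ₁ ρ₂ r₁ r₂ := by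
  have h0 : (n : ℂ) + (ρ₁ + ρ₂ - r₁ - r₂) ≠ 0 := fun h => hg n (by linear_combination h)
  have h1 : (n : ℂ) + (ρ₁ + ρ₂ - r₁ - r₂) + 1 ≠ 0 := fun h => hg (n + 1) (by
    push_cast
    linear_combination h)
  have h2 : (n : ℂ) + (ρ₁ + ρ₂ - r₁ - r₂) + 2 ≠ 0 := fun h => hg (n + 2) (by
    push_cast
    linear_combination h)
  rcases Nat.even_or_odd n with hn | hn
  · have ho : ¬ Even (n + 1) := by simpa [Nat.even_add_one] using hn
    simp only [downA, recB, even_add_two_iff, hn, ho, if_true, if_false, hn.neg_one_pow]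
    push_cast
    rw [down_coeffA_succ_even rfl h0 h1 h2]
    ring
  · have ho : Even (n + 1) := hn.add_one
    simp only [downA, recB, even_add_two_iff, Nat.not_even_iff_odd.2 hn, ho, if_true, if_false,
      hn.neg_one_pow]
    push_cast
    rw [down_coeffA_succ_odd rfl h0 h1 h2]
    ring

theorem down_coeffB_succ (hg : ∀ k : ℕ, ρ₁ + ρ₂ - r₁ - r₂ + k ≠ 0) (n : ℕ) :
    downB (n + 1) ρ₁ ρ₂ r₁ r₂ =
      -(-1) ^ n * recU (n + 2) (ρ₁ - 1 / 2) (-r₂) (r₁ + 1 / 2) (-ρ₂) -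
        downA n ρ₁ ρ₂ r₁ r₂ * (recB (n + 1) (ρ₁ - 1 / 2) (-r₂) (r₁ + 1 / 2) (-ρ₂) + 1 / 2) -
        downB n ρ₁ ρ₂ r₁ r₂ - recB n ρ₁ ρ₂ r₁ r₂ * downA n ρ₁ ρ₂ r₁ r₂ +
        (-1) ^ n * recU n ρ₁ ρ₂ r₁ r₂ := by
  have h0 : (n : ℂ) + (ρ₁ + ρ₂ - r₁ - r₂) ≠ 0 := fun h => hg n (by linear_combination h)
  have h1 : (n : ℂ) + (ρ₁ + ρ₂ - r₁ - r₂) + 1 ≠ 0 := fun h => hg (n + 1) (by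
    push_cast
    linear_combination h)
  rcases Nat.even_or_odd n with hn | hn
  · have ho : ¬ Even (n + 1) := by simpa [Nat.even_add_one] using hn
    simp only [downA, downB, recB, recU, even_add_two_iff, hn, ho, if_true, if_false,
      hn.neg_one_pow]
    push_cast
    rw [down_coeffB_succ_even rfl h0 h1]
    ring
  · have ho : Even (n + 1) := hn.add_one
    simp only [downA, downB, recB, recU, even_add_two_iff, Nat.not_even_iff_odd.2 hn, ho, if_true,
      if_false, hn.neg_one_pow]
    push_cast
    rw [down_coeffB_succ_odd rfl h0 h1]
    ring

theorem down_upper_remainder (hg : ∀ k : ℕ, ρ₁ + ρ₂ - r₁ - r₂ + k ≠ 0) (n : ℕ) :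
    downA (n + 1) ρ₁ ρ₂ r₁ r₂ * recU (n + 2) (ρ₁ - 1 / 2) (-r₂) (r₁ + 1 / 2) (-ρ₂) +
      downB (n + 1) ρ₁ ρ₂ r₁ r₂ * (recB (n + 1) (ρ₁ - 1 / 2) (-r₂) (r₁ + 1 / 2) (-ρ₂) + 1 / 2) +
      recB (n + 1) ρ₁ ρ₂ r₁ r₂ * downB (n + 1) ρ₁ ρ₂ r₁ r₂ +
      recU (n + 1) ρ₁ ρ₂ r₁ r₂ * downA n ρ₁ ρ₂ r₁ r₂ = 0 := by
  have h0 : (n : ℂ) + 1 + (ρ₁ + ρ₂ - r₁ - r₂) - 1 ≠ 0 := fun h => hg n (by linear_combination h)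
  have h1 : (n : ℂ) + 1 + (ρ₁ + ρ₂ - r₁ - r₂) ≠ 0 := fun h => hg (n + 1) (by
    push_cast
    linear_combination h)
  have h2 : (n : ℂ) + 1 + (ρ₁ + ρ₂ - r₁ - r₂) + 1 ≠ 0 := fun h => hg (n + 2) (by
    push_cast
    linear_combination h)
  have e : (n : ℂ) + 1 + 1 = n + 2 := by ring
  rcases Nat.even_or_odd n with hn | hn
  · have ho : ¬ Even (n + 1) := by simpa [Nat.even_add_one] using hn
    have := down_upper_remainder_odd rfl h0 h1 h2
    rw [add_sub_cancel_right, e] at this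
    simp only [downA, downB, recB, recU, even_add_two_iff, hn, ho, if_true, if_false]
    push_cast
    exact this
  · have ho : Even (n + 1) := hn.add_one
    have := down_upper_remainder_even rfl h0 h1 h2
    rw [add_sub_cancel_right, e] at this
    simp only [downA, downB, recB, recU, even_add_two_iff, Nat.not_even_iff_odd.2 hn, ho, if_true,
      if_false]
    push_cast
    exact this

theorem down_lower_remainder (hg : ∀ k : ℕ, ρ₁ + ρ₂ - r₁ - r₂ + k ≠ 0) (n : ℕ) :
    downB (n + 1) ρ₁ ρ₂ r₁ r₂ * recU (n + 1) (ρ₁ - 1 / 2) (-r₂) (r₁ + 1 / 2) (-ρ₂) +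
      recU (n + 1) ρ₁ ρ₂ r₁ r₂ * downB n ρ₁ ρ₂ r₁ r₂ = 0 := by
  have h0 : (n : ℂ) + 1 + (ρ₁ + ρ₂ - r₁ - r₂) - 1 ≠ 0 := fun h => hg n (by linear_combination h)
  have h1 : (n : ℂ) + 1 + (ρ₁ + ρ₂ - r₁ - r₂) ≠ 0 := fun h => hg (n + 1) (by
    push_cast
    linear_combination h)
  rcases Nat.even_or_odd n with hn | hn
  · have ho : ¬ Even (n + 1) := by simpa [Nat.even_add_one] using hn
    have := down_lower_remainder_odd rfl h0 h1
    rw [add_sub_cancel_right] at this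
    simp only [downB, recU, hn, ho, if_true, if_false]
    push_cast
    exact this
  · have ho : Even (n + 1) := hn.add_one
    have := down_lower_remainder_even rfl h0 h1
    rw [add_sub_cancel_right] at this
    simp only [downB, recU, Nat.not_even_iff_odd.2 hn, ho, if_true, if_false]
    push_cast
    exact this

/-- The general remainder identity at degree 0 would need g - 1 ≠ 0. Here the numerators containing
the factor 0 remove that denominator. -/
theorem down_upper_remainder_zero (hg : ∀ k : ℕ, ρ₁ + ρ₂ - r₁ - r₂ + k ≠ 0) :
    downA 0 ρ₁ ρ₂ r₁ r₂ * recU 1 (ρ₁ - 1 / 2) (-r₂) (r₁ + 1 / 2) (-ρ₂) +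
      downB 0 ρ₁ ρ₂ r₁ r₂ * (recB 0 (ρ₁ - 1 / 2) (-r₂) (r₁ + 1 / 2) (-ρ₂) + 1 / 2) +
      recB 0 ρ₁ ρ₂ r₁ r₂ * downB 0 ρ₁ ρ₂ r₁ r₂ = 0 := by
  obtain ⟨g, hG⟩ : ∃ g, ρ₁ + ρ₂ - r₁ - r₂ = g := ⟨_, rfl⟩
  have e : ρ₁ - 1 / 2 + -r₂ - (r₁ + 1 / 2) - -ρ₂ = g - 1 := by rw [← hG]; ring
  have e' : 1 + (g - 1) = g := by ring
  have h0 : g ≠ 0 := by simpa [hG] using hg 0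
  have h1 : g + 1 ≠ 0 := by simpa [hG] using hg 1
  simp only [downA, downB, recB, recU, downAEven, downBEven, recBEven, recUOdd, recAEven, recCEven,
    recCOdd, Nat.not_even_one, Even.zero, if_true, if_false, Nat.cast_one, Nat.cast_zero, zero_add,
    zero_mul, zero_div, neg_zero, sub_zero, add_zero, sub_self, e, hG, sub_add_cancel, e']
  obtain rfl : ρ₂ = g - ρ₁ + r₁ + r₂ := by rw [← hG]; ring
  clear hg hG e e'
  field_simp
  ring

/-- The start of the induction: the multiplier itself, expanded in the shifted polynomials of
degrees 2, 1, 0, which are written out through their recurrence. -/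
theorem down_initial (hg : ∀ k : ℕ, ρ₁ + ρ₂ - r₁ - r₂ + k ≠ 0) (x : ℂ) :
    (x + ρ₁) * (x + r₁ + 1 / 2) =
      (-x - 1 / 2 - recB 1 (ρ₁ - 1 / 2) (-r₂) (r₁ + 1 / 2) (-ρ₂)) *
          (-x - 1 / 2 - recB 0 (ρ₁ - 1 / 2) (-r₂) (r₁ + 1 / 2) (-ρ₂)) -
        recU 1 (ρ₁ - 1 / 2) (-r₂) (r₁ + 1 / 2) (-ρ₂) +
      downA 0 ρ₁ ρ₂ r₁ r₂ *
        (-x - 1 / 2 - recB 0 (ρ₁ - 1 / 2) (-r₂) (r₁ + 1 / 2) (-ρ₂)) +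
      downB 0 ρ₁ ρ₂ r₁ r₂ := by
  obtain ⟨g, hG⟩ : ∃ g, ρ₁ + ρ₂ - r₁ - r₂ = g := ⟨_, rfl⟩
  have e : ρ₁ - 1 / 2 + -r₂ - (r₁ + 1 / 2) - -ρ₂ = g - 1 := by rw [← hG]; ring
  have e' : 1 + (g - 1) = g := by ring
  have h0 : g ≠ 0 := by simpa [hG] using hg 0
  have h1 : g + 1 ≠ 0 := by simpa [hG] using hg 1
  simp only [downA, downB, recB, recU, downAEven, downBEven, recBEven, recBOdd, recUOdd, recAEven,
    recAOdd, recCEven, recCOdd, Nat.not_even_one, Even.zero, if_true, if_false, Nat.cast_one,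
    Nat.cast_zero, zero_add, zero_mul, zero_div, neg_zero, sub_zero, add_zero, sub_self, e, hG,
    sub_add_cancel, e']
  obtain rfl : ρ₂ = g - ρ₁ + r₁ + r₂ := by rw [← hG]; ring
  clear hg hG e e'
  field_simp
  ring

/-- A quadratic multiple of a Bannai-Ito polynomial in terms of those with shifted parameters. -/
theorem mul_biPoly_eq_down (hg : ∀ k : ℕ, ρ₁ + ρ₂ - r₁ - r₂ + k ≠ 0) (x : ℂ) (n : ℕ) :
    (x + ρ₁) * (x + r₁ + 1 / 2) * biPoly n x ρ₁ ρ₂ r₁ r₂ =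
      (-1) ^ n * biPoly (n + 2) (-x - 1 / 2) (ρ₁ - 1 / 2) (-r₂) (r₁ + 1 / 2) (-ρ₂) +
      downA n ρ₁ ρ₂ r₁ r₂ * biPoly (n + 1) (-x - 1 / 2) (ρ₁ - 1 / 2) (-r₂) (r₁ + 1 / 2) (-ρ₂) +
      downB n ρ₁ ρ₂ r₁ r₂ * biPoly n (-x - 1 / 2) (ρ₁ - 1 / 2) (-r₂) (r₁ + 1 / 2) (-ρ₂) := by
  have hg₁ : ∀ k : ℕ, ρ₁ + ρ₂ - r₁ - r₂ + 1 + k ≠ 0 := fun k h =>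
    hg (k + 1) (by push_cast; linear_combination h)
  have hg' : ∀ k : ℕ, ρ₁ - 1 / 2 + -r₂ - (r₁ + 1 / 2) - -ρ₂ + 1 + k ≠ 0 := fun k h =>
    hg k (by linear_combination h)
  have hX : ∀ n, x * ((x + ρ₁) * (x + r₁ + 1 / 2) * biPoly n x ρ₁ ρ₂ r₁ r₂) =
      (x + ρ₁) * (x + r₁ + 1 / 2) * biPoly (n + 1) x ρ₁ ρ₂ r₁ r₂ +
      recB n ρ₁ ρ₂ r₁ r₂ * ((x + ρ₁) * (x + r₁ + 1 / 2) * biPoly n x ρ₁ ρ₂ r₁ r₂) +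
      recU n ρ₁ ρ₂ r₁ r₂ * ((x + ρ₁) * (x + r₁ + 1 / 2) * biPoly (n - 1) x ρ₁ ρ₂ r₁ r₂) :=
    fun n => by linear_combination (x + ρ₁) * (x + r₁ + 1 / 2) * biPoly_recurrence hg₁ x n
  have hY := biPoly_recurrence hg' (-x - 1 / 2)
  set Y : ℕ → ℂ := fun k => biPoly k (-x - 1 / 2) (ρ₁ - 1 / 2) (-r₂) (r₁ + 1 / 2) (-ρ₂)
  have h0 : (x + ρ₁) * (x + r₁ + 1 / 2) * biPoly 0 x ρ₁ ρ₂ r₁ r₂ =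
      (-1) ^ 0 * Y 2 + downA 0 ρ₁ ρ₂ r₁ r₂ * Y 1 + downB 0 ρ₁ ρ₂ r₁ r₂ * Y 0 := by
    have y0 := hY 0
    have y1 := hY 1
    simp only [zero_add, recU_zero, zero_mul, add_zero, Nat.sub_self, biPoly_zero] at y0 y1
    simp only [Y, biPoly_zero]
    linear_combination down_initial hg x + y1 +
      (-x - 1 / 2 - recB 1 (ρ₁ - 1 / 2) (-r₂) (r₁ + 1 / 2) (-ρ₂) + downA 0 ρ₁ ρ₂ r₁ r₂) * y0
  induction n using Nat.twoStepInduction with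
  | zero => exact h0
  | one =>
    rw [show (-1 : ℂ) ^ 1 = -(-1) ^ 0 by norm_num]
    -- There is no polynomial of degree -1 to expand, but `recU_zero` removes it; the remaining
    -- slots can be 0.
    refine connection_step (Y₀ := Y 2) (Y₁ := Y 1) (Y₂ := Y 0) (Y₃ := 0) (p' := 0) (q' := 0)
      (b₂ := recB 0 (ρ₁ - 1 / 2) (-r₂) (r₁ + 1 / 2) (-ρ₂)) (u₂ := 0) (hX 0) h0 ?_ (hY 2)
      (congrArg _ (hY 1)) ?_ (down_coeffA_succ hg 0) (down_coeffB_succ hg 0) ?_ ?_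
    · simp only [recU_zero, zero_mul]
    · refine congrArg _ ((hY 0).trans ?_)
      rw [recU_zero, zero_mul, mul_zero]
    · rw [mul_zero, add_zero]
      exact down_upper_remainder_zero hg
    · rw [recU_zero, mul_zero, mul_zero, add_zero]
  | more n ih₀ ih₁ =>
    rw [show (-1 : ℂ) ^ (n + 2) = -(-1) ^ (n + 1) by ring]
    refine connection_step (Y₀ := Y (n + 3)) (Y₁ := Y (n + 2)) (Y₂ := Y (n + 1)) (Y₃ := Y n)
      (hX (n + 1)) ih₁ ?_ (hY (n + 3)) (congrArg _ (hY (n + 2))) (congrArg _ (hY (n + 1)))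
      (down_coeffA_succ hg (n + 1)) (down_coeffB_succ hg (n + 1)) (down_upper_remainder hg n)
      (down_lower_remainder hg n)
    rw [Nat.add_sub_cancel, ih₀, pow_succ _ n, mul_neg_one, neg_neg]

end Identities

theorem coeffA_natCast (n : ℕ) (ρ₁ ρ₂ r₁ r₂ : ℂ) :
    coeffA n ρ₁ ρ₂ r₁ r₂ =
      if Even n then recAEven n ρ₁ ρ₂ r₁ r₂ else recAOdd n ρ₁ ρ₂ r₁ r₂ := by
  simp [coeffA, recAEven, recAOdd]

theorem coeffC_natCast (n : ℕ) (ρ₁ ρ₂ r₁ r₂ : ℂ) :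
    coeffC n ρ₁ ρ₂ r₁ r₂ =
      if Even n then recCEven n ρ₁ ρ₂ r₁ r₂ else recCOdd n ρ₁ ρ₂ r₁ r₂ := by
  simp [coeffC, recCEven, recCOdd]

theorem coeffA_pred (n : ℕ) (ρ₁ ρ₂ r₁ r₂ : ℂ) :
    coeffA (n - 1) ρ₁ ρ₂ r₁ r₂ =
      if Even n then recAOdd (n - 1) ρ₁ ρ₂ r₁ r₂ else recAEven (n - 1) ρ₁ ρ₂ r₁ r₂ := by
  by_cases h : Even n <;> simp [coeffA, recAEven, recAOdd, h]

theorem recB_eq (n : ℕ) (ρ₁ ρ₂ r₁ r₂ : ℂ) :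
    recB n ρ₁ ρ₂ r₁ r₂ = ρ₁ - coeffA n ρ₁ ρ₂ r₁ r₂ - coeffC n ρ₁ ρ₂ r₁ r₂ := by
  rw [coeffA_natCast, coeffC_natCast, recB]
  split_ifs <;> rfl

theorem recU_eq (n : ℕ) (ρ₁ ρ₂ r₁ r₂ : ℂ) :
    recU n ρ₁ ρ₂ r₁ r₂ = coeffA (n - 1) ρ₁ ρ₂ r₁ r₂ * coeffC n ρ₁ ρ₂ r₁ r₂ := by
  rw [coeffA_pred, coeffC_natCast, recU]
  split_ifs <;> rfl

/-! ### The two factors, their parameters, and the coefficients θ. -/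

section Bivariate

variable (α β γ δ ε : ℂ)

/-- The first factor of the bivariate polynomials. -/
def firstFactor (n : ℕ) (z₁ z₂ : ℂ) : ℂ :=
  biPoly n (z₁ - 1 / 4) β (z₂ + ε - 1 / 4) α (z₂ - ε + 1 / 4)

/-- The second factor of the bivariate polynomials. -/
def secondFactor (n₁ n₂ : ℕ) (z₂ : ℂ) : ℂ :=
  biPoly n₂ ((-1) ^ n₁ * z₂ - 1 / 4)
    (secondρ₁ β ε n₁) (secondρ₂ γ δ n₁) (secondr₁ α ε n₁) (secondr₂ γ δ n₁)

theorem bivBI_natCast (n₁ n₂ : ℕ) (z₁ z₂ : ℂ) :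
    bivBI α β γ δ ε n₁ n₂ z₁ z₂ =
      firstFactor α β ε n₁ z₁ z₂ * secondFactor α β γ δ ε n₁ n₂ z₂ := by
  simp [bivBI, bivBINat, firstFactor, secondFactor]

theorem bivBI_of_left_neg {n₁ : ℤ} (h : n₁ < 0) (n₂ : ℤ) (z₁ z₂ : ℂ) :
    bivBI α β γ δ ε n₁ n₂ z₁ z₂ = 0 := by
  rw [bivBI, if_neg (by omega)]

/-- Lowering the second degree is harmless when the coefficient vanishes below the range. -/
theorem mul_bivBI_sub {c : ℂ} {n₂ k : ℕ} (h : n₂ < k → c = 0) (n₁ : ℕ) (z₁ z₂ : ℂ) :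
    c * bivBI α β γ δ ε n₁ ((n₂ : ℤ) - k) z₁ z₂ =
      c * (firstFactor α β ε n₁ z₁ z₂ * secondFactor α β γ δ ε n₁ (n₂ - k) z₂) := by
  by_cases hk : n₂ < k
  · rw [h hk, zero_mul, zero_mul]
  · rw [← bivBI_natCast, Nat.cast_sub (not_lt.1 hk)]

theorem second_even {n : ℕ} (hn : Even n) : secondρ₂ γ δ n = δ ∧ secondr₂ γ δ n = -γ := by
  simp [secondρ₂, secondr₂, parityInd, hn]

theorem second_odd {n : ℕ} (hn : ¬ Even n) : secondρ₂ γ δ n = γ ∧ secondr₂ γ δ n = -δ := by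
  simp [secondρ₂, secondr₂, parityInd, hn]

/-- This is g for the second factor: it grows by one with n₁, so a single nonvanishing condition
serves every n₁. -/
theorem second_sum (n : ℕ) :
    secondρ₁ β ε n + secondρ₂ γ δ n - secondr₁ α ε n - secondr₂ γ δ n =
      -α + β + γ + δ + 2 * ε + n := by
  simp only [secondρ₁, secondρ₂, secondr₁, secondr₂]
  ring

/-- The swap of γ and δ with the parity of n₁ is precisely the exchange ρ₂ ↔ -r₂ of the connection
formulas. -/
theorem second_succ (n : ℕ) :
    secondρ₁ β ε (n + 1) = secondρ₁ β ε n + 1 / 2 ∧ secondρ₂ γ δ (n + 1) = -secondr₂ γ δ n ∧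
      secondr₁ α ε (n + 1) = secondr₁ α ε n - 1 / 2 ∧ secondr₂ γ δ (n + 1) = -secondρ₂ γ δ n := by
  have hp : parityInd (n + 1) = 1 - parityInd n := by
    by_cases h : Even n <;> simp [parityInd, Nat.even_add_one, h]
  simp only [secondρ₁, secondρ₂, secondr₁, secondr₂, hp]
  push_cast
  refine ⟨?_, ?_, ?_, ?_⟩ <;> ring

theorem secondFactor_succ (n₁ n₂ : ℕ) (z₂ : ℂ) :
    secondFactor α β γ δ ε (n₁ + 1) n₂ z₂ =
      biPoly n₂ (-((-1) ^ n₁ * z₂ - 1 / 4) - 1 / 2) (secondρ₁ β ε n₁ + 1 / 2) (-secondr₂ γ δ n₁)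
        (secondr₁ α ε n₁ - 1 / 2) (-secondρ₂ γ δ n₁) := by
  obtain ⟨e1, e2, e3, e4⟩ := second_succ α β γ δ ε n₁
  rw [secondFactor, e1, e2, e3, e4, pow_succ]
  congr 1
  ring

theorem secondFactor_eq_pred (n₁ n₂ : ℕ) (z₂ : ℂ) :
    secondFactor α β γ δ ε n₁ n₂ z₂ =
      biPoly n₂ (-((-1) ^ (n₁ + 1) * z₂ - 1 / 4) - 1 / 2) (secondρ₁ β ε (n₁ + 1) - 1 / 2)
        (-secondr₂ γ δ (n₁ + 1)) (secondr₁ α ε (n₁ + 1) + 1 / 2) (-secondρ₂ γ δ (n₁ + 1)) := by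
  obtain ⟨e1, e2, e3, e4⟩ := second_succ α β γ δ ε n₁
  rw [secondFactor, e1, e2, e3, e4, pow_succ, add_sub_cancel_right, sub_add_cancel, neg_neg,
    neg_neg]
  congr 1
  ring

/-! The coefficients of the nine-term relation in terms of the univariate ones. -/

variable {α β γ δ ε} {n₁ n₂ : ℕ}

theorem total_ne_zero (h₂ : ∀ k : ℕ, -α + β + γ + δ + 2 * ε + 1 + (k : ℂ) ≠ 0) {n₁ n₂ : ℕ}
    (h : n₁ + n₂ ≠ 0) : -α + β + γ + δ + 2 * ε + n₁ + n₂ ≠ 0 := by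
  obtain ⟨k, hk⟩ := Nat.exists_eq_succ_of_ne_zero h
  have hk' : (n₁ : ℂ) + n₂ = k + 1 := by exact_mod_cast hk
  intro h'
  exact h₂ k (by linear_combination h' - hk')

theorem total_add_one_ne_zero (h₂ : ∀ k : ℕ, -α + β + γ + δ + 2 * ε + 1 + (k : ℂ) ≠ 0)
    (n₁ n₂ : ℕ) : -α + β + γ + δ + 2 * ε + n₁ + n₂ + 1 ≠ 0 := by
  intro h'
  exact h₂ (n₁ + n₂) (by push_cast; linear_combination h')

/-- For n₁ even the two expressions agree literally, so S = 0 is harmless. For n₁ odd they agree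
through a_γ + b_δ = a_δ + b_γ = 2S, which needs S ≠ 0; this holds because n₁ ≥ 1. -/
theorem theta2_eq (h₂ : ∀ k : ℕ, -α + β + γ + δ + 2 * ε + 1 + (k : ℂ) ≠ 0) :
    theta2 α β γ δ ε n₁ n₂ = upA n₂ (secondρ₁ β ε n₁) (secondρ₂ γ δ n₁) (secondr₁ α ε n₁)
      (secondr₂ γ δ n₁) := by
  have e : (n₂ : ℂ) + (-α + β + γ + δ + 2 * ε + n₁) = -α + β + γ + δ + 2 * ε + n₁ + n₂ := by ring
  have hS' := total_add_one_ne_zero h₂ n₁ n₂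
  rw [upA, upAEven, upAOdd, second_sum, e, theta2]
  by_cases hn₁ : Even n₁
  · obtain ⟨e2, e4⟩ := second_even γ δ hn₁
    rw [if_pos hn₁, e2, e4, secondρ₁, secondr₁]
    split_ifs <;> ring
  · obtain ⟨e2, e4⟩ := second_odd γ δ hn₁
    have hS : -α + β + γ + δ + 2 * ε + n₁ + n₂ ≠ 0 :=
      total_ne_zero h₂ (by rintro h; simp [show n₁ = 0 by omega] at hn₁)
    rw [if_neg hn₁, e2, e4, secondρ₁, secondr₁]
    generalize hG : -α + β + γ + δ + 2 * ε + (n₁ : ℂ) + n₂ = S at *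
    obtain rfl : β = S + α - γ - δ - 2 * ε - n₁ - n₂ := by rw [← hG]; ring
    clear hG h₂ e e2 e4
    split_ifs <;> field_simp <;> ring

theorem theta3_eq :
    theta3 α β γ δ ε n₁ n₂ = upB n₂ (secondρ₁ β ε n₁) (secondρ₂ γ δ n₁) (secondr₁ α ε n₁)
      (secondr₂ γ δ n₁) := by
  have e : (n₂ : ℂ) + (-α + β + γ + δ + 2 * ε + n₁) = -α + β + γ + δ + 2 * ε + n₁ + n₂ := by ring
  rw [upB, upBEven, upBOdd, second_sum, e, theta3]
  generalize -α + β + γ + δ + 2 * ε + (n₁ : ℂ) + n₂ = S at *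
  by_cases hn₁ : Even n₁
  · obtain ⟨e2, e4⟩ := second_even γ δ hn₁
    rw [if_pos hn₁, e2, e4, secondρ₁, secondr₁]
    split_ifs <;> ring
  · obtain ⟨e2, e4⟩ := second_odd γ δ hn₁
    rw [if_neg hn₁, e2, e4, secondρ₁, secondr₁]
    split_ifs <;> ring

theorem theta4_denominators :
    -2 * α + 2 * β + 4 * ε + 2 * n₁ - 1 = 2 * (-α + β + 2 * ε + n₁ - 1 / 2) ∧
      -2 * α + 2 * β + 4 * ε + 2 * n₁ + 1 = 2 * (-α + β + 2 * ε + n₁ + 1 / 2) := by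
  constructor <;> ring

/-- The bracket is the constant term from `first_recB` plus the middle recurrence coefficient of the
second factor. -/
theorem theta5_eq (h₂ : ∀ k : ℕ, -α + β + γ + δ + 2 * ε + 1 + (k : ℂ) ≠ 0) :
    theta5 α β γ δ ε n₁ n₂ = theta4 α β ε n₁ *
      ((2 * α + 2 * β + 1) * (-2 * α + 2 * β + 4 * ε + 2 * n₁ + 1) / 4 - secondρ₁ β ε n₁ +
        recB n₂ (secondρ₁ β ε n₁) (secondρ₂ γ δ n₁) (secondr₁ α ε n₁) (secondr₂ γ δ n₁)) := by
  have e : (n₂ : ℂ) + (-α + β + γ + δ + 2 * ε + n₁) = -α + β + γ + δ + 2 * ε + n₁ + n₂ := by ring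
  have hS' := total_add_one_ne_zero h₂ n₁ n₂
  obtain ⟨d, d'⟩ := theta4_denominators (α := α) (β := β) (ε := ε) (n₁ := n₁)
  have t : theta4 α β ε n₁ = if Even n₁ then
        -((n₁ : ℂ) / (-2 * α + 2 * β + 4 * ε + 2 * n₁ - 1) +
          (4 * ε + n₁) / (-2 * α + 2 * β + 4 * ε + 2 * n₁ + 1) - 1)
      else -(((n₁ : ℂ) + 1) / (-2 * α + 2 * β + 4 * ε + 2 * n₁ + 1) +
          (4 * ε + n₁ - 1) / (-2 * α + 2 * β + 4 * ε + 2 * n₁ - 1) - 1) := by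
    rw [theta4, d, d']
    generalize -α + β + 2 * ε + (n₁ : ℂ) - 1 / 2 = y
    generalize -α + β + 2 * ε + (n₁ : ℂ) + 1 / 2 = y'
    split_ifs <;> ring
  have key : ∀ {c x y z : ℂ}, 1 / 4 * (x * y) = z → -(1 / 4) * c * x * y = -c * z := by
    rintro c x y z rfl
    ring
  rw [t, recB, recBEven, recBOdd, recAEven, recCEven, recAOdd, recCOdd, second_sum, e, theta5]
  -- S can vanish only at n₁ = n₂ = 0, where in the even case it occurs only below a numerator n₂ =
  -- 0.
  have hS : (n₂ : ℂ) = 0 ∨ -α + β + γ + δ + 2 * ε + n₁ + n₂ ≠ 0 := by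
    rcases Nat.eq_zero_or_pos n₂ with h | h
    · exact Or.inl (by exact_mod_cast h)
    · exact Or.inr (total_ne_zero h₂ (by omega))
  by_cases hn₁ : Even n₁
  · obtain ⟨e2, e4⟩ := second_even γ δ hn₁
    rw [if_pos hn₁, if_pos hn₁, e2, e4, secondρ₁, secondr₁]
    by_cases hn₂ : Even n₂
    · rw [if_pos hn₂, if_pos hn₂]
      refine key ?_
      generalize hG : -α + β + γ + δ + 2 * ε + (n₁ : ℂ) + n₂ = S at *
      obtain rfl : β = S + α - γ - δ - 2 * ε - n₁ - n₂ := by rw [← hG]; ring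
      clear hG h₂ e e2 e4 t d d' key
      rcases hS with h0 | hS
      · rw [h0]
        field_simp
        ring
      · field_simp
        ring
    · have hS : -α + β + γ + δ + 2 * ε + n₁ + n₂ ≠ 0 :=
        total_ne_zero h₂ (by rintro h; simp [show n₂ = 0 by omega] at hn₂)
      rw [if_neg hn₂, if_neg hn₂]
      refine key ?_
      generalize hG : -α + β + γ + δ + 2 * ε + (n₁ : ℂ) + n₂ = S at *
      obtain rfl : β = S + α - γ - δ - 2 * ε - n₁ - n₂ := by rw [← hG]; ring
      clear hG h₂ e e2 e4 t d d' key
      field_simp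
      ring
  · obtain ⟨e2, e4⟩ := second_odd γ δ hn₁
    have hS : -α + β + γ + δ + 2 * ε + n₁ + n₂ ≠ 0 :=
      total_ne_zero h₂ (by rintro h; simp [show n₁ = 0 by omega] at hn₁)
    rw [if_neg hn₁, if_neg hn₁, e2, e4, secondρ₁, secondr₁]
    split_ifs
    all_goals
      refine key ?_
      generalize hG : -α + β + γ + δ + 2 * ε + (n₁ : ℂ) + n₂ = S at *
      obtain rfl : β = S + α - γ - δ - 2 * ε - n₁ - n₂ := by rw [← hG]; ring
      clear hG h₂ e e2 e4 t d d' key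
      field_simp
      ring

theorem theta6_eq
    (h : n₁ ≠ 0 → -2 * α + 2 * β + 4 * ε + 2 * n₁ - 1 ≠ 0)
    (h' : -2 * α + 2 * β + 4 * ε + 2 * n₁ + 1 ≠ 0) :
    theta6 α β γ δ ε n₁ n₂ = theta4 α β ε n₁ *
      recU n₂ (secondρ₁ β ε n₁) (secondρ₂ γ δ n₁) (secondr₁ α ε n₁) (secondr₂ γ δ n₁) := by
  have e : (n₂ : ℂ) + (-α + β + γ + δ + 2 * ε + n₁) = -α + β + γ + δ + 2 * ε + n₁ + n₂ := by ring
  have e' : (n₂ : ℂ) - 1 + (-α + β + γ + δ + 2 * ε + n₁) + 1 =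
    -α + β + γ + δ + 2 * ε + n₁ + n₂ := by ring
  obtain ⟨d, d'⟩ := theta4_denominators (α := α) (β := β) (ε := ε) (n₁ := n₁)
  have t : theta4 α β ε n₁ = if Even n₁ then
        -((2 * α - 2 * β + 2 * n₁ / (-2 * α + 2 * β + 4 * ε + 2 * n₁ - 1) - 1) /
          (-2 * α + 2 * β + 4 * ε + 2 * n₁ + 1))
      else -((2 * α - 2 * β + (8 * ε + 2 * n₁ - 2) /
          (-2 * α + 2 * β + 4 * ε + 2 * n₁ - 1) - 1) /
          (-2 * α + 2 * β + 4 * ε + 2 * n₁ + 1)) := by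
    rw [theta4]
    generalize hy : -2 * α + 2 * β + 4 * ε + 2 * (n₁ : ℂ) - 1 = y at *
    have hy' : -2 * α + 2 * β + 4 * ε + 2 * (n₁ : ℂ) + 1 = y + 2 := by rw [← hy]; ring
    rw [hy'] at h' d' ⊢
    have hd : -α + β + 2 * ε + (n₁ : ℂ) - 1 / 2 = y / 2 := by rw [d]; ring
    have hd' : -α + β + 2 * ε + (n₁ : ℂ) + 1 / 2 = (y + 2) / 2 := by rw [d']; ring
    rw [hd, hd']
    obtain rfl : β = (y + 1 - 2 * n₁ - 4 * ε) / 2 + α := by rw [← hy]; ring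
    clear hy hy' d d' hd hd'
    -- For n₁ = 0 the denominator T - 1 may vanish, but its numerator is then 0.
    by_cases hn : n₁ = 0
    · subst hn
      simp only [Even.zero, if_true, Nat.cast_zero]
      field_simp
      ring
    · have h := h hn
      split_ifs
      all_goals
        field_simp
        ring
  rw [t, recU, recUEven, recUOdd, recAEven, recCEven, recAOdd, recCOdd, second_sum, e, e', theta6]
  generalize -2 * α + 2 * β + 4 * ε + 2 * (n₁ : ℂ) + 1 = y
  generalize -2 * α + 2 * β + 4 * ε + 2 * (n₁ : ℂ) - 1 = y'
  generalize -α + β + γ + δ + 2 * ε + (n₁ : ℂ) + n₂ = S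
  by_cases hn₁ : Even n₁
  · obtain ⟨e2, e4⟩ := second_even γ δ hn₁
    rw [if_pos hn₁, if_pos hn₁, e2, e4, secondρ₁, secondr₁]
    split_ifs <;> ring
  · obtain ⟨e2, e4⟩ := second_odd γ δ hn₁
    rw [if_neg hn₁, if_neg hn₁, e2, e4, secondρ₁, secondr₁]
    split_ifs <;> ring

end Bivariate

section Bivariate

/-- The rational factor common to the three coefficients that lower the first degree. -/
def lowerFactor (α β ε : ℂ) (n₁ : ℕ) : ℂ :=
  (if Even n₁ then (n₁ : ℂ) * (-2 * α + 2 * β + 4 * ε + n₁ - 1)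
    else (4 * ε + n₁ - 1) * (-2 * α + 2 * β + n₁)) / (-2 * α + 2 * β + 4 * ε + 2 * n₁ - 1) ^ 2

variable {α β γ δ ε : ℂ} {n₁ n₂ : ℕ}

theorem theta7_eq : theta7 α β ε n₁ n₂ = lowerFactor α β ε n₁ * (-1) ^ n₂ := by
  rw [theta7, lowerFactor]
  split_ifs <;> ring

/-- The restriction n₁ ≠ 0 guarantees S ≠ 0; at n₁ = 0 the term multiplies a polynomial of negative
degree. -/
theorem theta8_eq (h₂ : ∀ k : ℕ, -α + β + γ + δ + 2 * ε + 1 + (k : ℂ) ≠ 0) (h : n₁ ≠ 0) :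
    theta8 α β γ δ ε n₁ n₂ = lowerFactor α β ε n₁ *
      downA n₂ (secondρ₁ β ε n₁) (secondρ₂ γ δ n₁) (secondr₁ α ε n₁) (secondr₂ γ δ n₁) := by
  have e : (n₂ : ℂ) + (-α + β + γ + δ + 2 * ε + n₁) = -α + β + γ + δ + 2 * ε + n₁ + n₂ := by ring
  have hS' := total_add_one_ne_zero h₂ n₁ n₂
  have hS : -α + β + γ + δ + 2 * ε + n₁ + n₂ ≠ 0 := total_ne_zero h₂ (by omega)
  have e1 : 2 * (β + ε + (n₁ : ℂ) / 2) + 2 * (α - ε - n₁ / 2) = 2 * α + 2 * β := by ring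
  have e2 : β + ε + (n₁ : ℂ) / 2 - (α - ε - n₁ / 2) + n₂ / 2 =
    -α + β + 2 * ε + n₁ + n₂ / 2 := by ring
  rw [downA, downAEven, downAOdd, second_sum, e, theta8, lowerFactor]
  generalize -2 * α + 2 * β + 4 * ε + 2 * (n₁ : ℂ) - 1 = y
  by_cases hn₁ : Even n₁
  · have e3 : (n₂ : ℂ) - 2 * (α - ε - n₁ / 2) - 2 * -γ =
      -2 * α + 2 * γ + 2 * ε + n₁ + n₂ := by ring
    rw [if_pos hn₁, if_pos hn₁, (second_even γ δ hn₁).2, secondρ₁, secondr₁, e1, e2, e3]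
    generalize -α + β + γ + δ + 2 * ε + (n₁ : ℂ) + (n₂ : ℂ) + 1 = S'
    generalize -α + β + γ + δ + 2 * ε + (n₁ : ℂ) + (n₂ : ℂ) = S
    generalize -α + β + γ + δ + 2 * ε + (n₁ : ℂ) + (n₂ : ℂ) / 2 = G
    generalize -α + β + 2 * ε + (n₁ : ℂ) + (n₂ : ℂ) / 2 = G'
    split_ifs
    · generalize 2 * α + 2 * β - (-2 * α + 2 * γ + 2 * ε + n₁ + n₂) / S + 1 = K
      ring
    · generalize 2 * α + 2 * β + (-2 * α + 2 * γ + 2 * ε + n₁ + n₂ + 1) / S' - 1 = K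
      ring
  · have e3 : (n₂ : ℂ) - 2 * (α - ε - n₁ / 2) - 2 * -δ =
      -2 * α + 2 * δ + 2 * ε + n₁ + n₂ := by ring
    -- For n₁ odd, θ⁽⁸⁾ is written with a_γ where `downA` may have a_δ. The relation a_γ + a_δ = 2S
    -- - 2α - 2β converts one form into the other.
    have key : ∀ a b : ℂ, a + b = 2 * (-α + β + γ + δ + 2 * ε + n₁ + n₂) - (2 * α + 2 * β) →
        (2 * α + 2 * β + (a + 1) / (-α + β + γ + δ + 2 * ε + n₁ + n₂ + 1) - 1) /
          (-α + β + γ + δ + 2 * ε + n₁ + n₂) =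
        (2 * α + 2 * β - b / (-α + β + γ + δ + 2 * ε + n₁ + n₂) + 1) /
          (-α + β + γ + δ + 2 * ε + n₁ + n₂ + 1) := by
      intro a b hab
      generalize -α + β + γ + δ + 2 * ε + (n₁ : ℂ) + (n₂ : ℂ) = S at *
      obtain rfl : a = 2 * S - (2 * α + 2 * β) - b := by linear_combination hab
      field_simp
      ring
    have k1 := key (-2 * α + 2 * γ + 2 * ε + n₁ + n₂) (-2 * α + 2 * δ + 2 * ε + n₁ + n₂) (by ring)
    have k2 := key (-2 * α + 2 * δ + 2 * ε + n₁ + n₂) (-2 * α + 2 * γ + 2 * ε + n₁ + n₂) (by ring)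
    rw [if_neg hn₁, if_neg hn₁, (second_odd γ δ hn₁).2, secondρ₁, secondr₁, e1, e2, e3]
    generalize -α + β + γ + δ + 2 * ε + (n₁ : ℂ) + (n₂ : ℂ) + 1 = S' at *
    generalize -α + β + γ + δ + 2 * ε + (n₁ : ℂ) + (n₂ : ℂ) = S at *
    generalize -α + β + γ + δ + 2 * ε + (n₁ : ℂ) + (n₂ : ℂ) / 2 = G
    generalize -α + β + 2 * ε + (n₁ : ℂ) + (n₂ : ℂ) / 2 = G'
    split_ifs
    · generalize 2 * α + 2 * β - (-2 * α + 2 * δ + 2 * ε + n₁ + n₂) / S + 1 = K at *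
      generalize 2 * α + 2 * β + (-2 * α + 2 * γ + 2 * ε + n₁ + n₂ + 1) / S' - 1 = K' at *
      linear_combination (2 * ε + ((n₁ : ℂ) - 1) / 2) * (2 * α - 2 * β - n₁) * G / y ^ 2 * k1
    · generalize 2 * α + 2 * β - (-2 * α + 2 * γ + 2 * ε + n₁ + n₂) / S + 1 = K at *
      generalize 2 * α + 2 * β + (-2 * α + 2 * δ + 2 * ε + n₁ + n₂ + 1) / S' - 1 = K' at *
      linear_combination (2 * ε + ((n₁ : ℂ) - 1) / 2) * (2 * α - 2 * β - n₁) * G' / y ^ 2 * k2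

theorem theta9_eq :
    theta9 α β γ δ ε n₁ n₂ = lowerFactor α β ε n₁ *
      downB n₂ (secondρ₁ β ε n₁) (secondρ₂ γ δ n₁) (secondr₁ α ε n₁) (secondr₂ γ δ n₁) := by
  have e : (n₂ : ℂ) + (-α + β + γ + δ + 2 * ε + n₁) = -α + β + γ + δ + 2 * ε + n₁ + n₂ := by ring
  have e0 : 2 * (β + ε + (n₁ : ℂ) / 2) - 2 * (α - ε - n₁ / 2) + n₂ =
    -2 * α + 2 * β + 4 * ε + 2 * n₁ + n₂ := by ring
  have eα : ∀ c : ℂ, (n₂ : ℂ) - 2 * (α - ε - n₁ / 2) - 2 * -c =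
    2 * (-α + c + ε + ((n₁ : ℂ) + n₂) / 2) := fun c => by ring
  have eα' : ∀ c : ℂ, (n₂ : ℂ) + 2 * c - 2 * (α - ε - n₁ / 2) =
    2 * (-α + c + ε + ((n₁ : ℂ) + n₂) / 2) := fun c => by ring
  have eβ : ∀ c : ℂ, (n₂ : ℂ) + 2 * (β + ε + n₁ / 2) + 2 * c =
    2 * (β + c + ε + ((n₁ : ℂ) + n₂) / 2) := fun c => by ring
  have eβ' : ∀ c : ℂ, (n₂ : ℂ) + 2 * (β + ε + n₁ / 2) - 2 * -c =
    2 * (β + c + ε + ((n₁ : ℂ) + n₂) / 2) := fun c => by ring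
  have eG : -α + β + γ + δ + 2 * ε + n₁ + ((n₂ : ℂ) - 1) / 2 =
    -α + β + γ + δ + 2 * ε + n₁ + (n₂ : ℂ) / 2 - 1 / 2 := by ring
  rw [downB, downBEven, downBOdd, second_sum, e, theta9, lowerFactor, secondρ₁, secondr₁, e0, eG]
  generalize -2 * α + 2 * β + 4 * ε + 2 * (n₁ : ℂ) - 1 = y
  generalize -2 * α + 2 * β + 4 * ε + 2 * (n₁ : ℂ) + n₂ = T
  generalize -α + β + γ + δ + 2 * ε + (n₁ : ℂ) + n₂ = S
  generalize -α + β + γ + δ + 2 * ε + (n₁ : ℂ) + (n₂ : ℂ) / 2 = G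
  by_cases hn₂ : Even n₂
  · have hs : (-1 : ℂ) ^ (n₂ + 1) = -1 := hn₂.add_one.neg_one_pow
    rw [if_pos hn₂, if_pos hn₂, if_pos hn₂, hs]
    by_cases hn₁ : Even n₁
    · obtain ⟨e2, e4⟩ := second_even γ δ hn₁
      rw [if_pos hn₁, if_pos hn₁, e2, e4, eα, eβ]
      generalize -α + γ + ε + ((n₁ : ℂ) + n₂) / 2 = a
      generalize β + δ + ε + ((n₁ : ℂ) + n₂) / 2 = b
      ring
    · obtain ⟨e2, e4⟩ := second_odd γ δ hn₁
      rw [if_neg hn₁, if_neg hn₁, e2, e4, eα, eβ]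
      generalize -α + δ + ε + ((n₁ : ℂ) + n₂) / 2 = a
      generalize β + γ + ε + ((n₁ : ℂ) + n₂) / 2 = b
      ring
  · have hs : (-1 : ℂ) ^ (n₂ + 1) = 1 := (Nat.not_even_iff_odd.1 hn₂).add_one.neg_one_pow
    rw [if_neg hn₂, if_neg hn₂, if_neg hn₂, hs]
    by_cases hn₁ : Even n₁
    · obtain ⟨e2, e4⟩ := second_even γ δ hn₁
      rw [if_pos hn₁, if_pos hn₁, e2, e4, eα', eβ']
      generalize -α + δ + ε + ((n₁ : ℂ) + n₂) / 2 = a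
      generalize β + γ + ε + ((n₁ : ℂ) + n₂) / 2 = b
      ring
    · obtain ⟨e2, e4⟩ := second_odd γ δ hn₁
      rw [if_neg hn₁, if_neg hn₁, e2, e4, eα', eβ']
      generalize -α + γ + ε + ((n₁ : ℂ) + n₂) / 2 = a
      generalize β + δ + ε + ((n₁ : ℂ) + n₂) / 2 = b
      ring

/-- The parameters ρ₂ and r₂ of the first factor contain z₂, but their difference does not. So
A_{n₁-1} C_{n₁} has a constant denominator and just two factors linear in z₂, and these are the two
factors of the multiplier in `mul_biPoly_eq_down`. -/
theorem first_recU (z₂ : ℂ) :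
    recU n₁ β (z₂ + ε - 1 / 4) α (z₂ - ε + 1 / 4) = lowerFactor α β ε n₁ *
      (((-1) ^ n₁ * z₂ - 1 / 4 + secondρ₁ β ε n₁) *
        ((-1) ^ n₁ * z₂ - 1 / 4 + secondr₁ α ε n₁ + 1 / 2)) := by
  have e : (n₁ : ℂ) + (β + (z₂ + ε - 1 / 4) - α - (z₂ - ε + 1 / 4)) =
    (-2 * α + 2 * β + 4 * ε + 2 * n₁ - 1) / 2 := by ring
  have e' : (n₁ : ℂ) - 1 + (β + (z₂ + ε - 1 / 4) - α - (z₂ - ε + 1 / 4)) + 1 =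
    (-2 * α + 2 * β + 4 * ε + 2 * n₁ - 1) / 2 := by ring
  rw [recU, recUEven, recUOdd, recAEven, recAOdd, recCEven, recCOdd, e, e', lowerFactor,
    secondρ₁, secondr₁]
  generalize -2 * α + 2 * β + 4 * ε + 2 * (n₁ : ℂ) - 1 = y
  by_cases hn₁ : Even n₁
  · rw [if_pos hn₁, if_pos hn₁, hn₁.neg_one_pow]
    ring
  · rw [if_neg hn₁, if_neg hn₁, (Nat.not_even_iff_odd.1 hn₁).neg_one_pow]
    ring

/-- The middle coefficient is affine in x = (-1)^{n₁} z₂ - 1/4 with slope θ⁽⁴⁾. The shift -α² + β²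
of z₁ is what lets θ⁽⁴⁾ divide the constant term as well. -/
theorem first_recB (h : n₁ ≠ 0 → -2 * α + 2 * β + 4 * ε + 2 * n₁ - 1 ≠ 0)
    (h' : -2 * α + 2 * β + 4 * ε + 2 * n₁ + 1 ≠ 0) (z₂ : ℂ) :
    recB n₁ β (z₂ + ε - 1 / 4) α (z₂ - ε + 1 / 4) + 1 / 4 - α ^ 2 + β ^ 2 =
      theta4 α β ε n₁ * ((-1) ^ n₁ * z₂ - 1 / 4 +
        ((2 * α + 2 * β + 1) * (-2 * α + 2 * β + 4 * ε + 2 * n₁ + 1) / 4 - secondρ₁ β ε n₁)) := by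
  have e : (n₁ : ℂ) + (β + (z₂ + ε - 1 / 4) - α - (z₂ - ε + 1 / 4)) =
    (-2 * α + 2 * β + 4 * ε + 2 * n₁ - 1) / 2 := by ring
  rw [recB, recBEven, recBOdd, recAEven, recAOdd, recCEven, recCOdd, e, secondρ₁, theta4]
  generalize hy : -2 * α + 2 * β + 4 * ε + 2 * (n₁ : ℂ) - 1 = y at *
  have hy' : -2 * α + 2 * β + 4 * ε + 2 * (n₁ : ℂ) + 1 = y + 2 := by rw [← hy]; ring
  rw [hy'] at h' ⊢
  have hd : -α + β + 2 * ε + (n₁ : ℂ) - 1 / 2 = y / 2 := by rw [← hy]; ring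
  have hd' : -α + β + 2 * ε + (n₁ : ℂ) + 1 / 2 = (y + 2) / 2 := by rw [← hy]; ring
  have hd'' : y / 2 + 1 = (y + 2) / 2 := by ring
  rw [hd, hd', hd'']
  obtain rfl : β = (y + 1 - 2 * n₁ - 4 * ε) / 2 + α := by rw [← hy]; ring
  clear hy hy' hd hd' hd'' e
  by_cases hn : n₁ = 0
  · subst hn
    simp only [Even.zero, if_true, Nat.cast_zero, pow_zero]
    field_simp
    ring
  · have h := h hn
    by_cases hn₁ : Even n₁
    · rw [if_pos hn₁, if_pos hn₁, hn₁.neg_one_pow]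
      field_simp
      ring
    · rw [if_neg hn₁, if_neg hn₁, (Nat.not_even_iff_odd.1 hn₁).neg_one_pow]
      field_simp
      ring

theorem lower_denominator_ne_zero (h₁ : ∀ k : ℕ, -α + β + 2 * ε + 1 / 2 + (k : ℂ) ≠ 0)
    (h : n₁ ≠ 0) : -2 * α + 2 * β + 4 * ε + 2 * n₁ - 1 ≠ 0 := by
  obtain ⟨k, rfl⟩ := Nat.exists_eq_succ_of_ne_zero h
  intro h'
  push_cast at h'
  exact h₁ k (by linear_combination h' / 2)

theorem raise_denominator_ne_zero (h₁ : ∀ k : ℕ, -α + β + 2 * ε + 1 / 2 + (k : ℂ) ≠ 0) (n₁ : ℕ) :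
    -2 * α + 2 * β + 4 * ε + 2 * n₁ + 1 ≠ 0 :=
  fun h' => h₁ n₁ (by linear_combination h' / 2)

/-! ### Assembly of the bivariate recurrences. -/

theorem firstFactor_recurrence (h₁ : ∀ k : ℕ, -α + β + 2 * ε + 1 / 2 + (k : ℂ) ≠ 0) (n : ℕ)
    (z₁ z₂ : ℂ) :
    (z₁ - 1 / 4) * firstFactor α β ε n z₁ z₂ =
      firstFactor α β ε (n + 1) z₁ z₂ +
        recB n β (z₂ + ε - 1 / 4) α (z₂ - ε + 1 / 4) * firstFactor α β ε n z₁ z₂ +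
        recU n β (z₂ + ε - 1 / 4) α (z₂ - ε + 1 / 4) * firstFactor α β ε (n - 1) z₁ z₂ :=
  biPoly_recurrence (fun k h => h₁ k (by linear_combination h)) _ n

theorem secondFactor_recurrence (h₂ : ∀ k : ℕ, -α + β + γ + δ + 2 * ε + 1 + (k : ℂ) ≠ 0)
    (n₁ n₂ : ℕ) (z₂ : ℂ) :
    ((-1) ^ n₁ * z₂ - 1 / 4) * secondFactor α β γ δ ε n₁ n₂ z₂ =
      secondFactor α β γ δ ε n₁ (n₂ + 1) z₂ +
        recB n₂ (secondρ₁ β ε n₁) (secondρ₂ γ δ n₁) (secondr₁ α ε n₁) (secondr₂ γ δ n₁) *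
          secondFactor α β γ δ ε n₁ n₂ z₂ +
        recU n₂ (secondρ₁ β ε n₁) (secondρ₂ γ δ n₁) (secondr₁ α ε n₁) (secondr₂ γ δ n₁) *
          secondFactor α β γ δ ε n₁ (n₂ - 1) z₂ :=
  biPoly_recurrence (fun k h => h₂ (n₁ + k) (by
    rw [second_sum] at h
    push_cast
    linear_combination h)) _ n₂

theorem secondFactor_eq_up (h₂ : ∀ k : ℕ, -α + β + γ + δ + 2 * ε + 1 + (k : ℂ) ≠ 0)
    (n₁ n₂ : ℕ) (z₂ : ℂ) :
    secondFactor α β γ δ ε n₁ n₂ z₂ =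
      (-1) ^ n₂ * secondFactor α β γ δ ε (n₁ + 1) n₂ z₂ +
        theta2 α β γ δ ε n₁ n₂ * secondFactor α β γ δ ε (n₁ + 1) (n₂ - 1) z₂ +
        theta3 α β γ δ ε n₁ n₂ * secondFactor α β γ δ ε (n₁ + 1) (n₂ - 2) z₂ := by
  rw [theta2_eq h₂, theta3_eq, secondFactor_succ, secondFactor_succ, secondFactor_succ]
  exact biPoly_eq_up (fun k h => h₂ (n₁ + k) (by
    rw [second_sum] at h
    push_cast
    linear_combination h)) _ n₂

/-- The lowering coefficient of the first factor supplies the quadratic multiplier, so the last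
three terms of the nine-term relation come from the second connection formula at n₁ + 1. -/
theorem mul_secondFactor_eq_down (h₂ : ∀ k : ℕ, -α + β + γ + δ + 2 * ε + 1 + (k : ℂ) ≠ 0)
    (n₁ n₂ : ℕ) (z₂ : ℂ) :
    recU (n₁ + 1) β (z₂ + ε - 1 / 4) α (z₂ - ε + 1 / 4) *
        secondFactor α β γ δ ε (n₁ + 1) n₂ z₂ =
      theta7 α β ε (n₁ + 1) n₂ * secondFactor α β γ δ ε n₁ (n₂ + 2) z₂ +
        theta8 α β γ δ ε (n₁ + 1) n₂ * secondFactor α β γ δ ε n₁ (n₂ + 1) z₂ +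
        theta9 α β γ δ ε (n₁ + 1) n₂ * secondFactor α β γ δ ε n₁ n₂ z₂ := by
  rw [theta7_eq, theta8_eq h₂ n₁.succ_ne_zero, theta9_eq, secondFactor_eq_pred _ _ _ _ _ n₁,
    secondFactor_eq_pred _ _ _ _ _ n₁, secondFactor_eq_pred _ _ _ _ _ n₁, first_recU]
  have := mul_biPoly_eq_down (fun k h => h₂ (n₁ + k) (by
    rw [second_sum] at h
    push_cast at h ⊢
    linear_combination h)) ((-1) ^ (n₁ + 1) * z₂ - 1 / 4) n₂ (ρ₁ := secondρ₁ β ε (n₁ + 1))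
    (ρ₂ := secondρ₂ γ δ (n₁ + 1)) (r₁ := secondr₁ α ε (n₁ + 1)) (r₂ := secondr₂ γ δ (n₁ + 1))
  rw [secondFactor]
  linear_combination lowerFactor α β ε (n₁ + 1) * this

theorem bivBI_three_term (h₂ : ∀ k : ℕ, -α + β + γ + δ + 2 * ε + 1 + (k : ℂ) ≠ 0)
    (n₁ n₂ : ℕ) (z₁ z₂ : ℂ) :
    ((-1) ^ n₁ * z₂ - 1 / 4) * bivBI α β γ δ ε n₁ n₂ z₁ z₂ =
      bivBI α β γ δ ε n₁ (n₂ + 1) z₁ z₂ +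
        recB n₂ (secondρ₁ β ε n₁) (secondρ₂ γ δ n₁) (secondr₁ α ε n₁) (secondr₂ γ δ n₁) *
          bivBI α β γ δ ε n₁ n₂ z₁ z₂ +
        recU n₂ (secondρ₁ β ε n₁) (secondρ₂ γ δ n₁) (secondr₁ α ε n₁) (secondr₂ γ δ n₁) *
          bivBI α β γ δ ε n₁ (n₂ - 1) z₁ z₂ := by
  have e := mul_bivBI_sub α β γ δ ε
    (c := recU n₂ (secondρ₁ β ε n₁) (secondρ₂ γ δ n₁) (secondr₁ α ε n₁) (secondr₂ γ δ n₁))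
    (n₂ := n₂) (k := 1) (fun h => by rw [Nat.lt_one_iff.1 h, recU_zero]) n₁ z₁ z₂
  rw [Nat.cast_one] at e
  have e' := bivBI_natCast α β γ δ ε n₁ (n₂ + 1) z₁ z₂
  push_cast at e'
  rw [e, e', bivBI_natCast]
  linear_combination firstFactor α β ε n₁ z₁ z₂ * secondFactor_recurrence h₂ n₁ n₂ z₂

theorem bivBI_nine_term (h₁ : ∀ k : ℕ, -α + β + 2 * ε + 1 / 2 + (k : ℂ) ≠ 0)
    (h₂ : ∀ k : ℕ, -α + β + γ + δ + 2 * ε + 1 + (k : ℂ) ≠ 0) (n₁ n₂ : ℕ) (z₁ z₂ : ℂ) :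
    (z₁ - α ^ 2 + β ^ 2) * bivBI α β γ δ ε n₁ n₂ z₁ z₂ =
      theta1 n₂ * bivBI α β γ δ ε (n₁ + 1) n₂ z₁ z₂
      + theta2 α β γ δ ε n₁ n₂ * bivBI α β γ δ ε (n₁ + 1) (n₂ - 1) z₁ z₂
      + theta3 α β γ δ ε n₁ n₂ * bivBI α β γ δ ε (n₁ + 1) (n₂ - 2) z₁ z₂
      + theta4 α β ε n₁ * bivBI α β γ δ ε n₁ (n₂ + 1) z₁ z₂
      + theta5 α β γ δ ε n₁ n₂ * bivBI α β γ δ ε n₁ n₂ z₁ z₂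
      + theta6 α β γ δ ε n₁ n₂ * bivBI α β γ δ ε n₁ (n₂ - 1) z₁ z₂
      + theta7 α β ε n₁ n₂ * bivBI α β γ δ ε (n₁ - 1) (n₂ + 2) z₁ z₂
      + theta8 α β γ δ ε n₁ n₂ * bivBI α β γ δ ε (n₁ - 1) (n₂ + 1) z₁ z₂
      + theta9 α β γ δ ε n₁ n₂ * bivBI α β γ δ ε (n₁ - 1) n₂ z₁ z₂ := by
  have d' := raise_denominator_ne_zero h₁ n₁
  have t6 := theta6_eq (γ := γ) (δ := δ) (n₂ := n₂)
    (fun h : n₁ ≠ 0 => lower_denominator_ne_zero h₁ h) d'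
  have t5 := theta5_eq (n₁ := n₁) (n₂ := n₂) h₂
  have B := first_recB (fun h : n₁ ≠ 0 => lower_denominator_ne_zero h₁ h) d' z₂
  have b11 := bivBI_natCast α β γ δ ε (n₁ + 1) n₂ z₁ z₂
  have b12 := mul_bivBI_sub α β γ δ ε (c := theta2 α β γ δ ε n₁ n₂) (n₂ := n₂) (k := 1)
    (fun h => by rw [theta2_eq h₂, Nat.lt_one_iff.1 h, upA_zero]) (n₁ + 1) z₁ z₂
  have b13 := mul_bivBI_sub α β γ δ ε (c := theta3 α β γ δ ε n₁ n₂) (n₂ := n₂) (k := 2)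
    (fun h => by
      rw [theta3_eq]
      interval_cases n₂
      exacts [upB_zero, upB_one]) (n₁ + 1) z₁ z₂
  have b01 := bivBI_natCast α β γ δ ε n₁ (n₂ + 1) z₁ z₂
  have b00 := bivBI_natCast α β γ δ ε n₁ n₂ z₁ z₂
  have b02 := mul_bivBI_sub α β γ δ ε (c := theta6 α β γ δ ε n₁ n₂) (n₂ := n₂) (k := 1)
    (fun h => by rw [t6, Nat.lt_one_iff.1 h, recU_zero, mul_zero]) n₁ z₁ z₂
  -- The group that lowers n₁. At n₁ = 0 both sides are 0: the left by `recU_zero`, the right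
  -- because the first degree is negative.
  have low : recU n₁ β (z₂ + ε - 1 / 4) α (z₂ - ε + 1 / 4) *
      (firstFactor α β ε (n₁ - 1) z₁ z₂ * secondFactor α β γ δ ε n₁ n₂ z₂) =
      theta7 α β ε n₁ n₂ * bivBI α β γ δ ε (n₁ - 1) (n₂ + 2) z₁ z₂
      + theta8 α β γ δ ε n₁ n₂ * bivBI α β γ δ ε (n₁ - 1) (n₂ + 1) z₁ z₂
      + theta9 α β γ δ ε n₁ n₂ * bivBI α β γ δ ε (n₁ - 1) n₂ z₁ z₂ := by
    rcases n₁ with - | m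
    · rw [bivBI_of_left_neg _ _ _ _ _ (by simp), bivBI_of_left_neg _ _ _ _ _ (by simp),
        bivBI_of_left_neg _ _ _ _ _ (by simp), recU_zero]
      ring
    · have c2 := bivBI_natCast α β γ δ ε m (n₂ + 2) z₁ z₂
      have c1 := bivBI_natCast α β γ δ ε m (n₂ + 1) z₁ z₂
      have c0 := bivBI_natCast α β γ δ ε m n₂ z₁ z₂
      push_cast at c2 c1 c0 ⊢
      rw [add_sub_cancel_right, c2, c1, c0]
      linear_combination firstFactor α β ε m z₁ z₂ * mul_secondFactor_eq_down h₂ m n₂ z₂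
  push_cast at b11 b12 b13 b01 b02
  rw [b11, b12, b13, b01, b00, b02, t5, t6, theta1]
  -- The recurrence of the first factor, followed by the lowering group, the raising group, the
  -- affine form of the middle coefficient, and the recurrence of the second factor that absorbs x.
  linear_combination secondFactor α β γ δ ε n₁ n₂ z₂ * firstFactor_recurrence h₁ n₁ z₁ z₂ +
    low + firstFactor α β ε (n₁ + 1) z₁ z₂ * secondFactor_eq_up h₂ n₁ n₂ z₂ +
    firstFactor α β ε n₁ z₁ z₂ * secondFactor α β γ δ ε n₁ n₂ z₂ * B +
    theta4 α β ε n₁ * firstFactor α β ε n₁ z₁ z₂ * secondFactor_recurrence h₂ n₁ n₂ z₂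

/-! ### Polynomiality in z₁ and z₂. -/

/-- The functions of two variables that are given by a polynomial. -/
def polyFunctions : Subalgebra ℂ (ℂ × ℂ → ℂ) :=
  (MvPolynomial.aeval (R := ℂ) ![Prod.fst, Prod.snd]).range

theorem exists_eval_of_mem_polyFunctions {f : ℂ × ℂ → ℂ} (hf : f ∈ polyFunctions) :
    ∃ P : MvPolynomial (Fin 2) ℂ, ∀ z₁ z₂ : ℂ, f (z₁, z₂) = MvPolynomial.eval ![z₁, z₂] P := by
  obtain ⟨P, rfl⟩ := hf
  refine ⟨P, fun z₁ z₂ => ?_⟩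
  have h : (Pi.evalAlgHom ℂ (fun _ : ℂ × ℂ => ℂ) (z₁, z₂)).comp
      (MvPolynomial.aeval ![Prod.fst, Prod.snd]) = MvPolynomial.aeval ![z₁, z₂] := by
    ext i
    fin_cases i <;> simp
  exact DFunLike.congr_fun h P

theorem fst_mem_polyFunctions : (fun z : ℂ × ℂ => z.1) ∈ polyFunctions :=
  ⟨MvPolynomial.X 0, by simp⟩

theorem snd_mem_polyFunctions : (fun z : ℂ × ℂ => z.2) ∈ polyFunctions :=
  ⟨MvPolynomial.X 1, by simp⟩

theorem const_mem_polyFunctions (c : ℂ) : (fun _ : ℂ × ℂ => c) ∈ polyFunctions :=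
  polyFunctions.algebraMap_mem c

theorem poch_mem_polyFunctions {f : ℂ × ℂ → ℂ} (hf : f ∈ polyFunctions) (n : ℕ) :
    (fun z => poch (f z) n) ∈ polyFunctions := by
  have : (fun z => poch (f z) n) = ∏ i ∈ Finset.range n, (f + fun _ => (i : ℂ)) := by
    ext z
    simp [poch]
  rw [this]
  exact Subalgebra.prod_mem _ fun i _ => add_mem hf (const_mem_polyFunctions _)

theorem sum_mem_polyFunctions {s : Finset ℕ} {F : ℕ → ℂ × ℂ → ℂ}
    (hF : ∀ k, F k ∈ polyFunctions) : (fun z => ∑ k ∈ s, F k z) ∈ polyFunctions := by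
  have : (fun z => ∑ k ∈ s, F k z) = ∑ k ∈ s, F k := by
    ext z
    simp
  rw [this]
  exact Subalgebra.sum_mem _ fun k _ => hF k

/-- If g is constant, the divisions in `biPoly` are by constants only, and all else is sums and
products of Pochhammer symbols of polynomial functions. -/
theorem biPoly_mem_polyFunctions {x ρ₁ ρ₂ r₁ r₂ : ℂ × ℂ → ℂ} (hx : x ∈ polyFunctions)
    (h₁ : ρ₁ ∈ polyFunctions) (h₂ : ρ₂ ∈ polyFunctions) (h₃ : r₁ ∈ polyFunctions)
    (h₄ : r₂ ∈ polyFunctions) {g : ℂ} (hg : ∀ z, ρ₁ z + ρ₂ z - r₁ z - r₂ z = g) (n : ℕ) :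
    (fun z => biPoly n (x z) (ρ₁ z) (ρ₂ z) (r₁ z) (r₂ z)) ∈ polyFunctions := by
  have c := const_mem_polyFunctions
  have cg : (fun z => ρ₁ z + ρ₂ z - r₁ z - r₂ z) ∈ polyFunctions :=
    sub_mem (sub_mem (add_mem h₁ h₂) h₃) h₄
  have p : ∀ {f : ℂ × ℂ → ℂ} (_ : f ∈ polyFunctions) (k : ℕ),
      (fun z => poch (f z) k) ∈ polyFunctions := poch_mem_polyFunctions
  have hu : ∀ k : ℂ, (fun z => 1 - r₁ z - r₂ z + k) ∈ polyFunctions := fun k =>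
    add_mem (sub_mem (sub_mem (c 1) h₃) h₄) (c k)
  have hv : ∀ a k : ℂ, (fun z => ρ₁ z - r₁ z + a + k) ∈ polyFunctions := fun a k =>
    add_mem (add_mem (sub_mem h₁ h₃) (c a)) (c k)
  have hw : ∀ a k : ℂ, (fun z => ρ₂ z - r₁ z + a + k) ∈ polyFunctions := fun a k =>
    add_mem (add_mem (sub_mem h₂ h₃) (c a)) (c k)
  have ha : ∀ a : ℂ, (fun z => x z - r₁ z + a) ∈ polyFunctions := fun a =>
    add_mem (sub_mem hx h₃) (c a)
  have hb : (fun z => -x z - r₁ z + 1 / 2) ∈ polyFunctions :=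
    add_mem (sub_mem (neg_mem hx) h₃) (c _)
  unfold biPoly
  -- Dividing by (m + g + 1)_{m+p} and by k! is multiplication by a constant, whether or not that
  -- constant's denominator vanishes.
  simp only [hg, div_eq_mul_inv _ (poch _ _), div_eq_mul_inv _ ((Nat.factorial _ : ℕ) : ℂ)]
  refine mul_mem (add_mem (mul_mem (c _) (sum_mem_polyFunctions fun k => ?_))
    (mul_mem (mul_mem (c _) (ha _)) (sum_mem_polyFunctions fun k => ?_))) (c _)
  · exact mul_mem (mul_mem (mul_mem (mul_mem (mul_mem (c _) (c _)) (p (ha _) k)) (p hb k)) (c _))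
      (mul_mem (mul_mem (p (hu _) _) (p (hv _ _) _)) (p (hw _ _) _))
  · exact mul_mem (mul_mem (mul_mem (mul_mem (mul_mem (c _) (c _)) (p (ha _) k)) (p hb k)) (c _))
      (mul_mem (mul_mem (p (hu _) _) (p (hv _ _) _)) (p (hw _ _) _))

theorem bivBI_mem_polyFunctions (α β γ δ ε : ℂ) (n₁ n₂ : ℕ) :
    (fun z => bivBI α β γ δ ε n₁ n₂ z.1 z.2) ∈ polyFunctions := by
  have c := const_mem_polyFunctions
  simp only [bivBI_natCast, firstFactor, secondFactor]
  refine mul_mem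
    (biPoly_mem_polyFunctions (sub_mem fst_mem_polyFunctions (c _)) (c β)
      (sub_mem (add_mem snd_mem_polyFunctions (c ε)) (c _)) (c α)
      (add_mem (sub_mem snd_mem_polyFunctions (c ε)) (c _))
      (g := β + 2 * ε - 1 / 2 - α) (fun z => ?_) n₁)
    (biPoly_mem_polyFunctions (sub_mem (mul_mem (c _) snd_mem_polyFunctions) (c _)) (c _) (c _)
      (c _) (c _) (fun z => rfl) n₂)
  simp only [Pi.add_apply, Pi.sub_apply]
  ring

end Bivariate

end

end BannaiIto

theorem mainTheorem3 (α β γ δ ε : ℂ)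
    (h₁ : ∀ k : ℕ, -α + β + 2 * ε + 1 / 2 + (k : ℂ) ≠ 0)
    (h₂ : ∀ k : ℕ, -α + β + γ + δ + 2 * ε + 1 + (k : ℂ) ≠ 0) :
    -- the three-term recurrence relation
    (∀ (n₁ n₂ : ℕ) (z₁ z₂ : ℂ),
      ((-1) ^ n₁ * z₂ - 1 / 4) * BannaiIto.bivBI α β γ δ ε n₁ n₂ z₁ z₂ =
        BannaiIto.bivBI α β γ δ ε n₁ (n₂ + 1) z₁ z₂
        + (β + ε + (n₁ : ℂ) / 2
            - BannaiIto.coeffA n₂ (BannaiIto.secondρ₁ β ε n₁) (BannaiIto.secondρ₂ γ δ n₁)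
                (BannaiIto.secondr₁ α ε n₁) (BannaiIto.secondr₂ γ δ n₁)
            - BannaiIto.coeffC n₂ (BannaiIto.secondρ₁ β ε n₁) (BannaiIto.secondρ₂ γ δ n₁)
                (BannaiIto.secondr₁ α ε n₁) (BannaiIto.secondr₂ γ δ n₁))
          * BannaiIto.bivBI α β γ δ ε n₁ n₂ z₁ z₂
        + BannaiIto.coeffA (n₂ - 1) (BannaiIto.secondρ₁ β ε n₁) (BannaiIto.secondρ₂ γ δ n₁)
              (BannaiIto.secondr₁ α ε n₁) (BannaiIto.secondr₂ γ δ n₁)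
          * BannaiIto.coeffC n₂ (BannaiIto.secondρ₁ β ε n₁) (BannaiIto.secondρ₂ γ δ n₁)
              (BannaiIto.secondr₁ α ε n₁) (BannaiIto.secondr₂ γ δ n₁)
          * BannaiIto.bivBI α β γ δ ε n₁ (n₂ - 1) z₁ z₂) ∧
    -- the nine-term recurrence relation
    (∀ (n₁ n₂ : ℕ) (z₁ z₂ : ℂ),
      (z₁ - α ^ 2 + β ^ 2) * BannaiIto.bivBI α β γ δ ε n₁ n₂ z₁ z₂ =
        BannaiIto.theta1 n₂ * BannaiIto.bivBI α β γ δ ε (n₁ + 1) n₂ z₁ z₂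
        + BannaiIto.theta2 α β γ δ ε n₁ n₂ * BannaiIto.bivBI α β γ δ ε (n₁ + 1) (n₂ - 1) z₁ z₂
        + BannaiIto.theta3 α β γ δ ε n₁ n₂ * BannaiIto.bivBI α β γ δ ε (n₁ + 1) (n₂ - 2) z₁ z₂
        + BannaiIto.theta4 α β ε n₁ * BannaiIto.bivBI α β γ δ ε n₁ (n₂ + 1) z₁ z₂
        + BannaiIto.theta5 α β γ δ ε n₁ n₂ * BannaiIto.bivBI α β γ δ ε n₁ n₂ z₁ z₂
        + BannaiIto.theta6 α β γ δ ε n₁ n₂ * BannaiIto.bivBI α β γ δ ε n₁ (n₂ - 1) z₁ z₂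
        + BannaiIto.theta7 α β ε n₁ n₂ * BannaiIto.bivBI α β γ δ ε (n₁ - 1) (n₂ + 2) z₁ z₂
        + BannaiIto.theta8 α β γ δ ε n₁ n₂ * BannaiIto.bivBI α β γ δ ε (n₁ - 1) (n₂ + 1) z₁ z₂
        + BannaiIto.theta9 α β γ δ ε n₁ n₂ * BannaiIto.bivBI α β γ δ ε (n₁ - 1) n₂ z₁ z₂) ∧
    -- the `B_{n₁,n₂}` are polynomials in `z₁, z₂`
    (∀ n₁ n₂ : ℕ, ∃ P : MvPolynomial (Fin 2) ℂ, ∀ z₁ z₂ : ℂ,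
      BannaiIto.bivBI α β γ δ ε n₁ n₂ z₁ z₂ = MvPolynomial.eval ![z₁, z₂] P) := by
  refine ⟨fun n₁ n₂ z₁ z₂ => ?_, BannaiIto.bivBI_nine_term h₁ h₂, fun n₁ n₂ => ?_⟩
  · have h := BannaiIto.bivBI_three_term h₂ n₁ n₂ z₁ z₂
    rw [BannaiIto.recB_eq, BannaiIto.recU_eq] at h
    exact h
  · exact BannaiIto.exists_eval_of_mem_polyFunctions
      (BannaiIto.bivBI_mem_polyFunctions α β γ δ ε n₁ n₂)
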